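/- Notation. For $\varepsilon>0$, $\varepsilon\ne1$, set $\omega(\varepsilon):=\varepsilon|\log\varepsilon|^{1/2}$ and, for an open set $\Omega\subseteq\mathbb{R}$ and $u\in H^2(\Omega)$, $$\mathrm{RPM}_\varepsilon(\Omega,u):=\int_\Omega\Big\{\varepsilon^6u''(x)^2+\frac{1}{\omega(\varepsilon)^2}\log\big(1+u'(x)^2\big)\Big\}\,dx ,\qquad \alpha_0:=\frac{16}{\sqrt3}.$$ A sequence $u_n\in BV(\Omega)$ converges strictly in $BV(\Omega)$ to $u\in BV(\Omega)$ if $u_n\to u$ in $L^1(\Omega)$ and $|Du_n|(\Omega)\to|Du|(\Omega)$. Let $C:\mathbb{R}\to\mathbb{R}$ be the function with $C(x)=-1$ for $x\le-1$, $C(x)=\frac32x-\frac12x^3$ for $x\in[-1,1]$, and $C(x)=1$ for $x\ge1$. For $\Lambda,V>0$ set $C_{\Lambda,V}(x):=V\,C(x/\Lambda)$, and for $\tau_0\in(-1,1)$ set $C_{\Lambda,V,\tau_0}(x):=C_{\Lambda,V}(x+x_0)-\tau_0V$, where $x_0$ is the unique point of $(-\Lambda,\Lambda)$ such that $C_{\Lambda,V}(x_0)=\tau_0V$.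 Theorem. Let $L>0$, let $\varepsilon_n\to0^+$ be a sequence of positive real numbers, and let $\{v_n\}\subseteq H^2((-L,L))$ be functions, identified with their continuous representatives on $[-L,L]$, such that $v_n(0)=0$ for every $n$. Assume that there exist real numbers $V>0$ and $\tau_0\in(-1,1)$ such that $$v_n(y)\to V(\operatorname{sign}(y)-\tau_0)\quad\text{strictly in }BV((-L,L)),$$ and that the limit of $\mathrm{RPM}_{\varepsilon_n}((-L,L),v_n)$ as $n\to+\infty$ exists and satisfies $$\lim_{n\to+\infty}\mathrm{RPM}_{\varepsilon_n}((-L,L),v_n)\le\alpha_0\sqrt{2V}.$$ Set $w_n(y):=v_n(\varepsilon_n^2y)$ and $\Lambda:=\frac{\sqrt3}{2}\sqrt{2V}$. Then $$\lim_{n\to+\infty}\max\big\{|w_n(y)-C_{\Lambda,V,\tau_0}(y)|:|y|\le L/\varepsilon_n^2\big\}=0,$$ and for every bounded interval $(a,b)\subseteq\mathbb{R}$ (where $w_n$ is defined and of class $H^2$ for all large $n$) it holds that $$w_n'\to C_{\Lambda,V,\tau_0}'\ \text{ uniformly in }(a,b),\qquad w_n''\to C_{\Lambda,V,\tau_0}''\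 \text{ strongly in }L^2((a,b)).$$ -/

import Mathlib

open scoped ENNReal ContDiff Topology

noncomputable section

namespace PeronaMalik

/-- `g` is a weak derivative of `f` in the open set `Ω ⊆ ℝ`: both functions are locally integrable
in `Ω`, and `∫ f φ' = - ∫ g φ` for every test function `φ` of class `C^∞` with compact support
contained in `Ω`. -/
def HasWeakDeriv (Ω : Set ℝ) (f g : ℝ → ℝ) : Prop :=
  MeasureTheory.LocallyIntegrableOn f Ω ∧ MeasureTheory.LocallyIntegrableOn g Ω ∧
    ∀ φ : ℝ → ℝ, ContDiff ℝ ∞ φ → HasCompactSupport φ → tsupport φ ⊆ Ω →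
      ∫ x in Ω, f x * deriv φ x = -∫ x in Ω, g x * φ x

open Classical in
/-- The weak derivative of `f` in the open set `Ω`, which is unique up to equality almost
everywhere in `Ω` when it exists (and `0` by convention when it does not exist). -/
def weakDeriv (Ω : Set ℝ) (f : ℝ → ℝ) : ℝ → ℝ :=
  if h : ∃ g, HasWeakDeriv Ω f g then h.choose else 0

/-- The Sobolev space `H²(Ω)`: `u` and its weak derivatives of order one and two are in `L²(Ω)`. -/
def MemH2 (Ω : Set ℝ) (u : ℝ → ℝ) : Prop :=
  MeasureTheory.MemLp u 2 (MeasureTheory.volume.restrict Ω) ∧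
    ∃ u₁ u₂ : ℝ → ℝ,
      MeasureTheory.MemLp u₁ 2 (MeasureTheory.volume.restrict Ω) ∧
      MeasureTheory.MemLp u₂ 2 (MeasureTheory.volume.restrict Ω) ∧
      HasWeakDeriv Ω u u₁ ∧ HasWeakDeriv Ω u₁ u₂

/-- The total variation `|Du|(Ω)` of the distributional derivative of `u` in the open set `Ω`: the
supremum of `∫ u φ'` over all `φ` of class `C¹` with compact support in `Ω` and `|φ| ≤ 1`. -/
def totalVariation (Ω : Set ℝ) (u : ℝ → ℝ) : ℝ≥0∞ :=
  ⨆ φ : {φ : ℝ → ℝ // ContDiff ℝ 1 φ ∧ HasCompactSupport φ ∧ tsupport φ ⊆ Ω ∧ ∀ x, |φ x| ≤ 1},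
    ENNReal.ofReal (∫ x in Ω, u x * deriv φ.1 x)

/-- The space `BV(Ω)`. -/
def MemBV (Ω : Set ℝ) (u : ℝ → ℝ) : Prop :=
  MeasureTheory.IntegrableOn u Ω ∧ totalVariation Ω u < ⊤

/-- Strict convergence in `BV(Ω)`: convergence in `L¹(Ω)` together with convergence of the total
variations. -/
def StrictTendstoBV (Ω : Set ℝ) (u : ℕ → ℝ → ℝ) (u₀ : ℝ → ℝ) : Prop :=
  (∀ n, MemBV Ω (u n)) ∧ MemBV Ω u₀ ∧
    Filter.Tendsto (fun n => ∫ x in Ω, |u n x - u₀ x|) Filter.atTop (𝓝 0) ∧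
    Filter.Tendsto (fun n => totalVariation Ω (u n)) Filter.atTop (𝓝 (totalVariation Ω u₀))

/-- `ω(ε) = ε |log ε|^{1/2}`. -/
def omega (ε : ℝ) : ℝ := ε * Real.sqrt |Real.log ε|

/-- The rescaled functional
`RPM_ε(Ω, u) = ∫_Ω { ε⁶ u''(x)² + ω(ε)⁻² log (1 + u'(x)²) } dx`, with weak derivatives. -/
def RPM (ε : ℝ) (Ω : Set ℝ) (u : ℝ → ℝ) : ℝ :=
  ∫ x in Ω, (ε ^ 6 * weakDeriv Ω (weakDeriv Ω u) x ^ 2 +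
    1 / omega ε ^ 2 * Real.log (1 + weakDeriv Ω u x ^ 2))

/-- `α₀ = 16 / √3`. -/
def alpha0 : ℝ := 16 / Real.sqrt 3

/-- The function `C`: `-1` for `x ≤ -1`, `(3/2) x - (1/2) x³` on `[-1, 1]`, and `1` for `x ≥ 1`. -/
def cubicProfile (x : ℝ) : ℝ :=
  if x ≤ -1 then -1 else if x ≤ 1 then 3 / 2 * x - 1 / 2 * x ^ 3 else 1

/-- The canonical `(Λ, V)`-cubic connection `C_{Λ,V}(x) = V C(x / Λ)`. -/
def cubicConnection (Λ V x : ℝ) : ℝ := V * cubicProfile (x / Λ)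

/-- The point `x₀ ∈ (-Λ, Λ)` with `C_{Λ,V}(x₀) = τ₀ V`; see `cubicShift_spec` and
`cubicShift_unique`. -/
def cubicShift (Λ V τ₀ : ℝ) : ℝ :=
  Classical.epsilon fun x₀ : ℝ => x₀ ∈ Set.Ioo (-Λ) Λ ∧ cubicConnection Λ V x₀ = τ₀ * V

/-- The graph translation `C_{Λ,V,τ₀}(x) = C_{Λ,V}(x + x₀) - τ₀ V`. -/
def cubicTranslate (Λ V τ₀ x : ℝ) : ℝ :=
  cubicConnection Λ V (x + cubicShift Λ V τ₀) - τ₀ * V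

theorem cubicConnection_of_mem {Λ V x : ℝ} (hΛ : 0 < Λ) (hx : x ∈ Set.Ioo (-Λ) Λ) :
    cubicConnection Λ V x = V * (3 / 2 * (x / Λ) - 1 / 2 * (x / Λ) ^ 3) := by
  have h1 : -1 < x / Λ := by rw [lt_div_iff₀ hΛ]; linarith [hx.1]
  have h2 : x / Λ < 1 := by rw [div_lt_iff₀ hΛ]; linarith [hx.2]
  simp [cubicConnection, cubicProfile, not_le.mpr h1, h2.le]

theorem cubicShift_spec {Λ V τ₀ : ℝ} (hΛ : 0 < Λ) (hτ : τ₀ ∈ Set.Ioo (-1 : ℝ) 1) :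
    cubicShift Λ V τ₀ ∈ Set.Ioo (-Λ) Λ ∧
      cubicConnection Λ V (cubicShift Λ V τ₀) = τ₀ * V := by
  refine Classical.epsilon_spec
    (p := fun x₀ : ℝ => x₀ ∈ Set.Ioo (-Λ) Λ ∧ cubicConnection Λ V x₀ = τ₀ * V) ?_
  have hc : ContinuousOn (fun t : ℝ => 3 / 2 * t - 1 / 2 * t ^ 3) (Set.Icc (-1) 1) := by
    fun_prop
  obtain ⟨t, ht, hft⟩ := intermediate_value_Ioo (by norm_num : (-1 : ℝ) ≤ 1) hc
    (show τ₀ ∈ _ from ⟨by norm_num; exact hτ.1, by norm_num; exact hτ.2⟩)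
  have hm : Λ * t ∈ Set.Ioo (-Λ) Λ := ⟨by nlinarith [ht.1], by nlinarith [ht.2]⟩
  refine ⟨Λ * t, hm, ?_⟩
  rw [cubicConnection_of_mem hΛ hm, mul_div_cancel_left₀ _ hΛ.ne', mul_comm]
  exact congrArg (· * V) hft

theorem cubicShift_unique {Λ V τ₀ x : ℝ} (hΛ : 0 < Λ) (hV : 0 < V)
    (hτ : τ₀ ∈ Set.Ioo (-1 : ℝ) 1) (hx : x ∈ Set.Ioo (-Λ) Λ)
    (hxτ : cubicConnection Λ V x = τ₀ * V) : x = cubicShift Λ V τ₀ := by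
  obtain ⟨hs, hsτ⟩ := cubicShift_spec (V := V) hΛ hτ
  set y := cubicShift Λ V τ₀
  rw [cubicConnection_of_mem hΛ hx] at hxτ
  rw [cubicConnection_of_mem hΛ hs] at hsτ
  have b : ∀ z ∈ Set.Ioo (-Λ) Λ, -1 < z / Λ ∧ z / Λ < 1 := fun z hz =>
    ⟨by rw [lt_div_iff₀ hΛ]; linarith [hz.1], by rw [div_lt_iff₀ hΛ]; linarith [hz.2]⟩
  obtain ⟨a1, a2⟩ := b x hx
  obtain ⟨b1, b2⟩ := b y hs
  have h := mul_left_cancel₀ hV.ne' (hxτ.trans hsτ.symm)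
  have hp : (x / Λ - y / Λ) *
      (3 - ((x / Λ) ^ 2 + (x / Λ) * (y / Λ) + (y / Λ) ^ 2)) = 0 := by linarith
  have hne : 3 - ((x / Λ) ^ 2 + (x / Λ) * (y / Λ) + (y / Λ) ^ 2) ≠ 0 := by
    nlinarith [mul_pos (by linarith : 0 < 1 - x / Λ) (by linarith : 0 < 1 + x / Λ),
      mul_pos (by linarith : 0 < 1 - y / Λ) (by linarith : 0 < 1 + y / Λ),
      sq_nonneg (x / Λ - y / Λ)]
  have := (mul_eq_zero.mp hp).resolve_right hne
  field_simp at this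
  linarith

end PeronaMalik

end

open scoped ENNReal ContDiff Topology

open MeasureTheory Set Filter

noncomputable section

namespace PeronaMalik

/-! ### Weak derivatives on intervals and their primitives. -/

section

/-! After the blow-up x = ε²y the energy becomes the integral over |y| ≤ L/ε² of r² + s⁻² log(1 +
(p/ε²)²), with p = w', r = w'' and s = |log ε|^{1/2} (`IsH2Rep.RPM_eq_rescaledEnergy`). For the
threshold δ = exp(-2s), the logarithmic term costs at least 4 - 4/s per unit length where p > δ
(`integral_sq_add_measure_le_rescaledEnergy`), while the part of p below δ contributes a vanishing
amount to the growth of w (`integral_min_max_le`). In the limit, a height 2V has to be climbed at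
cost ∫ r² + 4 |{p > δ}|.

Consider a component of {p > δ} of length ℓ on which p - δ has integral J. Projecting r onto the
affine function vanishing at the midpoint gives ∫ r² ≥ 12 J²/ℓ³ (`IsH2Rep.le_integral_sq`), and
minimising 12 J²/ℓ³ + 4ℓ over ℓ gives the cost α₀√J (`alpha0_mul_sqrt_le`). Splitting the height
among several components is more expensive: if every J is at most S², then α₀ times the total height
is at most S times the energy. Since the energy is asymptotically at most α₀√(2V), a single
component (α, β) must have J → 2V (`AlmostOptimal.exists_isBump`).

On this component all the inequalities are asymptotically equalities. Hence β - α → √3 √(2V) = 2Λ,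
and the defect in the projection inequality, which is exactly a squared L² distance from r to an
affine function extended by zero, tends to 0. Strict convergence bounds the total variation of w by
2V + o(1), so w is almost constant outside (α, β). The normalisation w(0) = 0 selects the horizontal
translation: the height reached at 0 is an increasing cubic function of the relative position of 0
in (α, β), and inverting it gives α → -x₀ - Λ (`AlmostOptimalBump.tendsto_left`). Convergence of r
in L² is then integrated once to control p on bounded intervals, and once more to control w, with
the small oscillation outside the component handling large |y|. -/

theorem integrableOn_mul_of_hasCompactSupport {Ω : Set ℝ} (hΩ : IsOpen Ω) {g φ : ℝ → ℝ}
    (hg : LocallyIntegrableOn g Ω) (hφ : Continuous φ) (hc : HasCompactSupport φ)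
    (hs : tsupport φ ⊆ Ω) : IntegrableOn (fun x => g x * φ x) Ω := by
  have h1 : IntegrableOn (fun x => g x * φ x) (tsupport φ) :=
    (hg.integrableOn_compact_subset hs hc).mul_continuousOn hφ.continuousOn hc
  refine h1.of_forall_sdiff_eq_zero hΩ.measurableSet fun x hx => ?_
  rw [image_eq_zero_of_notMem_tsupport hx.2, mul_zero]

theorem HasWeakDeriv.congr {Ω : Set ℝ} {f f' g g' : ℝ → ℝ}
    (h : HasWeakDeriv Ω f g) (hf : f =ᵐ[volume.restrict Ω] f')
    (hg : g =ᵐ[volume.restrict Ω] g') : HasWeakDeriv Ω f' g' := by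
  obtain ⟨h1, h2, h3⟩ := h
  have key : ∀ {u u' : ℝ → ℝ}, u =ᵐ[volume.restrict Ω] u' → LocallyIntegrableOn u Ω →
      LocallyIntegrableOn u' Ω := by
    intro u u' huu hu x hx
    obtain ⟨s, hs, hi⟩ := hu x hx
    refine ⟨s ∩ Ω, inter_mem hs self_mem_nhdsWithin, ?_⟩
    refine (hi.mono_set inter_subset_left).congr_fun_ae ?_
    exact ae_restrict_of_ae_restrict_of_subset inter_subset_right huu
  refine ⟨key hf h1, key hg h2, fun φ a b c => ?_⟩
  have e1 : ∫ x in Ω, f x * deriv φ x = ∫ x in Ω, f' x * deriv φ x :=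
    integral_congr_ae (hf.mul (ae_eq_refl (deriv φ)))
  have e2 : ∫ x in Ω, g x * φ x = ∫ x in Ω, g' x * φ x :=
    integral_congr_ae (hg.mul (ae_eq_refl φ))
  rw [← e1, ← e2]
  exact h3 φ a b c

theorem HasWeakDeriv.ae_eq {Ω : Set ℝ} (hΩ : IsOpen Ω) {f g g' : ℝ → ℝ}
    (h : HasWeakDeriv Ω f g) (h' : HasWeakDeriv Ω f g') : g =ᵐ[volume.restrict Ω] g' := by
  have h0 := hΩ.ae_eq_zero_of_integral_contDiff_smul_eq_zero (μ := volume)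
    (h.2.1.sub h'.2.1) fun φ hφ hc hs => by
    have e1 := h.2.2 φ hφ hc hs
    have e2 := h'.2.2 φ hφ hc hs
    have i1 := integrableOn_mul_of_hasCompactSupport hΩ h.2.1 hφ.continuous hc hs
    have i2 := integrableOn_mul_of_hasCompactSupport hΩ h'.2.1 hφ.continuous hc hs
    rw [← setIntegral_eq_integral_of_forall_compl_eq_zero (s := Ω)]
    · calc ∫ x in Ω, φ x • (g - g') x = ∫ x in Ω, (g x * φ x - g' x * φ x) := by
            congr 1; ext x; simp [smul_eq_mul]; ring
        _ = 0 := by rw [integral_sub i1 i2]; linarith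
    · intro x hx
      rw [image_eq_zero_of_notMem_tsupport fun hh => hx (hs hh), zero_smul]
  rw [EventuallyEq, ae_restrict_iff' hΩ.measurableSet]
  filter_upwards [h0] with x hx hxΩ
  have := hx hxΩ
  simp only [Pi.sub_apply] at this
  linarith

theorem HasWeakDeriv.weakDeriv_ae_eq {Ω : Set ℝ} (hΩ : IsOpen Ω) {f g : ℝ → ℝ}
    (h : HasWeakDeriv Ω f g) : weakDeriv Ω f =ᵐ[volume.restrict Ω] g := by
  have hex : ∃ g, HasWeakDeriv Ω f g := ⟨g, h⟩
  rw [weakDeriv, dif_pos hex]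
  exact hex.choose_spec.ae_eq hΩ h

/-- The outer `weakDeriv` acts on the function chosen by the inner one, which agrees with `g` only
almost everywhere; being a weak derivative is insensitive to such changes. -/
theorem HasWeakDeriv.weakDeriv_weakDeriv_ae_eq {Ω : Set ℝ} (hΩ : IsOpen Ω) {f g k : ℝ → ℝ}
    (h : HasWeakDeriv Ω f g) (h' : HasWeakDeriv Ω g k) :
    weakDeriv Ω (weakDeriv Ω f) =ᵐ[volume.restrict Ω] k :=
  (h'.congr (h.weakDeriv_ae_eq hΩ).symm (ae_eq_refl _)).weakDeriv_ae_eq hΩ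

/-- Since `g` is merely integrable, `f` need not be differentiable everywhere. Its primitive is
absolutely continuous with derivative `g` almost everywhere, which is enough to integrate by parts.
-/
theorem integral_mul_deriv_of_primitive {a b : ℝ} {f g φ φ' : ℝ → ℝ}
    (hg : IntervalIntegrable g volume a b)
    (hf : ∀ x ∈ uIcc a b, f x = f a + ∫ t in a..x, g t)
    (hφ : ∀ x, HasDerivAt φ (φ' x) x) (hφ' : Continuous φ') :
    ∫ x in a..b, f x * φ' x = f b * φ b - f a * φ a - ∫ x in a..b, g x * φ x := by
  set F : ℝ → ℝ := fun x => ∫ t in a..x, g t with hF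
  have hFac : AbsolutelyContinuousOnInterval F a b :=
    hg.absolutelyContinuousOnInterval_intervalIntegral left_mem_uIcc
  have hd : deriv φ = φ' := funext fun x => (hφ x).deriv
  have hφc : ContDiff ℝ 1 φ := contDiff_one_iff_deriv.2
    ⟨fun x => (hφ x).differentiableAt, by rw [hd]; exact hφ'⟩
  have hφac : AbsolutelyContinuousOnInterval φ a b :=
    hφc.contDiffOn.absolutelyContinuousOnInterval
  have e1 := hFac.integral_mul_deriv_eq_deriv_mul hφac
  have e2 : ∫ x in a..b, deriv F x * φ x = ∫ x in a..b, g x * φ x := by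
    refine intervalIntegral.integral_congr_ae ?_
    filter_upwards [hg.ae_hasDerivAt_integral] with x hx hxm
    rw [(hx (uIoc_subset_uIcc hxm) a left_mem_uIcc).deriv]
  have e3 : ∫ x in a..b, f x * φ' x = ∫ x in a..b, (f a * φ' x + F x * φ' x) := by
    refine intervalIntegral.integral_congr fun x hx => ?_
    simp only [hF]
    rw [hf x hx]; ring
  have hFi : IntervalIntegrable (fun x => F x * φ' x) volume a b :=
    (hFac.continuousOn.mul hφ'.continuousOn).intervalIntegrable
  rw [e3, intervalIntegral.integral_add ((hφ'.const_mul _).intervalIntegrable _ _) hFi,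
    intervalIntegral.integral_const_mul,
    intervalIntegral.integral_eq_sub_of_hasDerivAt (fun x _ => hφ x)
      (hφ'.intervalIntegrable _ _)]
  rw [hd] at e1
  rw [e1, e2, hf b right_mem_uIcc]
  simp [hF]
  ring

theorem hasWeakDeriv_of_primitive {a b : ℝ} (hab : a < b) {f g : ℝ → ℝ}
    (hg : IntegrableOn g (Ioo a b)) {c m : ℝ} (hm : m ∈ Icc a b)
    (hf : ∀ x ∈ Ioo a b, f x = c + ∫ t in m..x, g t) : HasWeakDeriv (Ioo a b) f g := by
  have hgi : IntervalIntegrable g volume a b := by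
    rw [intervalIntegrable_iff_integrableOn_Ioo_of_le hab.le]; exact hg
  have hgi' : ∀ {x y}, x ∈ Icc a b → y ∈ Icc a b → IntervalIntegrable g volume x y :=
    fun hx hy => hgi.mono_set (by rw [uIcc_of_le hab.le]; exact (uIcc_subset_Icc hx hy))
  set F : ℝ → ℝ := fun x => (c - ∫ t in a..m, g t) + ∫ t in a..x, g t with hF
  have hfF : ∀ x ∈ Ioo a b, f x = F x := fun x hx => by
    rw [hf x hx, hF]
    have := intervalIntegral.integral_add_adjacent_intervals
      (hgi' (left_mem_Icc.2 hab.le) hm) (hgi' hm (Ioo_subset_Icc_self hx))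
    simp only; linarith
  have hFc : ContinuousOn F (Icc a b) := by
    have := (hgi.absolutelyContinuousOnInterval_intervalIntegral
      (c := a) left_mem_uIcc).continuousOn
    rw [uIcc_of_le hab.le] at this
    exact continuousOn_const.add this
  refine ⟨?_, hg.locallyIntegrableOn, fun φ hφ hc hs => ?_⟩
  · refine ContinuousOn.locallyIntegrableOn ?_ measurableSet_Ioo
    exact (hFc.mono Ioo_subset_Icc_self).congr hfF
  · have e := integral_mul_deriv_of_primitive (f := F) (φ := φ) (φ' := deriv φ) hgi
      (fun x _ => by simp [hF])
      (fun x => (hφ.differentiable (by simp) x).hasDerivAt)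
      (hφ.continuous_deriv (by simp))
    have ha : φ a = 0 := image_eq_zero_of_notMem_tsupport fun h => (hs h).1.ne rfl
    have hb : φ b = 0 := image_eq_zero_of_notMem_tsupport fun h => (hs h).2.ne rfl
    rw [ha, hb, intervalIntegral.integral_of_le hab.le, intervalIntegral.integral_of_le hab.le,
      integral_Ioc_eq_integral_Ioo, integral_Ioc_eq_integral_Ioo] at e
    rw [setIntegral_congr_fun measurableSet_Ioo (fun x hx => by
      show f x * deriv φ x = F x * deriv φ x
      rw [hfF x hx]), e]
    ring

/-- Du Bois-Reymond's lemma. Subtracting from a test function ψ its mass times a fixed normalised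
bump θ leaves a function ρ of zero integral, whose primitive is again a test function. Hence h and
the constant ∫ hθ have the same integral against every ψ. -/
theorem ae_eq_const_of_integral_mul_deriv_eq_zero {a b : ℝ} (hab : a < b) {h : ℝ → ℝ}
    (hh : LocallyIntegrableOn h (Ioo a b))
    (h0 : ∀ φ : ℝ → ℝ, ContDiff ℝ ∞ φ → HasCompactSupport φ → tsupport φ ⊆ Ioo a b →
      ∫ x in Ioo a b, h x * deriv φ x = 0) :
    ∃ c : ℝ, h =ᵐ[volume.restrict (Ioo a b)] fun _ => c := by
  let B : ContDiffBump ((a + b) / 2) :=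
    ⟨(b - a) / 8, (b - a) / 4, by linarith, by linarith⟩
  set θ : ℝ → ℝ := B.normed volume with hθ
  have hθs : ContDiff ℝ ∞ θ := B.contDiff_normed
  have hθc : HasCompactSupport θ := B.hasCompactSupport_normed
  have hθt : tsupport θ ⊆ Ioo a b := by
    rw [hθ, B.tsupport_normed_eq, Real.closedBall_eq_Icc]
    intro x hx
    have h1 := hx.1
    have h2 := hx.2
    simp only [B] at h1 h2
    constructor <;> linarith
  have hθi : ∫ x, θ x = 1 := B.integral_normed
  set c := ∫ x in Ioo a b, h x * θ x with hcdef
  refine ⟨c, ?_⟩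
  have hΩ : IsOpen (Ioo a b) := isOpen_Ioo
  have key := hΩ.ae_eq_zero_of_integral_contDiff_smul_eq_zero (μ := volume)
    (hh.sub (locallyIntegrableOn_const (μ := volume) (s := Ioo a b) c))
    fun ψ hψ hψc hψs => by
    set m := ∫ x, ψ x with hm
    set ρ : ℝ → ℝ := fun x => ψ x - m * θ x with hρ
    have hρs : ContDiff ℝ ∞ ρ := hψ.sub (contDiff_const.mul hθs)
    set K := tsupport ψ ∪ tsupport θ with hK
    have hKc : IsCompact K := hψc.isCompact.union hθc.isCompact
    have hKs : K ⊆ Ioo a b := union_subset hψs hθt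
    have hKne : K.Nonempty := by
      by_contra hne
      rw [not_nonempty_iff_eq_empty] at hne
      have : ∀ x, θ x = 0 := fun x => image_eq_zero_of_notMem_tsupport fun hx => by
        have : x ∈ K := Or.inr hx
        rw [hne] at this; exact this
      simp [this] at hθi
    have hρ0 : ∀ x, x ∉ K → ρ x = 0 := fun x hx => by
      simp only [hρ]
      rw [image_eq_zero_of_notMem_tsupport fun h => hx (Or.inl h),
        image_eq_zero_of_notMem_tsupport fun h => hx (Or.inr h)]
      ring
    have hρi : ∫ x, ρ x = 0 := by
      simp only [hρ]
      rw [integral_sub (hψ.continuous.integrable_of_hasCompactSupport hψc)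
        ((hθs.continuous.integrable_of_hasCompactSupport hθc).const_mul m),
        integral_const_mul, hθi]
      simp [hm]
    have ha' := hKs (hKc.sInf_mem hKne)
    have hb' := hKs (hKc.sSup_mem hKne)
    set φ : ℝ → ℝ := fun x => ∫ t in a..x, ρ t with hφ
    have hφd : ∀ x, HasDerivAt φ (ρ x) x := fun x =>
      (hρs.continuous.integral_hasStrictDerivAt a x).hasDerivAt
    have hφd' : deriv φ = ρ := funext fun x => (hφd x).deriv
    have hφs : ContDiff ℝ ∞ φ := contDiff_infty_iff_deriv.2
      ⟨fun x => (hφd x).differentiableAt, by rw [hφd']; exact hρs⟩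
    -- To the left of the support nothing has been integrated yet; to the right, everything has, and
    -- the total is zero.
    have hφ0 : ∀ x, x ∉ Icc (sInf K) (sSup K) → φ x = 0 := by
      intro x hx
      rcases lt_or_ge x (sInf K) with hlt | hge
      · refine (intervalIntegral.integral_congr (g := fun _ => (0 : ℝ)) fun t ht => ?_).trans
          (by simp)
        refine hρ0 t fun htK => ?_
        have h1 := csInf_le hKc.bddBelow htK
        have h2 : t ≤ max a x := ht.2
        have := max_lt ha'.1 hlt
        linarith
      · have hgt : sSup K < x := by
          by_contra hcon
          exact hx ⟨hge, not_lt.1 hcon⟩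
        have : a ≤ x := by linarith [ha'.1]
        rw [hφ]
        simp only
        rw [intervalIntegral.integral_of_le this, setIntegral_eq_integral_of_forall_compl_eq_zero,
          hρi]
        intro t ht
        refine hρ0 t fun htK => ht ⟨(hKs htK).1, ?_⟩
        exact (le_csSup hKc.bddAbove htK).trans hgt.le
    have hφsub : tsupport φ ⊆ Icc (sInf K) (sSup K) :=
      closure_minimal (fun x hx => by
        by_contra hcon
        exact hx (hφ0 x hcon)) isClosed_Icc
    have hφc : HasCompactSupport φ := isCompact_Icc.of_isClosed_subset (isClosed_tsupport _) hφsub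
    have e := h0 φ hφs hφc (hφsub.trans fun x hx =>
      ⟨ha'.1.trans_le hx.1, hx.2.trans_lt hb'.2⟩)
    rw [hφd'] at e
    have i1 := integrableOn_mul_of_hasCompactSupport hΩ hh hψ.continuous hψc hψs
    have i2 := integrableOn_mul_of_hasCompactSupport hΩ hh hθs.continuous hθc hθt
    have i3 : IntegrableOn ψ (Ioo a b) :=
      (hψ.continuous.integrable_of_hasCompactSupport hψc).integrableOn
    have e1 : ∫ x in Ioo a b, h x * ρ x
        = (∫ x in Ioo a b, h x * ψ x) - m * c := by
      rw [hcdef, ← integral_const_mul, ← integral_sub i1 (i2.const_mul m)]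
      congr 1; ext x; simp only [hρ]; ring
    have hm' : ∫ x in Ioo a b, ψ x = m := by
      rw [hm]
      refine setIntegral_eq_integral_of_forall_compl_eq_zero fun x hx =>
        image_eq_zero_of_notMem_tsupport fun hxs => hx (hψs hxs)
    rw [← setIntegral_eq_integral_of_forall_compl_eq_zero (s := Ioo a b)]
    · calc ∫ x in Ioo a b, ψ x • (h - (fun _ => c : ℝ → ℝ)) x
          = ∫ x in Ioo a b, (h x * ψ x - c * ψ x) := by
            congr 1; ext x; simp [smul_eq_mul]; ring
        _ = 0 := by
            rw [integral_sub i1 (i3.const_mul c), integral_const_mul, hm']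
            linarith
    · intro x hx
      rw [image_eq_zero_of_notMem_tsupport fun hxs => hx (hψs hxs), zero_smul]
  rw [EventuallyEq, ae_restrict_iff' measurableSet_Ioo]
  filter_upwards [key] with x hx hxm
  have := hx hxm
  simp only [Pi.sub_apply] at this
  linarith

theorem HasWeakDeriv.exists_ae_eq_primitive {a b : ℝ} (hab : a < b) {f g : ℝ → ℝ}
    (h : HasWeakDeriv (Ioo a b) f g) (hg : IntegrableOn g (Ioo a b)) {m : ℝ}
    (hm : m ∈ Icc a b) :
    ∃ c : ℝ, f =ᵐ[volume.restrict (Ioo a b)] fun x => c + ∫ t in m..x, g t := by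
  have h1 : HasWeakDeriv (Ioo a b) (fun x => ∫ t in m..x, g t) g :=
    hasWeakDeriv_of_primitive hab hg (c := 0) hm fun x _ => by simp
  obtain ⟨c, hc⟩ := ae_eq_const_of_integral_mul_deriv_eq_zero hab (h.1.sub h1.1)
    fun φ hφ hφc hs => by
    have i1 := integrableOn_mul_of_hasCompactSupport isOpen_Ioo h.1
      (hφ.continuous_deriv (by simp)) hφc.deriv (tsupport_deriv_subset.trans hs)
    have i2 := integrableOn_mul_of_hasCompactSupport isOpen_Ioo h1.1
      (hφ.continuous_deriv (by simp)) hφc.deriv (tsupport_deriv_subset.trans hs)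
    have e1 := h.2.2 φ hφ hφc hs
    have e2 := h1.2.2 φ hφ hφc hs
    simp only [Pi.sub_apply, sub_mul]
    rw [integral_sub i1 i2, e1, e2]
    ring
  refine ⟨c, ?_⟩
  filter_upwards [hc] with x hx
  simp only [Pi.sub_apply] at hx
  linarith

end

/-! ### Representatives of H² functions, and total variation. -/

section

/-- `p` and `r` represent the first and the second derivative of `u` on `[a, b]`, in the sense that
`u` is a primitive of `p` on `[a, b]` and `p` is a primitive of `r ∈ L¹(ℝ) ∩ L²(ℝ)` on `ℝ`. -/
structure IsH2Rep (a b : ℝ) (u p r : ℝ → ℝ) : Prop where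
  integrable : Integrable r
  integrable_sq : Integrable fun x => r x ^ 2
  sub_eq : ∀ x y, p y - p x = ∫ t in x..y, r t
  sub_eq' : ∀ x ∈ Icc a b, ∀ y ∈ Icc a b, u y - u x = ∫ t in x..y, p t

variable {a b : ℝ} {u p r : ℝ → ℝ}

theorem IsH2Rep.continuous (h : IsH2Rep a b u p r) : Continuous p := by
  have : p = fun y => p 0 + ∫ t in (0 : ℝ)..y, r t := by
    ext y; rw [← h.sub_eq 0 y]; ring
  rw [this]
  exact continuous_const.add (intervalIntegral.continuous_primitive
    (fun x y => h.integrable.intervalIntegrable) 0)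

theorem IsH2Rep.mono (h : IsH2Rep a b u p r) {c d : ℝ} (hs : Icc c d ⊆ Icc a b) :
    IsH2Rep c d u p r :=
  ⟨h.1, h.2, h.3, fun x hx y hy => h.4 x (hs hx) y (hs hy)⟩

theorem IsH2Rep.hasDerivAt (h : IsH2Rep a b u p r) {x : ℝ} (hx : x ∈ Ioo a b) :
    HasDerivAt u (p x) x := by
  have h1 : HasDerivAt (fun y => u x + ∫ t in x..y, p t) (p x) x :=
    (h.continuous.integral_hasStrictDerivAt x x).hasDerivAt.const_add _
  refine h1.congr_of_eventuallyEq ?_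
  filter_upwards [Ioo_mem_nhds hx.1 hx.2] with y hy
  rw [← h.sub_eq' x (Ioo_subset_Icc_self hx) y (Ioo_subset_Icc_self hy)]; ring

theorem IsH2Rep.continuousOn (h : IsH2Rep a b u p r) : ContinuousOn u (Icc a b) := by
  rcases lt_or_ge b a with hab | hab
  · rw [Icc_eq_empty (not_le.2 hab)]; exact continuousOn_empty _
  have : ContinuousOn (fun y => u a + ∫ t in a..y, p t) (Icc a b) :=
    (continuous_const.add (intervalIntegral.continuous_primitive
      (fun x y => h.continuous.intervalIntegrable x y) a)).continuousOn
  refine this.congr fun y hy => ?_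
  simp only
  rw [← h.sub_eq' a (left_mem_Icc.2 hab) y hy]; ring

theorem IsH2Rep.hasWeakDeriv_left (h : IsH2Rep a b u p r) (hab : a < b) :
    HasWeakDeriv (Ioo a b) u p :=
  hasWeakDeriv_of_primitive hab
    ((h.continuous.continuousOn.integrableOn_Icc).mono_set Ioo_subset_Icc_self)
    (left_mem_Icc.2 hab.le) (c := u a) fun x hx => by
      rw [← h.sub_eq' a (left_mem_Icc.2 hab.le) x (Ioo_subset_Icc_self hx)]; ring

theorem IsH2Rep.hasWeakDeriv_right (h : IsH2Rep a b u p r) (hab : a < b) :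
    HasWeakDeriv (Ioo a b) p r :=
  hasWeakDeriv_of_primitive hab h.integrable.integrableOn
    (left_mem_Icc.2 hab.le) (c := p a) fun x _ => by
      rw [← h.sub_eq a x]; ring

theorem memLp_two_restrict_Ioo_of_continuousOn {f : ℝ → ℝ} (hf : ContinuousOn f (Icc a b)) :
    MemLp f 2 (volume.restrict (Ioo a b)) := by
  obtain ⟨C, hC⟩ := isCompact_Icc.exists_bound_of_continuousOn hf
  refine MemLp.of_bound
    ((hf.mono Ioo_subset_Icc_self).aestronglyMeasurable measurableSet_Ioo) C ?_
  rw [ae_restrict_iff' measurableSet_Ioo]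
  exact ae_of_all _ fun x hx => hC x (Ioo_subset_Icc_self hx)

theorem IsH2Rep.memLp (h : IsH2Rep a b u p r) : MemLp r 2 volume :=
  (memLp_two_iff_integrable_sq h.integrable.aestronglyMeasurable).2 h.integrable_sq

theorem IsH2Rep.memH2 (h : IsH2Rep a b u p r) (hab : a < b) : MemH2 (Ioo a b) u :=
  ⟨memLp_two_restrict_Ioo_of_continuousOn h.continuousOn, p, r,
    memLp_two_restrict_Ioo_of_continuousOn h.continuous.continuousOn,
    h.memLp.restrict _, h.hasWeakDeriv_left hab, h.hasWeakDeriv_right hab⟩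

theorem eqOn_Icc_of_ae_eq_Ioo (hab : a < b) {f g : ℝ → ℝ} (hf : ContinuousOn f (Icc a b))
    (hg : ContinuousOn g (Icc a b)) (h : f =ᵐ[volume.restrict (Ioo a b)] g) :
    EqOn f g (Icc a b) := by
  have h1 : EqOn f g (Ioo a b) := Measure.eqOn_open_of_ae_eq h isOpen_Ioo
    (hf.mono Ioo_subset_Icc_self) (hg.mono Ioo_subset_Icc_self)
  have := h1.of_subset_closure hf hg Ioo_subset_Icc_self (by rw [closure_Ioo hab.ne])
  exact this

theorem MemH2.exists_isH2Rep (hab : a < b) (hu : MemH2 (Ioo a b) u)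
    (hc : ContinuousOn u (Icc a b)) : ∃ p r, IsH2Rep a b u p r := by
  obtain ⟨-, u₁, u₂, h1, h2, hw1, hw2⟩ := hu
  have : IsFiniteMeasure (volume.restrict (Ioo a b)) := ⟨by simp⟩
  have ha := left_mem_Icc.2 hab.le
  have i1 : IntegrableOn u₁ (Ioo a b) := h1.integrable (by norm_num)
  have i2 : IntegrableOn u₂ (Ioo a b) := h2.integrable (by norm_num)
  -- Extending the second derivative by zero makes `p` a primitive on the whole line, so that no
  -- domain condition on `p` or `r` is needed later.
  set r : ℝ → ℝ := (Ioo a b).indicator u₂ with hr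
  have hri : Integrable r := i2.integrable_indicator measurableSet_Ioo
  have hru : u₂ =ᵐ[volume.restrict (Ioo a b)] r :=
    (indicator_ae_eq_restrict measurableSet_Ioo).symm
  obtain ⟨c, hcp⟩ := (hw2.congr (ae_eq_refl _) hru).exists_ae_eq_primitive hab
    hri.integrableOn ha
  set p : ℝ → ℝ := fun x => c + ∫ t in a..x, r t with hp
  have hri' : ∀ x y, IntervalIntegrable r volume x y := fun x y => hri.intervalIntegrable
  have hpc : Continuous p :=
    continuous_const.add (intervalIntegral.continuous_primitive hri' a)
  have hpi : IntegrableOn p (Ioo a b) :=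
    (hpc.continuousOn.integrableOn_Icc).mono_set Ioo_subset_Icc_self
  obtain ⟨d, hd⟩ := (hw1.congr (ae_eq_refl _) hcp).exists_ae_eq_primitive hab hpi ha
  have hpi' : ∀ x y, IntervalIntegrable p volume x y := fun x y => hpc.intervalIntegrable x y
  have heq := eqOn_Icc_of_ae_eq_Ioo hab hc
    (continuous_const.add (intervalIntegral.continuous_primitive hpi' a)).continuousOn hd
  refine ⟨p, r, hri, ?_, fun x y => ?_, fun x hx y hy => ?_⟩
  · have : (fun x => r x ^ 2) = (Ioo a b).indicator fun x => u₂ x ^ 2 := by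
      ext x
      by_cases hx : x ∈ Ioo a b <;> simp [hr, hx]
    rw [this]
    exact IntegrableOn.integrable_indicator h2.integrable_sq measurableSet_Ioo
  · have := intervalIntegral.integral_add_adjacent_intervals (hri' a x) (hri' x y)
    simp only [hp]; linarith
  · have := intervalIntegral.integral_add_adjacent_intervals (hpi' a x) (hpi' x y)
    rw [heq hx, heq hy]; simp only [Pi.add_apply]; linarith

theorem IsH2Rep.comp_mul_left (h : IsH2Rep a b u p r) {s : ℝ} (hs : 0 < s) :
    IsH2Rep (a / s) (b / s) (fun y => u (s * y)) (fun y => s * p (s * y))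
      (fun y => s ^ 2 * r (s * y)) := by
  refine ⟨(h.integrable.comp_mul_left' hs.ne').const_mul _, ?_, fun x y => ?_,
    fun x hx y hy => ?_⟩
  · have := (h.integrable_sq.comp_mul_left' hs.ne').const_mul (s ^ 4)
    refine this.congr (ae_of_all _ fun x => ?_)
    simp only; ring
  · rw [intervalIntegral.integral_const_mul,
      intervalIntegral.integral_comp_mul_left _ hs.ne', ← h.sub_eq, smul_eq_mul]
    field_simp
  · have hm : ∀ z ∈ Icc (a / s) (b / s), s * z ∈ Icc a b := fun z hz =>
      ⟨by have := (div_le_iff₀ hs).1 hz.1; linarith, by have := (le_div_iff₀ hs).1 hz.2; linarith⟩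
    rw [intervalIntegral.integral_const_mul,
      intervalIntegral.integral_comp_mul_left _ hs.ne',
      ← h.sub_eq' _ (hm x hx) _ (hm y hy), smul_eq_mul]
    field_simp

/-- A continuous function can be tested against smooth compactly supported approximations of its
sign. -/
theorem exists_testFunction_near_sign (hp : Continuous p) {η : ℝ} (hη : 0 < η) (hη1 : η < 1) :
    ∃ φ : ℝ → ℝ, ContDiff ℝ ∞ φ ∧ HasCompactSupport φ ∧ tsupport φ ⊆ Ioo a b ∧
      (∀ x, |φ x| ≤ 1) ∧
      ∀ x, a + 2 * η ≤ x → x ≤ b - 2 * η → η ≤ |p x| → |p x * φ x - abs (p x)| ≤ |p x| * (2 * η) := by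
  set χ : ℝ → ℝ := fun x => max 0 (min 1 (min (x - a) (b - x) / η - 1)) with hχ
  -- The cut-off χ vanishes within η of the endpoints and equals 1 beyond 2η; the other factor is
  -- the sign of `p` truncated at scale η. The factor 1 - η leaves room for a smoothing error η
  -- without exceeding 1.
  set f : ℝ → ℝ := fun x => (1 - η) * (χ x * max (-1) (min 1 (p x / η))) with hf
  have hχc : Continuous χ := by fun_prop
  have hfc : Continuous f := by fun_prop
  have hχ0 : ∀ x, 0 ≤ χ x := fun x => le_max_left _ _
  have hχ1 : ∀ x, χ x ≤ 1 := fun x => max_le zero_le_one (min_le_left _ _)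
  have hf1 : ∀ x, |f x| ≤ 1 - η := fun x => by
    have h1 : |max (-1) (min 1 (p x / η))| ≤ 1 :=
      abs_le.2 ⟨le_max_left _ _, max_le (by norm_num) (min_le_left _ _)⟩
    simp only [hf]
    rw [abs_mul, abs_mul, abs_of_nonneg (by linarith : 0 ≤ 1 - η), abs_of_nonneg (hχ0 x)]
    have := mul_le_mul (hχ1 x) h1 (abs_nonneg _) zero_le_one
    nlinarith
  have hχz : ∀ x, x ∉ Icc (a + η) (b - η) → χ x = 0 := fun x hx => by
    have : min (x - a) (b - x) ≤ η := by
      by_contra hcon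
      rw [not_le, lt_min_iff] at hcon
      exact hx ⟨by linarith, by linarith⟩
    have h2 : min (x - a) (b - x) / η - 1 ≤ 0 := by
      rw [sub_nonpos, div_le_one hη]; exact this
    exact max_eq_left ((min_le_right _ _).trans h2)
  have hfz : ∀ x, x ∉ Icc (a + η) (b - η) → f x = 0 := fun x hx => by
    simp only [hf]; rw [hχz x hx]; ring
  have hfs : HasCompactSupport f := HasCompactSupport.intro isCompact_Icc hfz
  have hfu : UniformContinuous f := hfs.uniformContinuous_of_continuous hfc
  obtain ⟨δ, hδ, hfδ⟩ := Metric.uniformContinuous_iff.1 hfu η hη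
  -- Radius δ makes the smoothing error at most η; radius η/2 keeps the smoothed function equal to
  -- zero near the endpoints.
  obtain ⟨g, hg, hgf⟩ := hfc.exists_contDiff_dist_le_of_forall_mem_ball_dist_le
    (lt_min hδ (half_pos hη))
  have hgη : ∀ x, |g x - f x| ≤ η := fun x => by
    have := hgf x η fun y hy => (hfδ (lt_of_lt_of_le hy (min_le_left _ _))).le
    rwa [Real.dist_eq] at this
  have hgz : ∀ x, x ∉ Icc (a + η / 2) (b - η / 2) → g x = 0 := fun x hx => by
    have hnear : ∀ y, dist y x < η / 2 → f y = 0 := fun y hy => by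
      refine hfz y fun hy' => hx ?_
      rw [Real.dist_eq, abs_lt] at hy
      exact ⟨by linarith [hy.2, hy'.1], by linarith [hy.1, hy'.2]⟩
    have hx0 : f x = 0 := hnear x (by simpa using half_pos hη)
    have := hgf x 0 fun y hy => by
      rw [hnear y (lt_of_lt_of_le hy (min_le_right _ _)), hx0, dist_self]
    rw [hx0, Real.dist_eq, sub_zero] at this
    exact abs_nonpos_iff.1 this
  have hgsub : tsupport g ⊆ Icc (a + η / 2) (b - η / 2) :=
    closure_minimal (fun x hx => by
      by_contra hcon
      exact hx (hgz x hcon)) isClosed_Icc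
  refine ⟨g, hg, isCompact_Icc.of_isClosed_subset (isClosed_tsupport _) hgsub,
    hgsub.trans fun x hx => ⟨by linarith [hx.1], by linarith [hx.2]⟩, fun x => ?_, ?_⟩
  · have h1 := hgη x
    have h2 := hf1 x
    rw [abs_le] at *
    constructor <;> linarith
  · intro x hxa hxb hpx
    have hχx : χ x = 1 := by
      have : 2 * η ≤ min (x - a) (b - x) := le_min (by linarith) (by linarith)
      have h2 : 1 ≤ min (x - a) (b - x) / η - 1 := by
        rw [le_sub_iff_add_le, le_div_iff₀ hη]; linarith
      simp only [hχ]
      rw [min_eq_left h2, max_eq_right zero_le_one]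
    have hpf : p x * f x = (1 - η) * |p x| := by
      simp only [hf]
      rw [hχx]
      rcases le_or_gt 0 (p x) with h0 | h0
      · rw [abs_of_nonneg h0] at hpx ⊢
        rw [min_eq_left ((one_le_div hη).2 hpx), max_eq_right (by norm_num)]; ring
      · rw [abs_of_neg h0] at hpx ⊢
        have : p x / η ≤ -1 := by rw [div_le_iff₀ hη]; linarith
        rw [min_eq_right (this.trans (by norm_num)), max_eq_left this]; ring
    have : p x * g x - abs (p x) = p x * (g x - f x) - η * |p x| := by
      rw [mul_sub, hpf]; ring
    rw [this]
    calc |p x * (g x - f x) - η * abs (p x)| ≤ |p x * (g x - f x)| + |η * abs (p x)| := abs_sub _ _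
      _ ≤ |p x| * η + η * |p x| := by
        rw [abs_mul, abs_mul, abs_abs, abs_of_pos hη]
        gcongr
        exact hgη x
      _ = |p x| * (2 * η) := by ring

/-- Test functions bounded by 1 can be chosen so that `p * φ n` tends pointwise to `|p|`, and
dominated convergence applies. Only this inequality between the two notions of variation is needed.
-/
theorem IsH2Rep.ofReal_integral_abs_le_totalVariation (h : IsH2Rep a b u p r) (hab : a < b) :
    ENNReal.ofReal (∫ x in a..b, |p x|) ≤ totalVariation (Ioo a b) u := by
  set T := totalVariation (Ioo a b) u with hT
  rcases eq_or_ne T ⊤ with hTt | hTt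
  · rw [hTt]; exact le_top
  have hw := h.hasWeakDeriv_left hab
  have hφT : ∀ φ : ℝ → ℝ, ContDiff ℝ ∞ φ → HasCompactSupport φ → tsupport φ ⊆ Ioo a b →
      (∀ x, |φ x| ≤ 1) → ∫ x in Ioo a b, p x * φ x ≤ T.toReal := by
    intro φ hφ hc hs h1
    -- Integration by parts changes the sign, so the competitor in the supremum is -φ.
    have h2 : ENNReal.ofReal (∫ x in Ioo a b, u x * deriv (fun y => -φ y) x) ≤ T :=
      le_iSup (fun φ : {φ : ℝ → ℝ // ContDiff ℝ 1 φ ∧ HasCompactSupport φ ∧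
        tsupport φ ⊆ Ioo a b ∧ ∀ x, |φ x| ≤ 1} =>
        ENNReal.ofReal (∫ x in Ioo a b, u x * deriv φ.1 x))
        ⟨fun y => -φ y, hφ.neg.of_le (by exact_mod_cast le_top), hc.neg, by
          have : tsupport (fun y => -φ y) = tsupport φ := by
            simp only [tsupport, Function.support_fun_neg]
          rw [this]; exact hs, fun x => by rw [abs_neg]; exact h1 x⟩
    have h3 : ∫ x in Ioo a b, u x * deriv (fun y => -φ y) x = ∫ x in Ioo a b, p x * φ x := by
      have := hw.2.2 φ hφ hc hs
      simp only [deriv.fun_neg, mul_neg, integral_neg]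
      linarith
    rw [h3] at h2
    exact (ENNReal.ofReal_le_iff_le_toReal hTt).1 h2
  rw [ENNReal.ofReal_le_iff_le_toReal hTt, intervalIntegral.integral_of_le hab.le,
    integral_Ioc_eq_integral_Ioo]
  set η : ℕ → ℝ := fun n => 1 / ((n : ℝ) + 2) with hη
  have hη0 : ∀ n, 0 < η n := fun n => by positivity
  have hη1 : ∀ n, η n < 1 := fun n => by
    simp only [hη]; rw [div_lt_one (by positivity)]
    have : (0 : ℝ) ≤ n := Nat.cast_nonneg n
    linarith
  have hηl : Tendsto η atTop (𝓝 0) := by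
    have := (tendsto_one_div_add_atTop_nhds_zero_nat (𝕜 := ℝ)).comp (tendsto_add_atTop_nat 1)
    refine this.congr fun n => ?_
    simp only [Function.comp, hη]; push_cast; ring
  choose φ hφ hφc hφs hφ1 hφp using fun n =>
    exists_testFunction_near_sign (a := a) (b := b) h.continuous (hη0 n) (hη1 n)
  have hpi : IntegrableOn p (Ioo a b) :=
    (h.continuous.continuousOn.integrableOn_Icc).mono_set Ioo_subset_Icc_self
  have hlim : Tendsto (fun n => ∫ x in Ioo a b, p x * φ n x) atTop
      (𝓝 (∫ x in Ioo a b, |p x|)) := by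
    refine tendsto_integral_of_dominated_convergence (fun x => |p x|)
      (fun n => (h.continuous.mul (hφ n).continuous).aestronglyMeasurable) hpi.abs
      (fun n => ae_of_all _ fun x => ?_) ?_
    · rw [Real.norm_eq_abs, abs_mul]
      exact mul_le_of_le_one_right (abs_nonneg _) (hφ1 n x)
    · rw [ae_restrict_iff' measurableSet_Ioo]
      refine ae_of_all _ fun x hx => ?_
      rcases eq_or_ne (p x) 0 with hp0 | hp0
      · simp [hp0]
      have e1 : ∀ᶠ n in atTop, 2 * η n < x - a :=
        (hηl.const_mul 2).eventually_lt_const (by simpa using hx.1)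
      have e2 : ∀ᶠ n in atTop, 2 * η n < b - x :=
        (hηl.const_mul 2).eventually_lt_const (by simpa using hx.2)
      have e3 : ∀ᶠ n in atTop, η n < |p x| := hηl.eventually_lt_const (abs_pos.2 hp0)
      rw [tendsto_iff_dist_tendsto_zero]
      refine squeeze_zero' (Eventually.of_forall fun n => dist_nonneg)
        (g := fun n => |p x| * (2 * η n)) ?_ (by simpa using (hηl.const_mul 2).const_mul |p x|)
      filter_upwards [e1, e2, e3] with n h1 h2 h3
      rw [Real.dist_eq]
      exact hφp n x (by linarith) (by linarith) h3.le
  exact le_of_tendsto' hlim fun n => hφT _ (hφ n) (hφc n) (hφs n) (hφ1 n)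

/-- Integrating separately on both sides of the jump, the pairing of the step function with φ' is
-2V φ(0), which is at most 2V. -/
theorem totalVariation_sign_le {L V τ₀ : ℝ} (hL : 0 < L) (hV : 0 < V) :
    totalVariation (Ioo (-L) L) (fun y => V * (Real.sign y - τ₀)) ≤ ENNReal.ofReal (2 * V) := by
  refine iSup_le fun ⟨φ, hφ, hc, hs, h1⟩ => ENNReal.ofReal_le_ofReal ?_
  simp only
  have hd : Continuous (deriv φ) := hφ.continuous_deriv le_rfl
  have hφd : ∀ x, HasDerivAt φ (deriv φ x) x := fun x =>
    (hφ.differentiable (by simp) x).hasDerivAt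
  have ha : φ (-L) = 0 := image_eq_zero_of_notMem_tsupport fun h => (hs h).1.ne rfl
  have hb : φ L = 0 := image_eq_zero_of_notMem_tsupport fun h => (hs h).2.ne rfl
  rw [← integral_Ioc_eq_integral_Ioo, ← intervalIntegral.integral_of_le (by linarith)]
  have hneg : ∀ᵐ x, x ∈ uIoc (-L) 0 →
      V * (-1 - τ₀) * deriv φ x = V * (Real.sign x - τ₀) * deriv φ x := by
    filter_upwards [Measure.ae_ne volume (0 : ℝ)] with x hx hxm
    rw [uIoc_of_le (by linarith)] at hxm
    rw [Real.sign_of_neg (lt_of_le_of_ne hxm.2 hx)]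
  have hpos : ∀ᵐ x, x ∈ uIoc 0 L →
      V * (1 - τ₀) * deriv φ x = V * (Real.sign x - τ₀) * deriv φ x := by
    refine ae_of_all _ fun x hxm => ?_
    rw [uIoc_of_le hL.le] at hxm
    rw [Real.sign_of_pos hxm.1]
  have hi : ∀ (k x y : ℝ), IntervalIntegrable (fun x => k * deriv φ x) volume x y :=
    fun k x y => (hd.const_mul k).intervalIntegrable x y
  have i1 := (hi (V * (-1 - τ₀)) (-L) 0).congr_ae ((ae_restrict_iff' measurableSet_uIoc).2 hneg)
  have i2 := (hi (V * (1 - τ₀)) 0 L).congr_ae ((ae_restrict_iff' measurableSet_uIoc).2 hpos)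
  rw [← intervalIntegral.integral_add_adjacent_intervals i1 i2,
    ← intervalIntegral.integral_congr_ae hneg, ← intervalIntegral.integral_congr_ae hpos,
    intervalIntegral.integral_const_mul, intervalIntegral.integral_const_mul,
    intervalIntegral.integral_eq_sub_of_hasDerivAt (fun x _ => hφd x) (hd.intervalIntegrable _ _),
    intervalIntegral.integral_eq_sub_of_hasDerivAt (fun x _ => hφd x) (hd.intervalIntegrable _ _),
    ha, hb]
  have := (abs_le.1 (h1 0)).1
  nlinarith

end

/-! ### Components of a superlevel set and the optimal cost of one transition. -/

section

/-- `(α, β)` is a connected component of `{x ∈ (y₁, y₂) | δ < p x}` at whose endpoints `p = δ`. -/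
structure IsBump (p : ℝ → ℝ) (δ y₁ y₂ α β : ℝ) : Prop where
  le_left : y₁ ≤ α
  lt : α < β
  right_le : β ≤ y₂
  eq_left : p α = δ
  eq_right : p β = δ
  lt_of_mem : ∀ x ∈ Ioo α β, δ < p x

/-- An endpoint of the component cannot lie in the superlevel set, or the component could be
enlarged. So p ≤ δ there, directly by hypothesis if the endpoint is y₁ or y₂; the opposite
inequality follows by continuity from inside. -/
theorem exists_isBump_eq_connectedComponentIn {p : ℝ → ℝ} (hp : Continuous p) {δ y₁ y₂ : ℝ}
    (h1 : p y₁ ≤ δ) (h2 : p y₂ ≤ δ) {x : ℝ} (hx : x ∈ {x ∈ Ioo y₁ y₂ | δ < p x}) :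
    ∃ α β, IsBump p δ y₁ y₂ α β ∧
      connectedComponentIn {x ∈ Ioo y₁ y₂ | δ < p x} x = Ioo α β := by
  set U : Set ℝ := {x ∈ Ioo y₁ y₂ | δ < p x} with hU
  have hUo : IsOpen U := isOpen_Ioo.inter (isOpen_lt continuous_const hp)
  set C := connectedComponentIn U x with hC
  have hCo : IsOpen C := hUo.connectedComponentIn
  have hCp : IsPreconnected C := isPreconnected_connectedComponentIn
  have hCU : C ⊆ U := connectedComponentIn_subset U x
  have hxC : x ∈ C := mem_connectedComponentIn hx
  have hne : C.Nonempty := ⟨x, hxC⟩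
  have hbb : BddBelow C := ⟨y₁, fun z hz => (hCU hz).1.1.le⟩
  have hba : BddAbove C := ⟨y₂, fun z hz => (hCU hz).1.2.le⟩
  set α := sInf C with hα
  set β := sSup C with hβ
  have hsub : Ioo α β ⊆ C :=
    IsConnected.Ioo_csInf_csSup_subset ⟨hne, hCp⟩ hbb hba
  have hαx : α ≤ x := csInf_le hbb hxC
  have hxβ : x ≤ β := le_csSup hba hxC
  have hα1 : y₁ ≤ α := le_csInf hne fun z hz => (hCU hz).1.1.le
  have hβ2 : β ≤ y₂ := csSup_le hne fun z hz => (hCU hz).1.2.le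
  have hαC : α ∉ C := fun h => by
    obtain ⟨ε, hε, hball⟩ := Metric.isOpen_iff.1 hCo α h
    have : α - ε / 2 ∈ C := hball (by
      rw [Metric.mem_ball, Real.dist_eq, abs_lt]; constructor <;> linarith)
    have := csInf_le hbb this
    linarith
  have hβC : β ∉ C := fun h => by
    obtain ⟨ε, hε, hball⟩ := Metric.isOpen_iff.1 hCo β h
    have : β + ε / 2 ∈ C := hball (by
      rw [Metric.mem_ball, Real.dist_eq, abs_lt]; constructor <;> linarith)
    have := le_csSup hba this
    linarith
  have hαx' : α < x := lt_of_le_of_ne hαx fun h => hαC (h ▸ hxC)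
  have hxβ' : x < β := lt_of_le_of_ne hxβ fun h => hβC (h ▸ hxC)
  have hCeq : C = Ioo α β := by
    refine Subset.antisymm (fun z hz => ⟨?_, ?_⟩) hsub
    · exact lt_of_le_of_ne (csInf_le hbb hz) fun h => hαC (h ▸ hz)
    · exact lt_of_le_of_ne (le_csSup hba hz) fun h => hβC (h ▸ hz)
  have hαU : α ∉ U := fun h => hαC <| by
    have hI : Ico α β ⊆ U := fun z hz => by
      rcases eq_or_lt_of_le hz.1 with h' | h'
      · exact h' ▸ h
      · exact hCU (hsub ⟨h', hz.2⟩)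
    exact (isPreconnected_Ico.subset_connectedComponentIn ⟨hαx, hxβ'⟩ hI)
      ⟨le_rfl, hαx'.trans hxβ'⟩
  have hβU : β ∉ U := fun h => hβC <| by
    have hI : Ioc α β ⊆ U := fun z hz => by
      rcases eq_or_lt_of_le hz.2 with h' | h'
      · exact h' ▸ h
      · exact hCU (hsub ⟨hz.1, h'⟩)
    exact (isPreconnected_Ioc.subset_connectedComponentIn ⟨hαx', hxβ⟩ hI)
      ⟨hαx'.trans hxβ', le_rfl⟩
  have hge : ∀ z ∈ Icc α β, δ ≤ p z := by
    have hcl : Icc α β ⊆ {z | δ ≤ p z} := by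
      rw [← closure_Ioo (hαx'.trans hxβ').ne]
      exact closure_minimal (fun z hz => (hCU (hsub hz)).2.le)
        (isClosed_le continuous_const hp)
    exact hcl
  refine ⟨α, β, ⟨hα1, hαx'.trans hxβ', hβ2, le_antisymm ?_ (hge α ⟨le_rfl, hαx.trans hxβ⟩),
    le_antisymm ?_ (hge β ⟨hαx.trans hxβ, le_rfl⟩), fun z hz => (hCU (hsub hz)).2⟩, hCeq⟩
  · rcases eq_or_lt_of_le hα1 with h | h
    · rw [← h]; exact h1
    · by_contra hcon
      exact hαU ⟨⟨h, hαx'.trans (hx.1.2)⟩, not_le.1 hcon⟩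
  · rcases eq_or_lt_of_le hβ2 with h | h
    · rw [h]; exact h2
    · by_contra hcon
      exact hβU ⟨⟨hx.1.1.trans hxβ', h⟩, not_le.1 hcon⟩

/-- The components of an open subset of the line are countably many disjoint open intervals, so an
integral inequality valid on each bump can be summed. -/
theorem setIntegral_superlevel_nonneg {p F : ℝ → ℝ} (hp : Continuous p) {δ y₁ y₂ : ℝ}
    (h1 : p y₁ ≤ δ) (h2 : p y₂ ≤ δ) (hF : IntegrableOn F {x ∈ Ioo y₁ y₂ | δ < p x})
    (h : ∀ α β, IsBump p δ y₁ y₂ α β → 0 ≤ ∫ x in Ioo α β, F x) :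
    0 ≤ ∫ x in {x ∈ Ioo y₁ y₂ | δ < p x}, F x := by
  set U : Set ℝ := {x ∈ Ioo y₁ y₂ | δ < p x} with hU
  have hUo : IsOpen U := isOpen_Ioo.inter (isOpen_lt continuous_const hp)
  let ι := {C : Set ℝ // ∃ x ∈ U, connectedComponentIn U x = C}
  let s : ι → Set ℝ := fun i => i.1
  have hso : ∀ i, IsOpen (s i) := fun ⟨C, x, hx, hC⟩ => by
    show IsOpen C
    rw [← hC]; exact hUo.connectedComponentIn
  have hsd : Pairwise (Function.onFun Disjoint s) := by
    rintro ⟨C, x, hx, rfl⟩ ⟨D, y, hy, rfl⟩ hne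
    refine disjoint_left.2 fun z hz hz' => hne ?_
    have e1 := connectedComponentIn_eq hz
    have e2 := connectedComponentIn_eq hz'
    exact Subtype.ext (e1.trans e2.symm)
  have hsn : ∀ i, (s i).Nonempty := fun ⟨C, x, hx, hC⟩ =>
    ⟨x, by show x ∈ C; rw [← hC]; exact mem_connectedComponentIn hx⟩
  have : Countable ι := hsd.countable_of_isOpen_disjoint hso hsn
  have hUs : U = ⋃ i, s i := by
    ext x
    constructor
    · intro hx
      exact mem_iUnion.2 ⟨⟨_, x, hx, rfl⟩, mem_connectedComponentIn hx⟩
    · intro hx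
      obtain ⟨⟨C, y, hy, rfl⟩, hi⟩ := mem_iUnion.1 hx
      exact connectedComponentIn_subset U y hi
  rw [hUs, integral_iUnion (fun i => (hso i).measurableSet) hsd (hUs ▸ hF)]
  refine tsum_nonneg fun ⟨C, x, hx, hC⟩ => ?_
  obtain ⟨α, β, hb, he⟩ := exists_isBump_eq_connectedComponentIn hp h1 h2 hx
  show 0 ≤ ∫ x in C, F x
  rw [← hC, he]
  exact h α β hb

/-- The right side is minimal in ℓ at ℓ = √3 √J. Writing √J = ℓx/√3 reduces the claim to x⁴ - 4x + 3
= (x - 1)²(x² + 2x + 3) ≥ 0. -/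
theorem alpha0_mul_sqrt_le {J ℓ : ℝ} (hJ : 0 ≤ J) (hℓ : 0 < ℓ) :
    alpha0 * √J ≤ 12 * J ^ 2 / ℓ ^ 3 + 4 * ℓ := by
  have h3 : (√3 : ℝ) ^ 2 = 3 := Real.sq_sqrt (by norm_num)
  have h30 : (0 : ℝ) < √3 := by positivity
  obtain ⟨j, hj, rfl⟩ : ∃ j, 0 ≤ j ∧ J = j ^ 2 := ⟨√J, Real.sqrt_nonneg _, (Real.sq_sqrt hJ).symm⟩
  rw [Real.sqrt_sq hj, alpha0]
  set a : ℝ := √3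
  obtain ⟨x, rfl⟩ : ∃ x, j = ℓ * x / a := ⟨j * a / ℓ, by field_simp⟩
  have ha4 : a ^ 4 = 9 := by nlinarith
  have e1 : 16 / a * (ℓ * x / a) = 16 / 3 * ℓ * x := by
    have : 16 / a * (ℓ * x / a) = 16 * (ℓ * x) / a ^ 2 := by field_simp
    rw [this, h3]; ring
  have e2 : 12 * ((ℓ * x / a) ^ 2) ^ 2 / ℓ ^ 3 = 4 / 3 * ℓ * x ^ 4 := by
    have : 12 * ((ℓ * x / a) ^ 2) ^ 2 / ℓ ^ 3 = 12 * ℓ * x ^ 4 / a ^ 4 := by field_simp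
    rw [this, ha4]; ring
  rw [e1, e2]
  nlinarith [mul_nonneg hℓ.le (mul_nonneg (sq_nonneg (x - 1)) (by nlinarith [sq_nonneg (x + 1)] :
    0 ≤ x ^ 2 + 2 * x + 3))]

variable {a b : ℝ} {u p r : ℝ → ℝ}

/-- Integration by parts with a weight vanishing at the midpoint; the boundary terms disappear
because p - δ vanishes at both ends. This expresses the height J as a scalar product with r. -/
theorem IsH2Rep.integral_mul_of_eq (h : IsH2Rep a b u p r) {δ α β : ℝ}
    (hα : p α = δ) (hβ : p β = δ) :
    ∫ x in α..β, r x * ((α + β) / 2 - x) = ∫ x in α..β, (p x - δ) := by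
  have := integral_mul_deriv_of_primitive (a := α) (b := β) (f := fun x => p x - δ) (g := r)
    (φ := fun x => x - (α + β) / 2) (φ' := fun _ => 1) h.integrable.intervalIntegrable
    (fun x _ => by rw [← h.sub_eq]; ring) (fun x => (hasDerivAt_id x).sub_const _)
    continuous_const
  simp only [mul_one, hα, hβ] at this
  rw [this, sub_self, zero_mul, zero_mul, sub_self, zero_sub, ← intervalIntegral.integral_neg]
  congr 1; ext x; ring

theorem IsH2Rep.integral_sub_affine_sq (h : IsH2Rep a b u p r) {δ α β : ℝ}
    (hα : p α = δ) (hβ : p β = δ) (k : ℝ) :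
    ∫ x in α..β, (r x - k * ((α + β) / 2 - x)) ^ 2 =
      (∫ x in α..β, r x ^ 2) - 2 * k * (∫ x in α..β, (p x - δ)) + k ^ 2 * (β - α) ^ 3 / 12 := by
  have e1 : ∫ x in α..β, (r x - k * ((α + β) / 2 - x)) ^ 2 =
      ∫ x in α..β, (r x ^ 2 - 2 * k * (r x * ((α + β) / 2 - x)) +
        k ^ 2 * ((α + β) / 2 - x) ^ 2) := by
    congr 1; ext x; ring
  have i1 : IntervalIntegrable (fun x => r x ^ 2) volume α β := h.integrable_sq.intervalIntegrable
  have i2 : IntervalIntegrable (fun x => 2 * k * (r x * ((α + β) / 2 - x))) volume α β :=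
    ((h.integrable.intervalIntegrable).mul_continuousOn (by fun_prop)).const_mul _
  have i3 : IntervalIntegrable (fun x => k ^ 2 * ((α + β) / 2 - x) ^ 2) volume α β :=
    Continuous.intervalIntegrable (by fun_prop) _ _
  have e2 : ∫ x in α..β, ((α + β) / 2 - x) ^ 2 = (β - α) ^ 3 / 12 := by
    rw [intervalIntegral.integral_comp_sub_left (fun x => x ^ 2) ((α + β) / 2), integral_pow]
    norm_num; ring
  rw [e1, intervalIntegral.integral_add (i1.sub i2) i3, intervalIntegral.integral_sub i1 i2,
    intervalIntegral.integral_const_mul, intervalIntegral.integral_const_mul,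
    h.integral_mul_of_eq hα hβ, e2]
  ring

/-- The coefficient 12J/(β - α)³ is that of the L² projection of r onto the line spanned by the
centred affine function. The identity is Pythagoras: the lower bound 12J²/(β - α)³ comes with an
exact remainder, which later measures the distance from the cubic profile. -/
theorem IsH2Rep.integral_sub_affine_sq_eq (h : IsH2Rep a b u p r) {δ α β : ℝ} (hαβ : α < β)
    (hα : p α = δ) (hβ : p β = δ) {J : ℝ} (hJ : J = ∫ x in α..β, (p x - δ)) :
    ∫ x in α..β, (r x - 12 * J / (β - α) ^ 3 * ((α + β) / 2 - x)) ^ 2 =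
      (∫ x in α..β, r x ^ 2) - 12 * J ^ 2 / (β - α) ^ 3 := by
  have : 0 < β - α := sub_pos.2 hαβ
  rw [h.integral_sub_affine_sq hα hβ, ← hJ]
  field_simp
  ring

theorem IsH2Rep.le_integral_sq (h : IsH2Rep a b u p r) {δ α β : ℝ} (hαβ : α < β)
    (hα : p α = δ) (hβ : p β = δ) {J : ℝ} (hJ : J = ∫ x in α..β, (p x - δ)) :
    12 * J ^ 2 / (β - α) ^ 3 ≤ ∫ x in α..β, r x ^ 2 := by
  have e := h.integral_sub_affine_sq_eq hαβ hα hβ hJ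
  have : 0 ≤ ∫ x in α..β, (r x - 12 * J / (β - α) ^ 3 * ((α + β) / 2 - x)) ^ 2 :=
    intervalIntegral.integral_nonneg hαβ.le fun x _ => sq_nonneg _
  linarith

/-- If √J ≤ S on every bump, then α₀J = √J · α₀√J is at most S times the energy of the bump. Summing
over the bumps contradicts the hypothesis: a large total height at small cost forces one large bump.
-/
theorem IsH2Rep.exists_isBump (h : IsH2Rep a b u p r) {δ y₁ y₂ S : ℝ}
    (h1 : p y₁ ≤ δ) (h2 : p y₂ ≤ δ)
    (hS : S * ∫ x in {x ∈ Ioo y₁ y₂ | δ < p x}, (r x ^ 2 + 4) <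
      alpha0 * ∫ x in {x ∈ Ioo y₁ y₂ | δ < p x}, (p x - δ)) :
    ∃ α β, IsBump p δ y₁ y₂ α β ∧ S < √(∫ x in α..β, (p x - δ)) := by
  by_contra hcon
  push Not at hcon
  have hpc := h.continuous
  have hsub : {x ∈ Ioo y₁ y₂ | δ < p x} ⊆ Icc y₁ y₂ := fun x hx => Ioo_subset_Icc_self hx.1
  have i4 : IntegrableOn (fun _ : ℝ => (4 : ℝ)) (Icc y₁ y₂) :=
    continuous_const.continuousOn.integrableOn_Icc
  have i1 : IntegrableOn (fun x => S * (r x ^ 2 + 4)) (Icc y₁ y₂) :=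
    (h.integrable_sq.integrableOn.add i4).const_mul _
  have i2 : IntegrableOn (fun x => alpha0 * (p x - δ)) (Icc y₁ y₂) :=
    (Continuous.continuousOn (by fun_prop)).integrableOn_Icc
  have ha0 : 0 < alpha0 := by unfold alpha0; positivity
  have key := setIntegral_superlevel_nonneg hpc h1 h2 ((i1.sub i2).mono_set hsub)
    fun α β hb => by
    have hsub' : Ioo α β ⊆ Icc y₁ y₂ := fun x hx =>
      ⟨hb.le_left.trans hx.1.le, hx.2.le.trans hb.right_le⟩
    have hc := hcon α β hb
    have hle := h.le_integral_sq hb.lt hb.eq_left hb.eq_right rfl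
    set J := ∫ x in α..β, (p x - δ) with hJ
    have hJ0 : 0 ≤ J := by
      rw [hJ, intervalIntegral.integral_of_le hb.lt.le, integral_Ioc_eq_integral_Ioo]
      exact setIntegral_nonneg measurableSet_Ioo fun x hx => (sub_pos.2 (hb.lt_of_mem x hx)).le
    have hen := alpha0_mul_sqrt_le hJ0 (sub_pos.2 hb.lt)
    simp only [Pi.sub_apply]
    rw [integral_sub (i1.mono_set hsub') (i2.mono_set hsub'), integral_const_mul,
      integral_const_mul, integral_add h.integrable_sq.integrableOn (i4.mono_set hsub'),
      ← integral_Ioc_eq_integral_Ioo, ← integral_Ioc_eq_integral_Ioo,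
      ← integral_Ioc_eq_integral_Ioo, ← intervalIntegral.integral_of_le hb.lt.le,
      ← intervalIntegral.integral_of_le hb.lt.le, ← intervalIntegral.integral_of_le hb.lt.le,
      intervalIntegral.integral_const, smul_eq_mul]
    have hs : √J * √J = J := Real.mul_self_sqrt hJ0
    have hS0 : 0 ≤ S := (Real.sqrt_nonneg _).trans hc
    have h3 : S * (alpha0 * √J) ≤ S * ((∫ x in α..β, r x ^ 2) + (β - α) * 4) :=
      mul_le_mul_of_nonneg_left (by linarith) hS0
    have h4 : √J * (alpha0 * √J) ≤ S * (alpha0 * √J) :=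
      mul_le_mul_of_nonneg_right hc (by positivity)
    nlinarith
  simp only [Pi.sub_apply] at key
  rw [integral_sub (i1.mono_set hsub) (i2.mono_set hsub), integral_const_mul,
    integral_const_mul] at key
  linarith

end

/-! ### Elementary inequalities and stability of the optimal length. -/

section

theorem half_le_log_one_add {x : ℝ} (h0 : 0 ≤ x) (h1 : x ≤ 1) : x / 2 ≤ Real.log (1 + x) := by
  have h := Real.one_sub_inv_le_log_of_pos (by linarith : 0 < 1 + x)
  have : x / 2 ≤ 1 - (1 + x)⁻¹ := by
    have h2 : 1 - (1 + x)⁻¹ = x / (1 + x) := by field_simp; ring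
    rw [h2]
    exact div_le_div_of_nonneg_left h0 (by linarith) (by linarith)
  linarith

/-- With ε = exp(-s²) the threshold exp(-2s) is much larger than ε², yet its logarithm is negligible
with respect to s². Hence, after division by s², the lower bound still tends to 4. -/
theorem le_log_one_add_of_exp_lt {s p : ℝ} (hp : Real.exp (-2 * s) < p) :
    4 * s ^ 2 - 4 * s ≤ Real.log (1 + (p / Real.exp (-s ^ 2) ^ 2) ^ 2) := by
  have h0 : Real.exp (-2 * s) / Real.exp (-s ^ 2) ^ 2 = Real.exp (-2 * s + 2 * s ^ 2) := by
    rw [← Real.exp_nat_mul, ← Real.exp_sub]; congr 1; push_cast; ring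
  have h1 : Real.exp (-2 * s + 2 * s ^ 2) ≤ p / Real.exp (-s ^ 2) ^ 2 := by
    rw [← h0]; gcongr
  have h2 : Real.exp (4 * s ^ 2 - 4 * s) = Real.exp (-2 * s + 2 * s ^ 2) ^ 2 := by
    rw [← Real.exp_nat_mul]; congr 1; push_cast; ring
  rw [Real.le_log_iff_exp_le (by positivity), h2]
  have := pow_le_pow_left₀ (Real.exp_pos _).le h1 2
  linarith

/-- Two regimes for q = p/e. If |q| ≤ 1, the logarithm is at least q²/2 and Young's inequality with
parameter η bounds |q|; if |q| > 1, the logarithm is at least 1/2, which pays for the cap δ. -/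
theorem min_max_le_log {e η δ p : ℝ} (he : 0 < e) (hη : 0 < η) (hδ : 0 < δ) :
    min (max p 0) δ ≤ η * e + (e / (2 * η) + 2 * δ) * Real.log (1 + (p / e) ^ 2) := by
  obtain ⟨q, rfl⟩ : ∃ q, p = e * q := ⟨p / e, by field_simp⟩
  rw [mul_div_cancel_left₀ _ he.ne']
  have hl0 : 0 ≤ Real.log (1 + q ^ 2) := Real.log_nonneg (by nlinarith [sq_nonneg q])
  rcases le_or_gt (q ^ 2) 1 with hq | hq
  · have h1 := half_le_log_one_add (sq_nonneg q) hq
    have h2 : |q| ≤ η + q ^ 2 / (4 * η) := by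
      have : 0 ≤ (|q| - 2 * η) ^ 2 / (4 * η) := by positivity
      have e : (|q| - 2 * η) ^ 2 / (4 * η) = q ^ 2 / (4 * η) - |q| + η := by
        field_simp; rw [sub_sq, sq_abs]; ring
      linarith
    have h3 : q ^ 2 / (4 * η) ≤ Real.log (1 + q ^ 2) / (2 * η) := by
      rw [div_le_div_iff₀ (by positivity) (by positivity)]
      nlinarith
    calc min (max (e * q) 0) δ ≤ max (e * q) 0 := min_le_left _ _
      _ ≤ e * |q| := max_le (mul_le_mul_of_nonneg_left (le_abs_self q) he.le) (by positivity)
      _ ≤ e * (η + Real.log (1 + q ^ 2) / (2 * η)) :=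
        mul_le_mul_of_nonneg_left (h2.trans (by linarith)) he.le
      _ = η * e + e / (2 * η) * Real.log (1 + q ^ 2) := by field_simp
      _ ≤ _ := by
        have : 0 ≤ 2 * δ * Real.log (1 + q ^ 2) := by positivity
        linarith
  · have h1 : 1 / 2 ≤ Real.log (1 + q ^ 2) := by
      have := half_le_log_one_add zero_le_one le_rfl
      exact this.trans (Real.log_le_log (by norm_num) (by linarith))
    calc min (max (e * q) 0) δ ≤ δ := min_le_right _ _
      _ ≤ 2 * δ * Real.log (1 + q ^ 2) := by nlinarith
      _ ≤ _ := by
        have : 0 ≤ e / (2 * η) * Real.log (1 + q ^ 2) := by positivity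
        have : 0 ≤ η * e := by positivity
        linarith

theorem sq_integral_le_mul_integral_sq {f : ℝ → ℝ} {x y : ℝ} (hxy : x ≤ y)
    (hf : IntervalIntegrable f volume x y)
    (hf2 : IntervalIntegrable (fun t => f t ^ 2) volume x y) :
    (∫ t in x..y, f t) ^ 2 ≤ (y - x) * ∫ t in x..y, f t ^ 2 := by
  rcases eq_or_lt_of_le hxy with rfl | hlt
  · simp
  have hl : 0 < y - x := sub_pos.2 hlt
  set I := ∫ t in x..y, f t with hI
  set m := I / (y - x) with hm
  have h0 : 0 ≤ ∫ t in x..y, (f t - m) ^ 2 :=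
    intervalIntegral.integral_nonneg hxy fun t _ => sq_nonneg _
  have e1 : ∫ t in x..y, (f t - m) ^ 2 = ∫ t in x..y, (f t ^ 2 - 2 * m * f t + m ^ 2) := by
    congr 1; ext t; ring
  rw [e1, intervalIntegral.integral_add (hf2.sub (hf.const_mul _)) (by simp),
    intervalIntegral.integral_sub hf2 (hf.const_mul _), intervalIntegral.integral_const_mul,
    intervalIntegral.integral_const, smul_eq_mul, ← hI] at h0
  have e2 : I = m * (y - x) := by rw [hm]; field_simp
  have : 0 ≤ (y - x) * ((∫ t in x..y, f t ^ 2) - 2 * m * I + (y - x) * m ^ 2) :=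
    mul_nonneg hl.le h0
  rw [e2] at this ⊢
  nlinarith

theorem abs_integral_le_sqrt {f : ℝ → ℝ} {a b x y A H : ℝ} (hf : IntervalIntegrable f volume a b)
    (hf2 : IntervalIntegrable (fun t => f t ^ 2) volume a b)
    (hx : x ∈ Icc a b) (hy : y ∈ Icc a b) (hA : |y - x| ≤ A)
    (hH : ∫ t in a..b, f t ^ 2 ≤ H) : |∫ t in x..y, f t| ≤ √(A * H) := by
  wlog hxy : x ≤ y generalizing x y
  · rw [intervalIntegral.integral_symm, abs_neg]
    exact this hy hx (by rwa [abs_sub_comm]) (le_of_not_ge hxy)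
  have hab : a ≤ b := hx.1.trans hx.2
  have hs : uIcc x y ⊆ uIcc a b := by
    rw [uIcc_of_le hab]; exact uIcc_subset_Icc hx hy
  have h1 := sq_integral_le_mul_integral_sq hxy (hf.mono_set hs) (hf2.mono_set hs)
  have h2 : ∫ t in x..y, f t ^ 2 ≤ ∫ t in a..b, f t ^ 2 :=
    intervalIntegral.integral_mono_interval hx.1 hxy hy.2 (ae_of_all _ fun t => sq_nonneg _) hf2
  have h3 : 0 ≤ ∫ t in x..y, f t ^ 2 :=
    intervalIntegral.integral_nonneg hxy fun t _ => sq_nonneg _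
  rw [abs_of_nonneg (by linarith : 0 ≤ y - x)] at hA
  refine Real.abs_le_sqrt (h1.trans ?_)
  exact mul_le_mul hA (h2.trans hH) h3 ((sub_nonneg.2 hxy).trans hA)

/-- The lengths of almost optimal transitions converge to the optimal length. -/
theorem tendsto_length_of_energy_le {W : ℝ} (hW : 0 < W) {J κ B ℓ : ℕ → ℝ}
    (hJ : Tendsto J atTop (𝓝 W)) (hκ : Tendsto κ atTop (𝓝 4))
    (hB : Tendsto B atTop (𝓝 (alpha0 * √W))) (hℓ : ∀ᶠ n in atTop, 0 < ℓ n)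
    (h : ∀ᶠ n in atTop, 12 * J n ^ 2 / ℓ n ^ 3 + κ n * ℓ n ≤ B n) :
    Tendsto ℓ atTop (𝓝 (√3 * √W)) := by
  have h3 : (√3 : ℝ) ^ 2 = 3 := Real.sq_sqrt (by norm_num)
  have h30 : (0 : ℝ) < √3 := by positivity
  have hW2 : √W ^ 2 = W := Real.sq_sqrt hW.le
  have hW0 : 0 < √W := Real.sqrt_pos.2 hW
  set M := √3 * √W with hM
  have hM0 : 0 < M := mul_pos h30 hW0
  have hM2 : M ^ 2 = 3 * W := by rw [hM, mul_pow, h3, hW2]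
  have hαM : alpha0 * √W = 16 * M / 3 := by
    rw [alpha0, hM, div_mul_eq_mul_div, div_eq_div_iff h30.ne' (by norm_num)]
    linear_combination (-16) * √W * h3
  set K := alpha0 * √W + 1 with hK
  -- The lengths are bounded because κ is eventually larger than 1, so that ℓ ≤ B.
  have hbd : ∀ᶠ n in atTop, ℓ n ≤ K := by
    filter_upwards [hℓ, h, hκ.eventually_const_lt (show (1 : ℝ) < 4 by norm_num),
      hB.eventually_lt_const (show alpha0 * √W < K by linarith)] with n h1 h2 h3 h4
    have : 0 ≤ 12 * J n ^ 2 / ℓ n ^ 3 := by positivity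
    nlinarith
  set e : ℕ → ℝ := fun n =>
    K ^ 3 * |B n - alpha0 * √W| + 12 * |W ^ 2 - J n ^ 2| + K ^ 4 * |4 - κ n| with he
  have he0 : Tendsto e atTop (𝓝 0) := by
    have t1 := ((hB.sub_const (alpha0 * √W)).abs).const_mul (K ^ 3)
    have t2 := (((hJ.pow 2).const_sub (W ^ 2)).abs).const_mul 12
    have t3 := ((hκ.const_sub 4).abs).const_mul (K ^ 4)
    simpa using (t1.add t2).add t3
  have hmain : ∀ᶠ n in atTop, (ℓ n - M) ^ 2 ≤ e n * (3 / (4 * M ^ 2)) := by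
    filter_upwards [hℓ, h, hbd] with n h1 h2 h4
    have hl3 : 0 < ℓ n ^ 3 := by positivity
    have e1 : 12 * J n ^ 2 + κ n * ℓ n ^ 4 ≤ B n * ℓ n ^ 3 := by
      have := mul_le_mul_of_nonneg_right h2 hl3.le
      rw [add_mul, div_mul_cancel₀ _ hl3.ne'] at this
      linarith
    have b1 : ℓ n ^ 3 * (B n - alpha0 * √W) ≤ K ^ 3 * |B n - alpha0 * √W| :=
      (mul_le_mul_of_nonneg_left (le_abs_self _) hl3.le).trans
        (mul_le_mul_of_nonneg_right (pow_le_pow_left₀ h1.le h4 3) (abs_nonneg _))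
    have b2 : W ^ 2 - J n ^ 2 ≤ |W ^ 2 - J n ^ 2| := le_abs_self _
    have b3 : ℓ n ^ 4 * (4 - κ n) ≤ K ^ 4 * |4 - κ n| :=
      (mul_le_mul_of_nonneg_left (le_abs_self _) (by positivity)).trans
        (mul_le_mul_of_nonneg_right (pow_le_pow_left₀ h1.le h4 4) (abs_nonneg _))
    have hW4 : 12 * W ^ 2 = 4 / 3 * M ^ 4 := by
      have : M ^ 4 = (3 * W) ^ 2 := by rw [← hM2]; ring
      rw [this]; ring
    -- The limit inequality 12W² + 4ℓ⁴ ≤ α₀√W ℓ³ has M = √3 √W as a double root of the difference of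
    -- its sides; the square (ℓ - M)² factors out and is controlled by the error e.
    have e2 : 4 / 3 * ((ℓ n - M) ^ 2 * (3 * ℓ n ^ 2 + 2 * ℓ n * M + M ^ 2)) ≤ e n := by
      have : 4 / 3 * ((ℓ n - M) ^ 2 * (3 * ℓ n ^ 2 + 2 * ℓ n * M + M ^ 2)) =
          12 * W ^ 2 + 4 * ℓ n ^ 4 - alpha0 * √W * ℓ n ^ 3 := by
        rw [hW4, hαM]; ring
      rw [this]
      simp only [he]
      linarith
    have e3 : (ℓ n - M) ^ 2 * M ^ 2 ≤
        (ℓ n - M) ^ 2 * (3 * ℓ n ^ 2 + 2 * ℓ n * M + M ^ 2) := by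
      refine mul_le_mul_of_nonneg_left ?_ (sq_nonneg _)
      have : 0 ≤ 2 * ℓ n * M := by positivity
      nlinarith [sq_nonneg (ℓ n)]
    have : (ℓ n - M) ^ 2 = (ℓ n - M) ^ 2 * M ^ 2 * (1 / M ^ 2) := by field_simp
    rw [this]
    have e4 : (ℓ n - M) ^ 2 * M ^ 2 ≤ e n * (3 / 4) := by linarith
    calc (ℓ n - M) ^ 2 * M ^ 2 * (1 / M ^ 2) ≤ e n * (3 / 4) * (1 / M ^ 2) :=
          mul_le_mul_of_nonneg_right e4 (by positivity)
      _ = _ := by field_simp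
  have hsq : Tendsto (fun n => (ℓ n - M) ^ 2) atTop (𝓝 0) :=
    squeeze_zero' (Eventually.of_forall fun n => sq_nonneg _) hmain
      (by simpa using he0.mul_const (3 / (4 * M ^ 2)))
  have habs : Tendsto (fun n => |ℓ n - M|) atTop (𝓝 0) := by
    have := hsq.sqrt
    simpa [Real.sqrt_sq_eq_abs] using this
  rw [tendsto_iff_dist_tendsto_zero]
  simpa [Real.dist_eq] using habs

/-- The excess of energy of almost optimal transitions vanishes in the limit. -/
theorem tendsto_energy_excess {W : ℝ} (hW : 0 < W) {J κ B ℓ : ℕ → ℝ}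
    (hJ : Tendsto J atTop (𝓝 W)) (hκ : Tendsto κ atTop (𝓝 4))
    (hB : Tendsto B atTop (𝓝 (alpha0 * √W))) (hℓ : Tendsto ℓ atTop (𝓝 (√3 * √W))) :
    Tendsto (fun n => B n - κ n * ℓ n - 12 * J n ^ 2 / ℓ n ^ 3) atTop (𝓝 0) := by
  have h3 : (√3 : ℝ) ^ 2 = 3 := Real.sq_sqrt (by norm_num)
  have h30 : (0 : ℝ) < √3 := by positivity
  have hW2 : √W ^ 2 = W := Real.sq_sqrt hW.le
  have hW0 : 0 < √W := Real.sqrt_pos.2 hW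
  have hM0 : (√3 * √W) ^ 3 ≠ 0 := by positivity
  have t := (hB.sub (hκ.mul hℓ)).sub (((hJ.pow 2).const_mul 12).div (hℓ.pow 3) hM0)
  convert! t using 2
  rw [alpha0]
  generalize √W = w at *
  generalize √3 = a at *
  subst hW2
  have e1 : 16 / a = 16 * a / 3 := by
    rw [div_eq_div_iff h30.ne' (by norm_num)]; linear_combination (-16) * h3
  have e2 : 12 * (w ^ 2) ^ 2 / (a * w) ^ 3 = 4 * a * w / 3 := by
    rw [div_eq_div_iff hM0 (by norm_num)]
    linear_combination (-4) * w ^ 4 * (a ^ 2 + 3) * h3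
  rw [e2, e1]
  ring

/-- Stability of the inversion of the cubic `t ↦ (3 t - t³) / 2` on `[-1, 1]`. -/
theorem tendsto_of_tendsto_cubic {t : ℕ → ℝ} {t₀ : ℝ} (ht₀ : t₀ ∈ Ioo (-1 : ℝ) 1)
    (ht : ∀ᶠ n in atTop, t n ∈ Icc (-1 : ℝ) 1)
    (h : Tendsto (fun n => 3 / 2 * t n - 1 / 2 * t n ^ 3) atTop
      (𝓝 (3 / 2 * t₀ - 1 / 2 * t₀ ^ 3))) : Tendsto t atTop (𝓝 t₀) := by
  have hpos : 0 < 1 - |t₀| := by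
    have := abs_lt.2 ⟨ht₀.1, ht₀.2⟩
    linarith
  have hb : ∀ᶠ n in atTop, |t n - t₀| ≤ |(3 / 2 * t n - 1 / 2 * t n ^ 3) -
      (3 / 2 * t₀ - 1 / 2 * t₀ ^ 3)| * (2 / (1 - |t₀|)) := by
    filter_upwards [ht] with n hn
    have e : (3 / 2 * t n - 1 / 2 * t n ^ 3) - (3 / 2 * t₀ - 1 / 2 * t₀ ^ 3) =
        (t n - t₀) * ((3 - (t n ^ 2 + t n * t₀ + t₀ ^ 2)) / 2) := by ring
    -- The difference quotient of the cubic between t n and t₀ stays away from zero even when t n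
    -- reaches ±1, where the cubic itself has a critical point, because |t₀| < 1.
    have hq : (1 - |t₀|) / 2 ≤ (3 - (t n ^ 2 + t n * t₀ + t₀ ^ 2)) / 2 := by
      have h1 : t n ^ 2 ≤ 1 := by nlinarith [hn.1, hn.2]
      have h2 : t₀ ^ 2 ≤ 1 := by nlinarith [ht₀.1, ht₀.2]
      have h3 : t n * t₀ ≤ |t₀| := by
        refine (le_abs_self _).trans ?_
        rw [abs_mul]
        exact mul_le_of_le_one_left (abs_nonneg _) (abs_le.2 hn)
      linarith
    rw [e, abs_mul, abs_of_nonneg ((by positivity : 0 ≤ (1 - |t₀|) / 2).trans hq)]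
    calc |t n - t₀| = |t n - t₀| * ((1 - |t₀|) / 2) * (2 / (1 - |t₀|)) := by field_simp
      _ ≤ _ := by gcongr
  rw [tendsto_iff_dist_tendsto_zero]
  refine squeeze_zero' (Eventually.of_forall fun n => dist_nonneg) hb ?_
  have := ((h.sub_const (3 / 2 * t₀ - 1 / 2 * t₀ ^ 3)).abs).mul_const (2 / (1 - |t₀|))
  simpa using this

end

/-! ### Almost optimal sequences: one component carries the whole transition. -/

section

/-- Pointwise, p is at most the positive part of p - δ plus p⁺ capped at δ. The first term measures
the height gained by bumps, the second is negligible for small energy. -/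
theorem integral_le_setIntegral_superlevel_add {p : ℝ → ℝ} (hp : Continuous p) {δ y₁ y₂ : ℝ}
    (hδ : 0 ≤ δ) (hy : y₁ ≤ y₂) :
    ∫ x in y₁..y₂, p x ≤ (∫ x in {x ∈ Ioo y₁ y₂ | δ < p x}, (p x - δ)) +
      ∫ x in y₁..y₂, min (max (p x) 0) δ := by
  have hU : MeasurableSet {x ∈ Ioo y₁ y₂ | δ < p x} :=
    (isOpen_Ioo.inter (isOpen_lt continuous_const hp)).measurableSet
  have h1 : ∫ x in {x ∈ Ioo y₁ y₂ | δ < p x}, (p x - δ) = ∫ x in y₁..y₂, max (p x - δ) 0 := by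
    rw [intervalIntegral.integral_of_le hy, integral_Ioc_eq_integral_Ioo,
      ← integral_indicator hU, ← integral_indicator measurableSet_Ioo]
    congr 1
    ext x
    by_cases hx : x ∈ Ioo y₁ y₂
    · rw [indicator_of_mem hx]
      by_cases hd : δ < p x
      · rw [indicator_of_mem (show x ∈ {x ∈ Ioo y₁ y₂ | δ < p x} from ⟨hx, hd⟩),
          max_eq_left (by linarith)]
      · rw [indicator_of_notMem (fun h => hd h.2), max_eq_right (by linarith)]
    · rw [indicator_of_notMem hx, indicator_of_notMem (fun h => hx h.1)]
  have c1 : Continuous fun x => max (p x - δ) 0 := by fun_prop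
  have c2 : Continuous fun x => min (max (p x) 0) δ := by fun_prop
  rw [h1, ← intervalIntegral.integral_add (c1.intervalIntegrable _ _) (c2.intervalIntegrable _ _)]
  refine intervalIntegral.integral_mono_on hy (hp.intervalIntegrable _ _)
    ((c1.add c2).intervalIntegrable _ _) fun x _ => ?_
  rcases le_or_gt (p x) δ with h | h
  · rw [min_eq_left (max_le h hδ)]
    have h2 := le_max_left (p x) 0
    have h3 := le_max_right (p x - δ) 0
    linarith
  · rw [max_eq_left (by linarith : 0 ≤ p x), min_eq_right h.le]
    have h3 := le_max_left (p x - δ) 0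
    linarith

/-- Sequences of rescaled functions `w n` on `[-R n, R n]`, with derivatives `p n` and `r n`, which
realise a transition between the values `V (-1 - τ₀)` and `V (1 - τ₀)` with almost minimal total
variation and almost minimal energy; the measure of the set where `p n` exceeds the threshold
`δ n` is penalised by the factor `κ n`. -/
structure AlmostOptimal (V τ₀ : ℝ) (R δ κ B T θ y₁ y₂ : ℕ → ℝ) (w p r : ℕ → ℝ → ℝ) : Prop where
  V_pos : 0 < V
  rep : ∀ n, IsH2Rep (-R n) (R n) (w n) (p n) (r n)
  R_tendsto : Tendsto R atTop atTop
  w_zero : ∀ n, w n 0 = 0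
  δ_nonneg : ∀ᶠ n in atTop, 0 ≤ δ n
  δ_tendsto : Tendsto δ atTop (𝓝 0)
  κ_le : ∀ᶠ n in atTop, κ n ≤ 4
  κ_tendsto : Tendsto κ atTop (𝓝 4)
  B_tendsto : Tendsto B atTop (𝓝 (alpha0 * √(2 * V)))
  energy_le : ∀ᶠ n in atTop, (∫ x in -R n..R n, r n x ^ 2) +
    κ n * volume.real {x ∈ Ioo (-R n) (R n) | δ n < p n x} ≤ B n
  T_tendsto : Tendsto T atTop (𝓝 (2 * V))
  variation_le : ∀ᶠ n in atTop, ∫ x in -R n..R n, |p n x| ≤ T n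
  y₁_mem : ∀ᶠ n in atTop, y₁ n ∈ Ioo (-R n) 0
  y₂_mem : ∀ᶠ n in atTop, y₂ n ∈ Ioo 0 (R n)
  p_y₁_le : ∀ᶠ n in atTop, p n (y₁ n) ≤ δ n
  p_y₂_le : ∀ᶠ n in atTop, p n (y₂ n) ≤ δ n
  w_y₁_tendsto : Tendsto (fun n => w n (y₁ n)) atTop (𝓝 (V * (-1 - τ₀)))
  w_y₂_tendsto : Tendsto (fun n => w n (y₂ n)) atTop (𝓝 (V * (1 - τ₀)))
  θ_tendsto : Tendsto θ atTop (𝓝 0)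
  integral_min_le : ∀ᶠ n in atTop, ∫ x in y₁ n..y₂ n, min (max (p n x) 0) (δ n) ≤ θ n

variable {V τ₀ : ℝ} {R δ κ B T θ y₁ y₂ : ℕ → ℝ} {w p r : ℕ → ℝ → ℝ}

theorem alpha0_pos : 0 < alpha0 := by unfold alpha0; positivity

theorem AlmostOptimal.exists_isBump (h : AlmostOptimal V τ₀ R δ κ B T θ y₁ y₂ w p r) :
    ∃ α β : ℕ → ℝ, (∀ᶠ n in atTop, IsBump (p n) (δ n) (y₁ n) (y₂ n) (α n) (β n)) ∧
      Tendsto (fun n => ∫ x in α n..β n, (p n x - δ n)) atTop (𝓝 (2 * V)) := by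
  have hV2 : 0 < √(2 * V) := Real.sqrt_pos.2 (by linarith [h.V_pos])
  have hV2s : √(2 * V) ^ 2 = 2 * V := Real.sq_sqrt (by linarith [h.V_pos])
  have hα0 := alpha0_pos
  have hE0 : 0 < alpha0 * √(2 * V) := mul_pos hα0 hV2
  set q : ℕ → ℝ := fun n => w n (y₂ n) - w n (y₁ n) - θ n with hq
  have hqt : Tendsto q atTop (𝓝 (2 * V)) := by
    have := (h.w_y₂_tendsto.sub h.w_y₁_tendsto).sub h.θ_tendsto
    convert! this using 2; ring
  -- The total height of the bumps is at least q, and their energy with weight 4 is at most 4B/κ.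
  -- The quotient is the threshold given by the single-bump argument; the term 1/(n + 1) makes the
  -- inequality strict, and the limit is 2V/√(2V).
  set S : ℕ → ℝ := fun n => alpha0 * q n * κ n / (4 * B n) - 1 / ((n : ℝ) + 1) with hS
  have hSt : Tendsto S atTop (𝓝 √(2 * V)) := by
    have := (((hqt.const_mul alpha0).mul h.κ_tendsto).div (h.B_tendsto.const_mul 4)
      (by positivity)).sub (tendsto_one_div_add_atTop_nhds_zero_nat (𝕜 := ℝ))
    convert! this using 2
    rw [← hV2s, Real.sqrt_sq hV2.le]
    field_simp
    ring
  -- The pair (0, 0) is a default for the indices without a suitable bump, which eventually do not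
  -- occur.
  have hex : ∀ n, ∃ αβ : ℝ × ℝ, (∃ α β, IsBump (p n) (δ n) (y₁ n) (y₂ n) α β ∧
      S n < √(∫ x in α..β, (p n x - δ n))) →
      IsBump (p n) (δ n) (y₁ n) (y₂ n) αβ.1 αβ.2 ∧
      S n < √(∫ x in αβ.1..αβ.2, (p n x - δ n)) := fun n => by
    by_cases hc : ∃ α β, IsBump (p n) (δ n) (y₁ n) (y₂ n) α β ∧
      S n < √(∫ x in α..β, (p n x - δ n))
    · obtain ⟨α, β, h'⟩ := hc
      exact ⟨(α, β), fun _ => h'⟩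
    · exact ⟨(0, 0), fun h' => absurd h' hc⟩
  choose αβ hαβ using hex
  have hev : ∀ᶠ n in atTop, IsBump (p n) (δ n) (y₁ n) (y₂ n) (αβ n).1 (αβ n).2 ∧
      S n < √(∫ x in (αβ n).1..(αβ n).2, (p n x - δ n)) := by
    filter_upwards [h.δ_nonneg, h.κ_le, h.κ_tendsto.eventually_const_lt (by norm_num : (0 : ℝ) < 4),
      h.B_tendsto.eventually_const_lt hE0, hSt.eventually_const_lt hV2, h.energy_le,
      h.y₁_mem, h.y₂_mem, h.p_y₁_le, h.p_y₂_le, h.integral_min_le] with n hδ hκ4 hκ0 hB0 hS0 hen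
      hy1 hy2 hp1 hp2 hmin
    refine hαβ n ((h.rep n).exists_isBump hp1 hp2 ?_)
    have hy : y₁ n ≤ y₂ n := (hy1.2.trans hy2.1).le
    have hm1 : y₁ n ∈ Icc (-R n) (R n) := ⟨hy1.1.le, by linarith [hy1.2, hy2.1, hy2.2]⟩
    have hm2 : y₂ n ∈ Icc (-R n) (R n) := ⟨by linarith [hy1.2, hy2.1, hy1.1], hy2.2.le⟩
    have hQ : q n ≤ ∫ x in {x ∈ Ioo (y₁ n) (y₂ n) | δ n < p n x}, (p n x - δ n) := by
      have := integral_le_setIntegral_superlevel_add (h.rep n).continuous hδ hy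
      rw [← (h.rep n).sub_eq' _ hm1 _ hm2] at this
      simp only [hq]; linarith
    set U := {x ∈ Ioo (y₁ n) (y₂ n) | δ n < p n x} with hU
    have hUs : U ⊆ {x ∈ Ioo (-R n) (R n) | δ n < p n x} := fun x hx =>
      ⟨⟨hm1.1.trans_lt hx.1.1, hx.1.2.trans_le hm2.2⟩, hx.2⟩
    have hUs' : U ⊆ Ioo (-R n) (R n) := fun x hx => (hUs hx).1
    have hfin : volume {x ∈ Ioo (-R n) (R n) | δ n < p n x} ≠ ⊤ :=
      measure_ne_top_of_subset (fun x hx => hx.1) (by simp)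
    have hRR : -R n ≤ R n := hm1.1.trans hm1.2
    have hUE : ∫ x in U, (r n x ^ 2 + 4) ≤ 4 * B n / κ n := by
      have hfU : IntegrableOn (fun _ : ℝ => (4 : ℝ)) U :=
        integrableOn_const (measure_ne_top_of_subset hUs hfin)
      rw [integral_add (h.rep n).integrable_sq.integrableOn hfU, setIntegral_const, smul_eq_mul]
      have h1 : ∫ x in U, r n x ^ 2 ≤ ∫ x in -R n..R n, r n x ^ 2 := by
        rw [intervalIntegral.integral_of_le hRR, integral_Ioc_eq_integral_Ioo]
        exact setIntegral_mono_set (h.rep n).integrable_sq.integrableOn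
          (ae_of_all _ fun x => sq_nonneg _) (ae_of_all _ hUs')
      have h2 : volume.real U ≤ volume.real {x ∈ Ioo (-R n) (R n) | δ n < p n x} :=
        measureReal_mono hUs hfin
      have h3 : 0 ≤ ∫ x in U, r n x ^ 2 := integral_nonneg fun x => sq_nonneg _
      rw [le_div_iff₀ hκ0]
      have h5 : (∫ x in U, r n x ^ 2) * κ n ≤ (∫ x in U, r n x ^ 2) * 4 :=
        mul_le_mul_of_nonneg_left hκ4 h3
      have h6 := mul_le_mul_of_nonneg_left h2 hκ0.le
      linarith
    have hn : 0 < 1 / ((n : ℝ) + 1) := by positivity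
    calc S n * ∫ x in U, (r n x ^ 2 + 4) ≤ S n * (4 * B n / κ n) :=
          mul_le_mul_of_nonneg_left hUE hS0.le
      _ < (S n + 1 / ((n : ℝ) + 1)) * (4 * B n / κ n) :=
          mul_lt_mul_of_pos_right (by linarith) (by positivity)
      _ = alpha0 * q n := by
          simp only [hS, sub_add_cancel]; field_simp
      _ ≤ alpha0 * _ := mul_le_mul_of_nonneg_left hQ hα0.le
  refine ⟨fun n => (αβ n).1, fun n => (αβ n).2, hev.mono fun n hn => hn.1, ?_⟩
  -- The height of the chosen bump lies between S² and the total variation bound T, both of which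
  -- tend to 2V.
  refine tendsto_of_tendsto_of_tendsto_of_le_of_le' (g := fun n => S n ^ 2) (h := T)
    (by rw [← hV2s]; exact hSt.pow 2) h.T_tendsto ?_ ?_
  · filter_upwards [hev, hSt.eventually_const_lt hV2] with n hn hS0
    exact (Real.lt_sqrt hS0.le).1 hn.2 |>.le
  · filter_upwards [hev, h.variation_le, h.δ_nonneg, h.y₁_mem, h.y₂_mem] with n hn hT hδ hy1 hy2
    have hb := hn.1
    refine le_trans ?_ hT
    have hpc := (h.rep n).continuous
    calc ∫ x in (αβ n).1..(αβ n).2, (p n x - δ n) ≤ ∫ x in (αβ n).1..(αβ n).2, |p n x| :=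
          intervalIntegral.integral_mono_on hb.lt.le
            ((hpc.sub continuous_const).intervalIntegrable _ _)
            (hpc.abs.intervalIntegrable _ _) fun x _ => by linarith [le_abs_self (p n x)]
      _ ≤ ∫ x in -R n..R n, |p n x| :=
          intervalIntegral.integral_mono_interval (hy1.1.le.trans hb.le_left) hb.lt.le
            (hb.right_le.trans hy2.2.le) (ae_of_all _ fun x => abs_nonneg _)
            (hpc.abs.intervalIntegrable _ _)

end

/-! ### The large component: length, excess and oscillation. -/

section

/-- The second derivative of the cubic transition of height `J` on `[α, β]`, extended by zero. -/
def cubicSecondDeriv (J α β : ℝ) : ℝ → ℝ :=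
  (Ioo α β).indicator fun x => 12 * J / (β - α) ^ 3 * ((α + β) / 2 - x)

theorem integrable_cubicSecondDeriv (J α β : ℝ) : Integrable (cubicSecondDeriv J α β) :=
  IntegrableOn.integrable_indicator
    (((Continuous.continuousOn (by fun_prop)).integrableOn_Icc (a := α) (b := β)).mono_set
      Ioo_subset_Icc_self) measurableSet_Ioo

theorem integrable_sub_cubicSecondDeriv_sq {a b : ℝ} {u p r : ℝ → ℝ} (h : IsH2Rep a b u p r)
    (J α β : ℝ) : Integrable fun x => (r x - cubicSecondDeriv J α β x) ^ 2 := by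
  have : MemLp (cubicSecondDeriv J α β) 2 volume := by
    rw [memLp_two_iff_integrable_sq (integrable_cubicSecondDeriv J α β).aestronglyMeasurable]
    have e : (fun x => cubicSecondDeriv J α β x ^ 2) =
        (Ioo α β).indicator fun x => (12 * J / (β - α) ^ 3 * ((α + β) / 2 - x)) ^ 2 := by
      ext x
      by_cases hx : x ∈ Ioo α β <;> simp [cubicSecondDeriv, hx]
    rw [e]
    exact IntegrableOn.integrable_indicator
      (((Continuous.continuousOn (by fun_prop)).integrableOn_Icc (a := α) (b := β)).mono_set
        Ioo_subset_Icc_self) measurableSet_Ioo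
  exact (h.memLp.sub this).integrable_sq

/-- The projection identity on (α, β), together with the trivial one outside, where the cubic second
derivative vanishes. Thus r is also compared with 0 off the bump. -/
theorem IsH2Rep.integral_sub_cubicSecondDeriv_sq {a b : ℝ} {u p r : ℝ → ℝ}
    (h : IsH2Rep a b u p r) {δ α β A : ℝ} (hα : -A ≤ α) (hαβ : α < β) (hβ : β ≤ A)
    (hpα : p α = δ) (hpβ : p β = δ) {J : ℝ} (hJ : J = ∫ x in α..β, (p x - δ)) :
    ∫ x in -A..A, (r x - cubicSecondDeriv J α β x) ^ 2 =
      (∫ x in -A..A, r x ^ 2) - 12 * J ^ 2 / (β - α) ^ 3 := by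
  set f : ℝ → ℝ := fun x => (r x - 12 * J / (β - α) ^ 3 * ((α + β) / 2 - x)) ^ 2 with hf
  have hsub : Ioo α β ⊆ Ioo (-A) A := fun x hx => ⟨hα.trans_lt hx.1, hx.2.trans_le hβ⟩
  have e : (fun x => (r x - cubicSecondDeriv J α β x) ^ 2) =
      fun x => r x ^ 2 + (Ioo α β).indicator (fun x => f x - r x ^ 2) x := by
    ext x
    by_cases hx : x ∈ Ioo α β <;> simp [cubicSecondDeriv, hx, hf]
  have i1 : ∀ s, IntegrableOn (fun x => r x ^ 2) s := fun s => h.integrable_sq.integrableOn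
  have i2 : IntegrableOn f (Ioo α β) := by
    have := (integrable_sub_cubicSecondDeriv_sq h J α β).integrableOn (s := Ioo α β)
    refine this.congr_fun (fun x hx => ?_) measurableSet_Ioo
    simp [cubicSecondDeriv, hx, hf]
  have hid := h.integral_sub_affine_sq_eq hαβ hpα hpβ hJ
  rw [intervalIntegral.integral_of_le hαβ.le, intervalIntegral.integral_of_le hαβ.le,
    integral_Ioc_eq_integral_Ioo, integral_Ioc_eq_integral_Ioo] at hid
  have i3 : Integrable ((Ioo α β).indicator fun x => f x - r x ^ 2) :=
    IntegrableOn.integrable_indicator (i2.sub (i1 _)) measurableSet_Ioo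
  rw [e, intervalIntegral.integral_of_le (by linarith), intervalIntegral.integral_of_le
    (by linarith), integral_Ioc_eq_integral_Ioo, integral_Ioc_eq_integral_Ioo,
    integral_add (i1 _) i3.integrableOn,
    setIntegral_indicator measurableSet_Ioo, inter_eq_right.2 hsub, integral_sub i2 (i1 _), hid]
  ring

/-- The data of `AlmostOptimal` with the component `(α n, β n)` of `{p n > δ n}` which carries
almost all the variation. -/
structure AlmostOptimalBump (V τ₀ : ℝ) (R δ κ B T θ y₁ y₂ : ℕ → ℝ) (w p r : ℕ → ℝ → ℝ)
    (α β : ℕ → ℝ) : Prop extends AlmostOptimal V τ₀ R δ κ B T θ y₁ y₂ w p r where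
  isBump : ∀ᶠ n in atTop, IsBump (p n) (δ n) (y₁ n) (y₂ n) (α n) (β n)
  J_tendsto : Tendsto (fun n => ∫ x in α n..β n, (p n x - δ n)) atTop (𝓝 (2 * V))

variable {V τ₀ : ℝ} {R δ κ B T θ y₁ y₂ : ℕ → ℝ} {w p r : ℕ → ℝ → ℝ} {α β : ℕ → ℝ}

namespace AlmostOptimalBump

variable (h : AlmostOptimalBump V τ₀ R δ κ B T θ y₁ y₂ w p r α β)

include h

theorem eventually_mem : ∀ᶠ n in atTop, -R n ≤ α n ∧ α n < β n ∧ β n ≤ R n := by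
  filter_upwards [h.isBump, h.y₁_mem, h.y₂_mem] with n hb h1 h2
  exact ⟨h1.1.le.trans hb.le_left, hb.lt, hb.right_le.trans h2.2.le⟩

/-- Because (α, β) is contained in the superlevel set, the energy bound leaves at most B - κ(β - α)
for ∫ r². The length of the bump and the closeness of r to its affine model both follow from this
single estimate. -/
theorem eventually_excess_le : ∀ᶠ n in atTop,
    ∫ x in -R n..R n,
      (r n x - cubicSecondDeriv (∫ x in α n..β n, (p n x - δ n)) (α n) (β n) x) ^ 2 ≤
      B n - κ n * (β n - α n) -
        12 * (∫ x in α n..β n, (p n x - δ n)) ^ 2 / (β n - α n) ^ 3 := by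
  filter_upwards [h.isBump, h.eventually_mem, h.energy_le,
    h.κ_tendsto.eventually_const_lt (by norm_num : (0 : ℝ) < 4)] with n hb hm hen hκ
  rw [(h.rep n).integral_sub_cubicSecondDeriv_sq hm.1 hm.2.1 hm.2.2 hb.eq_left hb.eq_right rfl]
  have hle : β n - α n ≤ volume.real {x ∈ Ioo (-R n) (R n) | δ n < p n x} := by
    have hfin : volume {x ∈ Ioo (-R n) (R n) | δ n < p n x} ≠ ⊤ :=
      measure_ne_top_of_subset (fun x hx => hx.1) (by simp)
    have hsub : Ioo (α n) (β n) ⊆ {x ∈ Ioo (-R n) (R n) | δ n < p n x} := fun x hx =>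
      ⟨⟨hm.1.trans_lt hx.1, hx.2.trans_le hm.2.2⟩, hb.lt_of_mem x hx⟩
    have := measureReal_mono (μ := volume) hsub hfin
    rwa [Real.volume_real_Ioo_of_le hm.2.1.le] at this
  have := mul_le_mul_of_nonneg_left hle hκ.le
  linarith

theorem tendsto_length : Tendsto (fun n => β n - α n) atTop (𝓝 (√3 * √(2 * V))) := by
  refine tendsto_length_of_energy_le (by linarith [h.V_pos]) h.J_tendsto h.κ_tendsto h.B_tendsto
    (h.eventually_mem.mono fun n hn => sub_pos.2 hn.2.1) ?_
  filter_upwards [h.eventually_excess_le, h.eventually_mem] with n hn hm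
  have : 0 ≤ ∫ x in -R n..R n,
      (r n x - cubicSecondDeriv (∫ x in α n..β n, (p n x - δ n)) (α n) (β n) x) ^ 2 :=
    intervalIntegral.integral_nonneg (by linarith) fun x _ => sq_nonneg _
  linarith

theorem exists_tendsto_excess : ∃ D : ℕ → ℝ, Tendsto D atTop (𝓝 0) ∧ ∀ᶠ n in atTop,
    ∫ x in -R n..R n,
      (r n x - cubicSecondDeriv (∫ x in α n..β n, (p n x - δ n)) (α n) (β n) x) ^ 2 ≤ D n :=
  ⟨_, tendsto_energy_excess (by linarith [h.V_pos]) h.J_tendsto h.κ_tendsto h.B_tendsto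
    h.tendsto_length, h.eventually_excess_le⟩

/-- The bump already uses variation J → 2V out of a total of at most T → 2V, so at most T - J → 0
remains on the two sides. -/
theorem exists_tendsto_oscillation : ∃ σ : ℕ → ℝ, Tendsto σ atTop (𝓝 0) ∧ ∀ᶠ n in atTop,
    (∀ x ∈ Icc (-R n) (α n), ∀ y ∈ Icc (-R n) (α n), |w n y - w n x| ≤ σ n) ∧
      ∀ x ∈ Icc (β n) (R n), ∀ y ∈ Icc (β n) (R n), |w n y - w n x| ≤ σ n := by
  refine ⟨fun n => T n - ∫ x in α n..β n, (p n x - δ n),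
    by simpa using h.T_tendsto.sub h.J_tendsto, ?_⟩
  filter_upwards [h.eventually_mem, h.variation_le, h.δ_nonneg] with n hm hT hδ
  have hpc := (h.rep n).continuous
  have hi : ∀ x y, IntervalIntegrable (fun x => |p n x|) volume x y :=
    fun x y => hpc.abs.intervalIntegrable x y
  have hJ : ∫ x in α n..β n, (p n x - δ n) ≤ ∫ x in α n..β n, |p n x| :=
    intervalIntegral.integral_mono_on hm.2.1.le ((hpc.sub continuous_const).intervalIntegrable _ _)
      (hi _ _) fun x _ => by linarith [le_abs_self (p n x)]
  have e1 := intervalIntegral.integral_add_adjacent_intervals (hi (-R n) (α n)) (hi (α n) (β n))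
  have e2 := intervalIntegral.integral_add_adjacent_intervals (hi (-R n) (β n)) (hi (β n) (R n))
  have n1 : 0 ≤ ∫ x in -R n..α n, |p n x| :=
    intervalIntegral.integral_nonneg hm.1 fun x _ => abs_nonneg _
  have n2 : 0 ≤ ∫ x in β n..R n, |p n x| :=
    intervalIntegral.integral_nonneg hm.2.2 fun x _ => abs_nonneg _
  have key : ∀ c d : ℝ, Icc c d ⊆ Icc (-R n) (R n) → ∀ x ∈ Icc c d, ∀ y ∈ Icc c d,
      |w n y - w n x| ≤ ∫ x in c..d, |p n x| := by
    intro c d hcd x hx y hy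
    wlog hxy : x ≤ y generalizing x y
    · rw [abs_sub_comm]; exact this y hy x hx (le_of_not_ge hxy)
    rw [(h.rep n).sub_eq' x (hcd hx) y (hcd hy)]
    exact (intervalIntegral.abs_integral_le_integral_abs hxy).trans
      (intervalIntegral.integral_mono_interval hx.1 hxy hy.2 (ae_of_all _ fun x => abs_nonneg _)
        (hi _ _))
  refine ⟨fun x hx y hy => (key _ _ (Icc_subset_Icc le_rfl (hm.2.1.le.trans hm.2.2))
    x hx y hy).trans (by linarith), fun x hx y hy => (key _ _ (Icc_subset_Icc
    (hm.1.trans hm.2.1.le) le_rfl) x hx y hy).trans (by linarith)⟩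

theorem tendsto_w_left : Tendsto (fun n => w n (α n)) atTop (𝓝 (V * (-1 - τ₀))) := by
  obtain ⟨σ, hσ, hw⟩ := h.exists_tendsto_oscillation
  refine tendsto_of_tendsto_of_dist h.w_y₁_tendsto (squeeze_zero' (Eventually.of_forall
    fun n => dist_nonneg) ?_ hσ)
  filter_upwards [hw, h.isBump, h.y₁_mem] with n hn hb h1
  rw [dist_comm, Real.dist_eq]
  exact hn.1 _ ⟨h1.1.le, hb.le_left⟩ _ ⟨h1.1.le.trans hb.le_left, le_rfl⟩

/-- On the left of the bump w is close to V(-1 - τ₀) < 0, on the right to V(1 - τ₀) > 0, and neither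
is compatible with w(0) = 0. This uses that τ₀ is strictly between -1 and 1. -/
theorem eventually_zero_mem (hτ₀ : τ₀ ∈ Ioo (-1 : ℝ) 1) :
    ∀ᶠ n in atTop, α n < 0 ∧ 0 < β n := by
  obtain ⟨σ, hσ, hw⟩ := h.exists_tendsto_oscillation
  have hV := h.V_pos
  have l1 : V * (-1 - τ₀) < 0 := by nlinarith [hτ₀.1]
  have l2 : 0 < V * (1 - τ₀) := by nlinarith [hτ₀.2]
  have t1 : Tendsto (fun n => w n (y₁ n) + σ n) atTop (𝓝 (V * (-1 - τ₀))) := by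
    simpa using h.w_y₁_tendsto.add hσ
  have t2 : Tendsto (fun n => w n (y₂ n) - σ n) atTop (𝓝 (V * (1 - τ₀))) := by
    simpa using h.w_y₂_tendsto.sub hσ
  filter_upwards [hw, h.isBump, h.y₁_mem, h.y₂_mem, t1.eventually_lt_const l1,
    t2.eventually_const_lt l2] with n hn hb h1 h2 h3 h4
  constructor
  · by_contra hcon
    have := hn.1 (y₁ n) ⟨h1.1.le, hb.le_left⟩ 0 ⟨(h1.1.trans h1.2).le, not_lt.1 hcon⟩
    rw [h.w_zero n] at this
    linarith [(abs_le.1 this).2]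
  · by_contra hcon
    have := hn.2 (y₂ n) ⟨hb.right_le, h2.2.le⟩ 0 ⟨not_lt.1 hcon, (h2.1.trans h2.2).le⟩
    rw [h.w_zero n] at this
    linarith [(abs_le.1 this).1]

end AlmostOptimalBump

end

/-! ### Calculus of the limiting cubic profile. -/

section

/-- The cubic joins the constants with zero slope at ±1, so the one-sided derivatives agree and the
maximum covers all three branches. -/
theorem hasDerivAt_cubicProfile (x : ℝ) :
    HasDerivAt cubicProfile (3 / 2 * max (1 - x ^ 2) 0) x := by
  have hl : ∀ y ∈ Iic (-1 : ℝ), cubicProfile y = -1 := fun y hy => if_pos hy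
  have hm : ∀ y ∈ Icc (-1 : ℝ) 1, cubicProfile y = 3 / 2 * y - 1 / 2 * y ^ 3 := fun y hy => by
    rcases eq_or_lt_of_le hy.1 with h | h
    · rw [← h]; norm_num [cubicProfile]
    · simp [cubicProfile, not_le.2 h, hy.2]
  have hr : ∀ y ∈ Ici (1 : ℝ), cubicProfile y = 1 := fun y hy => by
    rcases eq_or_lt_of_le (show 1 ≤ y from hy) with h | h
    · rw [← h]; norm_num [cubicProfile]
    · simp [cubicProfile, not_le.2 h, not_le.2 (by linarith : (-1 : ℝ) < y)]
  have dl : ∀ y ∈ Iic (-1 : ℝ),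
      HasDerivWithinAt cubicProfile (3 / 2 * max (1 - y ^ 2) 0) (Iic (-1)) y := fun y hy => by
    have hy' : y ≤ -1 := hy
    rw [max_eq_right (by nlinarith), mul_zero]
    exact (hasDerivWithinAt_const y (Iic (-1)) (-1 : ℝ)).congr hl (hl y hy)
  have dr : ∀ y ∈ Ici (1 : ℝ),
      HasDerivWithinAt cubicProfile (3 / 2 * max (1 - y ^ 2) 0) (Ici 1) y := fun y hy => by
    have hy' : 1 ≤ y := hy
    rw [max_eq_right (by nlinarith), mul_zero]
    exact (hasDerivWithinAt_const y (Ici 1) (1 : ℝ)).congr hr (hr y hy)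
  have dm : ∀ y ∈ Icc (-1 : ℝ) 1,
      HasDerivWithinAt cubicProfile (3 / 2 * max (1 - y ^ 2) 0) (Icc (-1) 1) y := fun y hy => by
    rw [max_eq_left (by nlinarith [hy.1, hy.2])]
    have : HasDerivAt (fun y : ℝ => 3 / 2 * y - 1 / 2 * y ^ 3) (3 / 2 * (1 - y ^ 2)) y := by
      convert! ((hasDerivAt_id y).const_mul (3 / 2)).sub
        ((hasDerivAt_pow 3 y).const_mul (1 / 2)) using 1
      norm_num; ring
    exact this.hasDerivWithinAt.congr hm (hm y hy)
  rcases lt_trichotomy x (-1) with h | rfl | h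
  · exact (dl x h.le).hasDerivAt (Iic_mem_nhds h)
  · refine ((dl (-1) self_mem_Iic).union (dm (-1) ⟨le_rfl, by norm_num⟩)).hasDerivAt ?_
    rw [Iic_union_Icc_eq_Iic (by norm_num)]
    exact Iic_mem_nhds (by norm_num)
  rcases lt_trichotomy x 1 with h' | rfl | h'
  · exact (dm x ⟨h.le, h'.le⟩).hasDerivAt (Icc_mem_nhds h h')
  · refine ((dm 1 ⟨by norm_num, le_rfl⟩).union (dr 1 self_mem_Ici)).hasDerivAt ?_
    rw [Icc_union_Ici_eq_Ici (by norm_num)]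
    exact Ici_mem_nhds (by norm_num)
  · exact (dr x h'.le).hasDerivAt (Ici_mem_nhds h')

variable {Λ V τ₀ : ℝ}

theorem hasDerivAt_cubicTranslate (x : ℝ) : HasDerivAt (cubicTranslate Λ V τ₀)
    (V * (3 / 2 * max (1 - ((x + cubicShift Λ V τ₀) / Λ) ^ 2) 0 * (1 / Λ))) x := by
  have h1 : HasDerivAt (fun x => (x + cubicShift Λ V τ₀) / Λ) (1 / Λ) x :=
    ((hasDerivAt_id x).add_const _).div_const Λ
  exact (((hasDerivAt_cubicProfile _).comp x h1).const_mul V).sub_const _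

theorem deriv_cubicTranslate (x : ℝ) : deriv (cubicTranslate Λ V τ₀) x =
    V * (3 / 2 * max (1 - ((x + cubicShift Λ V τ₀) / Λ) ^ 2) 0 * (1 / Λ)) :=
  (hasDerivAt_cubicTranslate x).deriv

theorem continuous_deriv_cubicTranslate : Continuous (deriv (cubicTranslate Λ V τ₀)) := by
  rw [funext deriv_cubicTranslate]
  fun_prop

theorem deriv_cubicTranslate_of_le (hΛ : 0 < Λ) {x : ℝ} (hx : x ≤ -cubicShift Λ V τ₀ - Λ) :
    deriv (cubicTranslate Λ V τ₀) x = 0 := by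
  rw [deriv_cubicTranslate]
  have : (x + cubicShift Λ V τ₀) / Λ ≤ -1 := by rw [div_le_iff₀ hΛ]; linarith
  rw [max_eq_right (by nlinarith)]; ring

theorem deriv_cubicTranslate_of_ge (hΛ : 0 < Λ) {x : ℝ} (hx : -cubicShift Λ V τ₀ + Λ ≤ x) :
    deriv (cubicTranslate Λ V τ₀) x = 0 := by
  rw [deriv_cubicTranslate]
  have : 1 ≤ (x + cubicShift Λ V τ₀) / Λ := by rw [le_div_iff₀ hΛ]; linarith
  rw [max_eq_right (by nlinarith)]; ring

theorem cubicTranslate_zero (hΛ : 0 < Λ) (hτ : τ₀ ∈ Ioo (-1 : ℝ) 1) :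
    cubicTranslate Λ V τ₀ 0 = 0 := by
  rw [cubicTranslate, zero_add, (cubicShift_spec hΛ hτ).2, sub_self]

theorem cubicTranslate_sub_eq (x y : ℝ) :
    cubicTranslate Λ V τ₀ y - cubicTranslate Λ V τ₀ x =
      ∫ t in x..y, deriv (cubicTranslate Λ V τ₀) t :=
  (intervalIntegral.integral_eq_sub_of_hasDerivAt
    (fun z _ => (hasDerivAt_cubicTranslate z).differentiableAt.hasDerivAt)
    (continuous_deriv_cubicTranslate.intervalIntegrable _ _)).symm

theorem cubicTranslate_eq_of_le (hΛ : 0 < Λ) {x y : ℝ} (hx : x ≤ -cubicShift Λ V τ₀ - Λ)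
    (hy : y ≤ -cubicShift Λ V τ₀ - Λ) : cubicTranslate Λ V τ₀ x = cubicTranslate Λ V τ₀ y := by
  have h1 : ∀ {z}, z ≤ -cubicShift Λ V τ₀ - Λ → (z + cubicShift Λ V τ₀) / Λ ≤ -1 := fun hz => by
    rw [div_le_iff₀ hΛ]; linarith
  simp [cubicTranslate, cubicConnection, cubicProfile, h1 hx, h1 hy]

/-- Strict inequalities, unlike on the left side: the point 1 falls in the polynomial branch of
`cubicProfile`. -/
theorem cubicTranslate_eq_of_ge (hΛ : 0 < Λ) {x y : ℝ} (hx : -cubicShift Λ V τ₀ + Λ < x)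
    (hy : -cubicShift Λ V τ₀ + Λ < y) : cubicTranslate Λ V τ₀ x = cubicTranslate Λ V τ₀ y := by
  have h1 : ∀ {z}, -cubicShift Λ V τ₀ + Λ < z → 1 < (z + cubicShift Λ V τ₀) / Λ := fun hz => by
    rw [lt_div_iff₀ hΛ]; linarith
  have h2 : ∀ {z}, -cubicShift Λ V τ₀ + Λ < z → -1 < (z + cubicShift Λ V τ₀) / Λ := fun hz => by
    linarith [h1 hz]
  simp [cubicTranslate, cubicConnection, cubicProfile, not_le.2 (h1 hx), not_le.2 (h1 hy),
    not_le.2 (h2 hx), not_le.2 (h2 hy)]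

/-- The limit profile is the cubic transition of height 2V and length 2Λ. Its second derivative
jumps at the two excluded points, which are harmless for integrals. -/
theorem hasDerivAt_deriv_cubicTranslate (hΛ : 0 < Λ) {x : ℝ}
    (h1 : x ≠ -cubicShift Λ V τ₀ - Λ) (h2 : x ≠ -cubicShift Λ V τ₀ + Λ) :
    HasDerivAt (deriv (cubicTranslate Λ V τ₀))
      (cubicSecondDeriv (2 * V) (-cubicShift Λ V τ₀ - Λ) (-cubicShift Λ V τ₀ + Λ) x) x := by
  rcases lt_or_gt_of_ne h1 with h | h
  · rw [cubicSecondDeriv, indicator_of_notMem (fun hh => h.not_gt hh.1)]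
    refine (hasDerivAt_const x (0 : ℝ)).congr_of_eventuallyEq ?_
    filter_upwards [Iic_mem_nhds h] with y hy
    exact deriv_cubicTranslate_of_le hΛ hy
  rcases lt_or_gt_of_ne h2 with h' | h'
  · rw [cubicSecondDeriv, indicator_of_mem (mem_Ioo.2 ⟨h, h'⟩)]
    have hd : HasDerivAt (fun y => V * (3 / 2 * (1 - ((y + cubicShift Λ V τ₀) / Λ) ^ 2) * (1 / Λ)))
        (V * (3 / 2 * (-(2 * ((x + cubicShift Λ V τ₀) / Λ) * (1 / Λ))) * (1 / Λ))) x := by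
      have e1 : HasDerivAt (fun x => (x + cubicShift Λ V τ₀) / Λ) (1 / Λ) x :=
        ((hasDerivAt_id x).add_const _).div_const Λ
      have e2 := (((((e1.pow 2).const_sub 1).const_mul (3 / 2)).mul_const (1 / Λ)).const_mul V)
      convert! e2 using 1
      simp
    convert! hd.congr_of_eventuallyEq ?_ using 1
    · rw [show -cubicShift Λ V τ₀ + Λ - (-cubicShift Λ V τ₀ - Λ) = 2 * Λ by ring]
      field_simp; ring
    · filter_upwards [Ioo_mem_nhds h h'] with y hy
      rw [deriv_cubicTranslate]
      have : -1 ≤ (y + cubicShift Λ V τ₀) / Λ := by rw [le_div_iff₀ hΛ]; linarith [hy.1]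
      have : (y + cubicShift Λ V τ₀) / Λ ≤ 1 := by rw [div_le_iff₀ hΛ]; linarith [hy.2]
      rw [max_eq_left (by nlinarith)]
  · rw [cubicSecondDeriv, indicator_of_notMem (fun hh => h'.not_gt hh.2)]
    refine (hasDerivAt_const x (0 : ℝ)).congr_of_eventuallyEq ?_
    filter_upwards [Ici_mem_nhds h'] with y hy
    exact deriv_cubicTranslate_of_ge hΛ hy

theorem deriv_cubicTranslate_sub_eq (hΛ : 0 < Λ) (x y : ℝ) :
    deriv (cubicTranslate Λ V τ₀) y - deriv (cubicTranslate Λ V τ₀) x =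
      ∫ t in x..y,
        cubicSecondDeriv (2 * V) (-cubicShift Λ V τ₀ - Λ) (-cubicShift Λ V τ₀ + Λ) t := by
  refine (integral_eq_of_hasDerivAt_off_countable _ _
    (s := {-cubicShift Λ V τ₀ - Λ, -cubicShift Λ V τ₀ + Λ}) (Set.to_countable _)
    continuous_deriv_cubicTranslate.continuousOn (fun z hz => ?_)
    (integrable_cubicSecondDeriv _ _ _).intervalIntegrable).symm
  have := hz.2
  simp only [mem_insert_iff, mem_singleton_iff, not_or] at this
  exact hasDerivAt_deriv_cubicTranslate hΛ this.1 this.2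

theorem deriv_deriv_cubicTranslate_ae_eq (hΛ : 0 < Λ) :
    deriv (deriv (cubicTranslate Λ V τ₀)) =ᵐ[volume]
      cubicSecondDeriv (2 * V) (-cubicShift Λ V τ₀ - Λ) (-cubicShift Λ V τ₀ + Λ) := by
  filter_upwards [Measure.ae_ne volume (-cubicShift Λ V τ₀ - Λ),
    Measure.ae_ne volume (-cubicShift Λ V τ₀ + Λ)] with x h1 h2
  exact (hasDerivAt_deriv_cubicTranslate hΛ h1 h2).deriv

theorem abs_cubicSecondDeriv_le {J α β : ℝ} (h : α < β) (x : ℝ) :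
    |cubicSecondDeriv J α β x| ≤ 12 * |J| / (β - α) ^ 2 := by
  have hl : 0 < β - α := sub_pos.2 h
  by_cases hx : x ∈ Ioo α β
  · rw [cubicSecondDeriv, indicator_of_mem hx, abs_mul, abs_div, abs_mul,
      abs_of_pos (by positivity : 0 < (β - α) ^ 3), abs_of_pos (by norm_num : (0 : ℝ) < 12)]
    have : |(α + β) / 2 - x| ≤ β - α := abs_le.2 ⟨by linarith [hx.1, hx.2], by
      linarith [hx.1, hx.2]⟩
    calc 12 * |J| / (β - α) ^ 3 * |(α + β) / 2 - x| ≤ 12 * |J| / (β - α) ^ 3 * (β - α) := by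
          gcongr
      _ = 12 * |J| / (β - α) ^ 2 := by field_simp
  · rw [cubicSecondDeriv, indicator_of_notMem hx, abs_zero]
    positivity

/-- Away from the two limit endpoints the indicators are eventually constant, so convergence is
pointwise; the lengths stay above half their limit, which gives a uniform bound on a fixed compact
interval. -/
theorem tendsto_integral_cubicSecondDeriv_sub_sq {J α β : ℕ → ℝ} {J₀ α₀ β₀ : ℝ} (h₀ : α₀ < β₀)
    (hJ : Tendsto J atTop (𝓝 J₀)) (hα : Tendsto α atTop (𝓝 α₀)) (hβ : Tendsto β atTop (𝓝 β₀)) :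
    Tendsto (fun n => ∫ x, (cubicSecondDeriv (J n) (α n) (β n) x -
      cubicSecondDeriv J₀ α₀ β₀ x) ^ 2) atTop (𝓝 0) := by
  set l := β₀ - α₀ with hl
  have hl0 : 0 < l := sub_pos.2 h₀
  set K := 12 * (|J₀| + 1) / (l / 2) ^ 2 with hK
  have hlt : Tendsto (fun n => β n - α n) atTop (𝓝 l) := hβ.sub hα
  have e0 : ∫ x : ℝ, (0 : ℝ) = 0 := by simp
  rw [← e0]
  refine tendsto_integral_filter_of_dominated_convergence
    ((Icc (α₀ - 1) (β₀ + 1)).indicator fun _ => (2 * K) ^ 2) ?_ ?_ ?_ ?_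
  · refine Eventually.of_forall fun n => ?_
    exact (((integrable_cubicSecondDeriv _ _ _).sub
      (integrable_cubicSecondDeriv _ _ _)).aestronglyMeasurable.pow 2)
  · filter_upwards [hα.eventually_const_lt (show α₀ - 1 < α₀ by linarith),
      hβ.eventually_lt_const (show β₀ < β₀ + 1 by linarith),
      hlt.eventually_const_lt (show l / 2 < l by linarith),
      hJ.abs.eventually_lt_const (show |J₀| < |J₀| + 1 by linarith)] with n h1 h2 h3 h4
    refine ae_of_all _ fun x => ?_
    by_cases hx : x ∈ Icc (α₀ - 1) (β₀ + 1)
    · rw [indicator_of_mem hx, Real.norm_eq_abs, abs_pow]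
      have b1 : |cubicSecondDeriv (J n) (α n) (β n) x| ≤ K := by
        refine (abs_cubicSecondDeriv_le (by linarith) x).trans ?_
        simp only [hK]; gcongr
      have b2 : |cubicSecondDeriv J₀ α₀ β₀ x| ≤ K := by
        refine (abs_cubicSecondDeriv_le h₀ x).trans ?_
        simp only [hK]
        gcongr <;> linarith
      refine pow_le_pow_left₀ (abs_nonneg _) ((abs_sub _ _).trans (by linarith)) 2
    · rw [indicator_of_notMem hx, cubicSecondDeriv, cubicSecondDeriv, indicator_of_notMem,
        indicator_of_notMem]
      · simp
      · exact fun hh => hx ⟨by linarith [hh.1], by linarith [hh.2]⟩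
      · exact fun hh => hx ⟨by linarith [hh.1], by linarith [hh.2]⟩
  · exact (integrable_indicator_iff measurableSet_Icc).2 continuousOn_const.integrableOn_Icc
  · filter_upwards [Measure.ae_ne volume α₀, Measure.ae_ne volume β₀] with x hxα hxβ
    have hz : ∀ {f : ℕ → ℝ}, (∀ᶠ n in atTop, f n = 0) → Tendsto f atTop (𝓝 0) := fun hf =>
      tendsto_const_nhds.congr' (hf.mono fun n hn => hn.symm)
    rcases lt_or_gt_of_ne hxα with h | h
    · refine hz ?_
      filter_upwards [hα.eventually_const_lt h] with n hn
      rw [cubicSecondDeriv, cubicSecondDeriv, indicator_of_notMem (fun hh => hn.not_gt hh.1),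
        indicator_of_notMem (fun hh => h.not_gt hh.1)]
      simp
    rcases lt_or_gt_of_ne hxβ with h' | h'
    · have t1 : Tendsto (fun n => (12 * J n / (β n - α n) ^ 3 * ((α n + β n) / 2 - x) -
          12 * J₀ / (β₀ - α₀) ^ 3 * ((α₀ + β₀) / 2 - x)) ^ 2) atTop (𝓝 0) := by
        have := (((((hJ.const_mul 12).div (hlt.pow 3) (by positivity)).mul
          (((hα.add hβ).div_const 2).sub_const x)).sub_const
          (12 * J₀ / (β₀ - α₀) ^ 3 * ((α₀ + β₀) / 2 - x))).pow 2)
        convert! this using 2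
        simp [hl]
      refine t1.congr' ?_
      filter_upwards [hα.eventually_lt_const h, hβ.eventually_const_lt h'] with n h1 h2
      rw [cubicSecondDeriv, cubicSecondDeriv, indicator_of_mem (mem_Ioo.2 ⟨h1, h2⟩), indicator_of_mem (mem_Ioo.2 ⟨h, h'⟩)]
    · refine hz ?_
      filter_upwards [hβ.eventually_lt_const h'] with n hn
      rw [cubicSecondDeriv, cubicSecondDeriv, indicator_of_notMem (fun hh => hn.not_gt hh.2),
        indicator_of_notMem (fun hh => h'.not_gt hh.2)]
      simp

end

/-! ### Identification of the translation and convergence of w, w' and w''. -/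

section

theorem integral_cubicSecondDeriv {J α β y : ℝ} (h1 : α ≤ y) (h2 : y ≤ β) :
    ∫ t in α..y, cubicSecondDeriv J α β t = 12 * J / (β - α) ^ 3 / 2 * ((y - α) * (β - y)) := by
  have e1 : ∫ t in α..y, cubicSecondDeriv J α β t =
      ∫ t in α..y, 12 * J / (β - α) ^ 3 * ((α + β) / 2 - t) := by
    rw [intervalIntegral.integral_of_le h1, intervalIntegral.integral_of_le h1,
      integral_Ioc_eq_integral_Ioo, integral_Ioc_eq_integral_Ioo]
    refine setIntegral_congr_fun measurableSet_Ioo fun t ht => ?_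
    exact indicator_of_mem (mem_Ioo.2 ⟨ht.1, ht.2.trans_le h2⟩) _
  have e2 : ∀ t : ℝ, HasDerivAt (fun t => (t - α) * (β - t) / 2) ((α + β) / 2 - t) t := fun t => by
    have := (((hasDerivAt_id t).sub_const α).mul ((hasDerivAt_id t).const_sub β)).div_const 2
    convert! this using 1
    simp; ring
  rw [e1, intervalIntegral.integral_const_mul, intervalIntegral.integral_eq_sub_of_hasDerivAt
    (fun t _ => e2 t) (Continuous.intervalIntegrable (by fun_prop) _ _)]
  ring

theorem integral_parabola (α β : ℝ) :
    ∫ t in α..0, (t - α) * (β - t) = (β - α) * α ^ 2 / 2 + α ^ 3 / 3 := by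
  have e2 : ∀ t : ℝ, HasDerivAt (fun t => (β - α) * (t - α) ^ 2 / 2 - (t - α) ^ 3 / 3)
      ((t - α) * (β - t)) t := fun t => by
    have h0 := (hasDerivAt_id t).sub_const α
    have := (((h0.pow 2).const_mul (β - α)).div_const 2).sub ((h0.pow 3).div_const 3)
    convert! this using 1
    simp; ring
  rw [intervalIntegral.integral_eq_sub_of_hasDerivAt
    (fun t _ => e2 t) (Continuous.intervalIntegrable (by fun_prop) _ _)]
  ring

variable {V τ₀ Λ : ℝ} {R δ κ B T θ y₁ y₂ : ℕ → ℝ} {w p r : ℕ → ℝ → ℝ} {α β : ℕ → ℝ}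

namespace AlmostOptimalBump

variable (h : AlmostOptimalBump V τ₀ R δ κ B T θ y₁ y₂ w p r α β)

include h

/-- On the bump p is uniformly close to a parabola, so -w(α), the integral of p from α to 0, is
close to an explicit cubic in the relative position of 0. Its limit V(1 + τ₀) is known, and the
cubic is inverted stably. -/
theorem tendsto_left (hτ₀ : τ₀ ∈ Ioo (-1 : ℝ) 1) (hΛ : Λ = √3 / 2 * √(2 * V)) :
    Tendsto α atTop (𝓝 (-cubicShift Λ V τ₀ - Λ)) := by
  have hV := h.V_pos
  have hΛ0 : 0 < Λ := by rw [hΛ]; positivity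
  obtain ⟨D, hD, hDle⟩ := h.exists_tendsto_excess
  have hl : Tendsto (fun n => β n - α n) atTop (𝓝 (2 * Λ)) := by
    have := h.tendsto_length
    rwa [show √3 * √(2 * V) = 2 * Λ by rw [hΛ]; ring] at this
  set J : ℕ → ℝ := fun n => ∫ x in α n..β n, (p n x - δ n) with hJdef
  have hJ : Tendsto J atTop (𝓝 (2 * V)) := h.J_tendsto
  -- The position of 0 in (α, β), rescaled affinely to [-1, 1]; its expected limit is x₀/Λ.
  set t : ℕ → ℝ := fun n => -2 * α n / (β n - α n) - 1 with ht
  set e : ℕ → ℝ := fun n => (β n - α n) * (δ n + √((β n - α n) * D n)) with he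
  have he0 : Tendsto e atTop (𝓝 0) := by
    have := hl.mul (h.δ_tendsto.add (hl.mul hD).sqrt)
    simpa using this
  have hmain : ∀ᶠ n in atTop,
      |-w n (α n) - J n / 2 * (1 + (3 / 2 * t n - 1 / 2 * t n ^ 3))| ≤ e n := by
    filter_upwards [hDle, h.isBump, h.eventually_mem, h.eventually_zero_mem hτ₀, h.δ_nonneg]
      with n hDn hb hm h0 hδ
    have hpc := (h.rep n).continuous
    have hlpos : 0 < β n - α n := sub_pos.2 hm.2.1
    have hw : -w n (α n) = ∫ y in α n..0, p n y := by
      rw [← (h.rep n).sub_eq' _ ⟨hm.1, by linarith⟩ _ ⟨by linarith, by linarith⟩, h.w_zero n]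
      ring
    set k := 12 * J n / (β n - α n) ^ 3 / 2 with hk
    have hP : J n / 2 * (1 + (3 / 2 * t n - 1 / 2 * t n ^ 3)) =
        ∫ y in α n..0, k * ((y - α n) * (β n - y)) := by
      rw [intervalIntegral.integral_const_mul, integral_parabola, hk]
      simp only [ht]
      field_simp
      ring
    have hcont : Continuous fun y => k * ((y - α n) * (β n - y)) := by fun_prop
    rw [hw, hP, ← intervalIntegral.integral_sub (hpc.intervalIntegrable _ _)
      (hcont.intervalIntegrable _ _)]
    have hbound : ∀ y ∈ uIoc (α n) 0, ‖p n y - k * ((y - α n) * (β n - y))‖ ≤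
        δ n + √((β n - α n) * D n) := fun y hy => by
      rw [uIoc_of_le h0.1.le] at hy
      have hr : ∫ s in α n..y, (r n s - cubicSecondDeriv (J n) (α n) (β n) s) =
          p n y - δ n - k * ((y - α n) * (β n - y)) := by
        rw [intervalIntegral.integral_sub (h.rep n).integrable.intervalIntegrable
          (integrable_cubicSecondDeriv _ _ _).intervalIntegrable, ← (h.rep n).sub_eq, hb.eq_left,
          integral_cubicSecondDeriv hy.1.le (hy.2.trans h0.2.le)]
      have hcs := abs_integral_le_sqrt (x := α n) (y := y) (A := β n - α n)
        ((h.rep n).integrable.sub (integrable_cubicSecondDeriv (J n) (α n)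
          (β n))).intervalIntegrable
        (integrable_sub_cubicSecondDeriv_sq (h.rep n) (J n) (α n) (β n)).intervalIntegrable
        (a := -R n) (b := R n) ⟨hm.1, by linarith⟩ ⟨by linarith [hy.1], by linarith [hy.2]⟩
        (by rw [abs_of_pos (by linarith [hy.1])]; linarith [hy.2]) hDn
      simp only [Pi.sub_apply] at hcs
      rw [hr] at hcs
      rw [Real.norm_eq_abs, show p n y - k * ((y - α n) * (β n - y)) =
        δ n + (p n y - δ n - k * ((y - α n) * (β n - y))) by ring]
      refine (abs_add_le _ _).trans ?_
      rw [abs_of_nonneg hδ]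
      linarith
    have := intervalIntegral.norm_integral_le_of_norm_le_const hbound
    rw [Real.norm_eq_abs] at this
    refine this.trans ?_
    rw [mul_comm]
    refine mul_le_mul_of_nonneg_right ?_ (by positivity)
    rw [abs_of_pos (by linarith)]
    linarith
  have hx₀ := cubicShift_spec (V := V) hΛ0 hτ₀
  set x₀ := cubicShift Λ V τ₀ with hx₀def
  have hcub : 3 / 2 * (x₀ / Λ) - 1 / 2 * (x₀ / Λ) ^ 3 = τ₀ := by
    have := hx₀.2
    rw [cubicConnection_of_mem hΛ0 hx₀.1, mul_comm τ₀] at this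
    exact mul_left_cancel₀ hV.ne' this
  have hprod : Tendsto (fun n => J n / 2 * (1 + (3 / 2 * t n - 1 / 2 * t n ^ 3))) atTop
      (𝓝 (V * (1 + τ₀))) := by
    have h1 : Tendsto (fun n => -w n (α n)) atTop (𝓝 (V * (1 + τ₀))) := by
      convert! h.tendsto_w_left.neg using 2; ring
    refine tendsto_of_tendsto_of_dist h1 (squeeze_zero' (Eventually.of_forall
      fun n => dist_nonneg) ?_ he0)
    filter_upwards [hmain] with n hn
    rwa [Real.dist_eq]
  have hcubt : Tendsto (fun n => 3 / 2 * t n - 1 / 2 * t n ^ 3) atTop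
      (𝓝 (3 / 2 * (x₀ / Λ) - 1 / 2 * (x₀ / Λ) ^ 3)) := by
    rw [hcub]
    have := (hprod.div (hJ.div_const 2) (by positivity)).sub_const 1
    have e1 : V * (1 + τ₀) / (2 * V / 2) - 1 = τ₀ := by field_simp; ring
    rw [e1] at this
    refine this.congr' ?_
    filter_upwards [hJ.eventually_const_lt (by linarith : 0 < 2 * V)] with n hn
    simp only [Pi.div_apply]
    rw [mul_div_cancel_left₀ _ (by positivity)]; ring
  have htt : Tendsto t atTop (𝓝 (x₀ / Λ)) := by
    refine tendsto_of_tendsto_cubic ⟨?_, ?_⟩ ?_ hcubt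
    · rw [lt_div_iff₀ hΛ0]; linarith [hx₀.1.1]
    · rw [div_lt_iff₀ hΛ0]; linarith [hx₀.1.2]
    · filter_upwards [h.eventually_zero_mem hτ₀] with n hn
      have hlpos : 0 < β n - α n := by linarith
      simp only [ht]
      constructor
      · have : 0 ≤ -2 * α n / (β n - α n) := div_nonneg (by linarith) hlpos.le
        linarith
      · have : -2 * α n / (β n - α n) ≤ 2 := by rw [div_le_iff₀ hlpos]; linarith
        linarith
  have hfin : Tendsto (fun n => -((β n - α n) * (1 + t n) / 2)) atTop (𝓝 (-x₀ - Λ)) := by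
    convert! ((hl.mul (htt.const_add 1)).div_const 2).neg using 2
    field_simp; ring
  refine hfin.congr' ?_
  filter_upwards [h.eventually_mem] with n hn
  have hlpos : 0 < β n - α n := sub_pos.2 hn.2.1
  simp only [ht]
  field_simp
  ring

theorem tendsto_right (hτ₀ : τ₀ ∈ Ioo (-1 : ℝ) 1) (hΛ : Λ = √3 / 2 * √(2 * V)) :
    Tendsto β atTop (𝓝 (-cubicShift Λ V τ₀ + Λ)) := by
  have := h.tendsto_length.add (h.tendsto_left hτ₀ hΛ)
  convert! this using 2
  · ring
  · rw [hΛ]; ring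

/-- The cubic second derivative with the actual data J, α, β is used as an intermediate function: it
is close to r by the vanishing excess, and close to the limit by convergence of the data. -/
theorem exists_tendsto_second_deriv (hτ₀ : τ₀ ∈ Ioo (-1 : ℝ) 1) (hΛ : Λ = √3 / 2 * √(2 * V)) :
    ∃ H : ℕ → ℝ, Tendsto H atTop (𝓝 0) ∧ ∀ᶠ n in atTop, ∫ x in -R n..R n,
      (r n x - cubicSecondDeriv (2 * V) (-cubicShift Λ V τ₀ - Λ) (-cubicShift Λ V τ₀ + Λ) x) ^ 2
        ≤ H n := by
  have hV := h.V_pos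
  have hΛ0 : 0 < Λ := by rw [hΛ]; positivity
  obtain ⟨D, hD, hDle⟩ := h.exists_tendsto_excess
  have hG := tendsto_integral_cubicSecondDeriv_sub_sq (by linarith) h.J_tendsto
    (h.tendsto_left hτ₀ hΛ) (h.tendsto_right hτ₀ hΛ)
  set g := cubicSecondDeriv (2 * V) (-cubicShift Λ V τ₀ - Λ) (-cubicShift Λ V τ₀ + Λ) with hg
  set gn : ℕ → ℝ → ℝ := fun n =>
    cubicSecondDeriv (∫ x in α n..β n, (p n x - δ n)) (α n) (β n) with hgn
  refine ⟨fun n => 2 * D n + 2 * ∫ x, (gn n x - g x) ^ 2,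
    by simpa using (hD.const_mul 2).add (hG.const_mul 2), ?_⟩
  filter_upwards [hDle, h.eventually_mem] with n hn hm
  have hle : -R n ≤ R n := by linarith
  have i1 : Integrable fun x => (r n x - gn n x) ^ 2 :=
    integrable_sub_cubicSecondDeriv_sq (h.rep n) _ _ _
  have i2 : Integrable fun x => (r n x - g x) ^ 2 :=
    integrable_sub_cubicSecondDeriv_sq (h.rep n) _ _ _
  have i3 : Integrable fun x => (gn n x - g x) ^ 2 := by
    have m1 : MemLp (fun x => r n x - gn n x) 2 volume :=
      (memLp_two_iff_integrable_sq ((h.rep n).integrable.sub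
        (integrable_cubicSecondDeriv _ _ _)).aestronglyMeasurable).2 i1
    have m2 : MemLp (fun x => r n x - g x) 2 volume :=
      (memLp_two_iff_integrable_sq ((h.rep n).integrable.sub
        (integrable_cubicSecondDeriv _ _ _)).aestronglyMeasurable).2 i2
    refine (m2.sub m1).integrable_sq.congr (ae_of_all _ fun x => ?_)
    simp only [Pi.sub_apply]; ring
  calc ∫ x in -R n..R n, (r n x - g x) ^ 2
      ≤ ∫ x in -R n..R n, (2 * (r n x - gn n x) ^ 2 + 2 * (gn n x - g x) ^ 2) := by
        refine intervalIntegral.integral_mono_on hle i2.intervalIntegrable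
          ((i1.const_mul 2).add (i3.const_mul 2)).intervalIntegrable fun x _ => ?_
        nlinarith [sq_nonneg ((r n x - gn n x) - (gn n x - g x))]
    _ = 2 * (∫ x in -R n..R n, (r n x - gn n x) ^ 2) +
        2 * ∫ x in -R n..R n, (gn n x - g x) ^ 2 := by
        rw [intervalIntegral.integral_add (i1.const_mul 2).intervalIntegrable
          (i3.const_mul 2).intervalIntegrable, intervalIntegral.integral_const_mul,
          intervalIntegral.integral_const_mul]
    _ ≤ 2 * D n + 2 * ∫ x, (gn n x - g x) ^ 2 := by
        have : ∫ x in -R n..R n, (gn n x - g x) ^ 2 ≤ ∫ x, (gn n x - g x) ^ 2 := by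
          rw [intervalIntegral.integral_of_le hle]
          exact setIntegral_le_integral i3 (ae_of_all _ fun x => sq_nonneg _)
        linarith

/-- Integrate the difference of second derivatives from α, where p equals δ → 0 and the limit
derivative is also small since α approaches the left end of its support. Cauchy–Schwarz on a bounded
range turns L² smallness into uniform smallness. -/
theorem exists_tendsto_deriv (hτ₀ : τ₀ ∈ Ioo (-1 : ℝ) 1) (hΛ : Λ = √3 / 2 * √(2 * V)) (A : ℝ) :
    ∃ e : ℕ → ℝ, Tendsto e atTop (𝓝 0) ∧ ∀ᶠ n in atTop, A ≤ R n ∧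
      ∀ y ∈ Icc (-A) A, |p n y - deriv (cubicTranslate Λ V τ₀) y| ≤ e n := by
  have hV := h.V_pos
  have hΛ0 : 0 < Λ := by rw [hΛ]; positivity
  obtain ⟨H, hH, hHle⟩ := h.exists_tendsto_second_deriv hτ₀ hΛ
  have hα := h.tendsto_left hτ₀ hΛ
  set α₀ := -cubicShift Λ V τ₀ - Λ with hα₀
  set P := deriv (cubicTranslate Λ V τ₀) with hP
  have hPα : P α₀ = 0 := deriv_cubicTranslate_of_le hΛ0 le_rfl
  have hPc : Tendsto (fun n => P (α n)) atTop (𝓝 0) := by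
    rw [← hPα]; exact (continuous_deriv_cubicTranslate.tendsto _).comp hα
  set M := |A| + |α₀| + 1 with hM
  refine ⟨fun n => δ n + |P (α n)| + √(M * H n), by
    simpa using (h.δ_tendsto.add hPc.abs).add (hH.const_mul M).sqrt, ?_⟩
  filter_upwards [hHle, h.isBump, h.eventually_mem, h.δ_nonneg, h.R_tendsto.eventually_ge_atTop A,
    hα.abs.eventually_lt_const (show |α₀| < |α₀| + 1 by linarith)] with n hn hb hm hδ hR hαn
  refine ⟨hR, fun y hy => ?_⟩
  have hint : ∫ s in α n..y, (r n s - cubicSecondDeriv (2 * V) α₀ (-cubicShift Λ V τ₀ + Λ) s) =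
      (p n y - P y) - (δ n - P (α n)) := by
    rw [intervalIntegral.integral_sub (h.rep n).integrable.intervalIntegrable
      (integrable_cubicSecondDeriv _ _ _).intervalIntegrable, ← (h.rep n).sub_eq, hb.eq_left,
      ← deriv_cubicTranslate_sub_eq hΛ0]
    ring
  have hya : |y| ≤ |A| := (abs_le.2 hy).trans (le_abs_self A)
  have hcs := abs_integral_le_sqrt (x := α n) (y := y) (A := M)
    ((h.rep n).integrable.sub (integrable_cubicSecondDeriv (2 * V) α₀
      (-cubicShift Λ V τ₀ + Λ))).intervalIntegrable
    (integrable_sub_cubicSecondDeriv_sq (h.rep n) _ _ _).intervalIntegrable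
    (a := -R n) (b := R n) ⟨hm.1, by linarith⟩ ⟨by linarith [hy.1], by linarith [hy.2]⟩
    ((abs_sub _ _).trans (by simp only [hM]; linarith)) hn
  simp only [Pi.sub_apply] at hcs
  rw [hint] at hcs
  have e1 : p n y - P y = ((p n y - P y) - (δ n - P (α n))) + (δ n - P (α n)) := by ring
  have e2 : |δ n - P (α n)| ≤ δ n + |P (α n)| := by
    refine (abs_sub _ _).trans ?_
    rw [abs_of_nonneg hδ]
  rw [e1]
  refine (abs_add_le _ _).trans ?_
  linarith

theorem exists_tendsto_uniform (hτ₀ : τ₀ ∈ Ioo (-1 : ℝ) 1) (hΛ : Λ = √3 / 2 * √(2 * V)) :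
    ∃ e : ℕ → ℝ, Tendsto e atTop (𝓝 0) ∧ ∀ᶠ n in atTop,
      ∀ y ∈ Icc (-R n) (R n), |w n y - cubicTranslate Λ V τ₀ y| ≤ e n := by
  have hV := h.V_pos
  have hΛ0 : 0 < Λ := by rw [hΛ]; positivity
  have hx₀ := (cubicShift_spec (V := V) hΛ0 hτ₀).1
  -- Since |x₀| < Λ, the limit transition lies inside (-2Λ, 2Λ). Inside [-A, A] the estimate is
  -- integrated from the common zero at 0; outside, the limit is constant and w hardly oscillates.
  set A := 2 * Λ + 1 with hA
  obtain ⟨e, he, hle⟩ := h.exists_tendsto_deriv hτ₀ hΛ A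
  obtain ⟨σ, hσ, hσle⟩ := h.exists_tendsto_oscillation
  set u := cubicTranslate Λ V τ₀ with hu
  refine ⟨fun n => A * e n + σ n, by simpa using (he.const_mul A).add hσ, ?_⟩
  filter_upwards [hle, hσle, h.eventually_mem,
    (h.tendsto_left hτ₀ hΛ).eventually_const_lt (show -A < _ by linarith [hx₀.2]),
    (h.tendsto_right hτ₀ hΛ).eventually_lt_const (show _ < A by linarith [hx₀.1])]
    with n hn hs hm hαn hβn
  have hpc := (h.rep n).continuous
  have hσ0 : 0 ≤ σ n := by
    have := hs.1 (α n) ⟨hm.1, le_rfl⟩ (α n) ⟨hm.1, le_rfl⟩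
    exact (abs_nonneg _).trans this
  have hin : ∀ y ∈ Icc (-A) A, |w n y - u y| ≤ A * e n := fun y hy => by
    have e1 : w n y - u y = ∫ t in (0 : ℝ)..y, (p n t - deriv u t) := by
      rw [intervalIntegral.integral_sub (hpc.intervalIntegrable _ _)
        (continuous_deriv_cubicTranslate.intervalIntegrable _ _),
        ← (h.rep n).sub_eq' 0 ⟨by linarith, by linarith⟩ y ⟨by linarith [hy.1], by linarith [hy.2]⟩,
        ← cubicTranslate_sub_eq, h.w_zero n, cubicTranslate_zero hΛ0 hτ₀]
      ring
    have e2 := intervalIntegral.norm_integral_le_of_norm_le_const (a := (0 : ℝ)) (b := y)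
      (f := fun t => p n t - deriv u t) (C := e n) fun t ht => hn.2 t <| by
        rcases le_total 0 y with h0 | h0
        · rw [uIoc_of_le h0] at ht
          exact ⟨by linarith [ht.1], ht.2.trans hy.2⟩
        · rw [uIoc_of_ge h0] at ht
          exact ⟨hy.1.trans ht.1.le, by linarith [ht.2]⟩
    rw [← e1, Real.norm_eq_abs, sub_zero] at e2
    have he0 : 0 ≤ e n := (abs_nonneg _).trans (hn.2 0 ⟨by linarith, by linarith⟩)
    refine e2.trans ?_
    rw [mul_comm]
    exact mul_le_mul_of_nonneg_right (abs_le.2 hy) he0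
  intro y hy
  rcases lt_or_ge y (-A) with h1 | h1
  · have e1 := hs.1 (-A) ⟨by linarith, hαn.le⟩ y ⟨hy.1, by linarith⟩
    have e2 : u y = u (-A) := cubicTranslate_eq_of_le hΛ0 (by linarith [hx₀.2])
      (by linarith [hx₀.2])
    rw [e2, show w n y - u (-A) = (w n (-A) - u (-A)) + (w n y - w n (-A)) by ring]
    exact (abs_add_le _ _).trans (add_le_add (hin _ ⟨le_rfl, by linarith⟩) e1)
  rcases le_or_gt y A with h2 | h2
  · exact (hin y ⟨h1, h2⟩).trans (by linarith)
  · have e1 := hs.2 A ⟨hβn.le, by linarith⟩ y ⟨by linarith, hy.2⟩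
    have e2 : u y = u A := cubicTranslate_eq_of_ge hΛ0 (by linarith [hx₀.1])
      (by linarith [hx₀.1])
    rw [e2, show w n y - u A = (w n A - u A) + (w n y - w n A) by ring]
    exact (abs_add_le _ _).trans (add_le_add (hin _ ⟨by linarith, le_rfl⟩) e1)

end AlmostOptimalBump

end

/-! ### The rescaled energy. -/

section

theorem eLpNorm_two_le_ofReal_sqrt {μ : Measure ℝ} {f : ℝ → ℝ} {H : ℝ} (hf : MemLp f 2 μ)
    (hH : ∫ x, f x ^ 2 ∂μ ≤ H) : eLpNorm f 2 μ ≤ ENNReal.ofReal √H := by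
  rw [hf.eLpNorm_eq_integral_rpow_norm (by norm_num) (by norm_num)]
  refine ENNReal.ofReal_le_ofReal ?_
  rw [Real.sqrt_eq_rpow]
  simp only [ENNReal.toReal_ofNat, Real.rpow_ofNat, Real.norm_eq_abs, sq_abs]
  rw [show (2 : ℝ)⁻¹ = 1 / 2 by norm_num]
  exact Real.rpow_le_rpow (integral_nonneg fun x => sq_nonneg _) hH (by norm_num)

theorem continuous_log_one_add_sq {f : ℝ → ℝ} (hf : Continuous f) :
    Continuous fun x => Real.log (1 + f x ^ 2) :=
  Continuous.log (by fun_prop) fun x => by positivity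

/-- The rescaled energy of a function on `[-R, R]`. -/
def rescaledEnergy (ε s R : ℝ) (p r : ℝ → ℝ) : ℝ :=
  ∫ x in -R..R, (r x ^ 2 + 1 / s ^ 2 * Real.log (1 + (p x / ε ^ 2) ^ 2))

section

variable {ε s R : ℝ} {w p r : ℝ → ℝ}

theorem rescaledEnergy_eq (h : IsH2Rep (-R) R w p r) : rescaledEnergy ε s R p r =
    (∫ x in -R..R, r x ^ 2) + 1 / s ^ 2 * ∫ x in -R..R, Real.log (1 + (p x / ε ^ 2) ^ 2) := by
  have hc := continuous_log_one_add_sq (h.continuous.div_const (ε ^ 2))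
  rw [rescaledEnergy, intervalIntegral.integral_add h.integrable_sq.intervalIntegrable
    ((hc.const_mul _).intervalIntegrable _ _), intervalIntegral.integral_const_mul]

/-- Keep the logarithm only on the superlevel set, where it is at least 4s² - 4s, and divide by s².
-/
theorem integral_sq_add_measure_le_rescaledEnergy (h : IsH2Rep (-R) R w p r) (hs : 0 < s)
    (hR : 0 ≤ R) (hε : ε = Real.exp (-s ^ 2)) :
    (∫ x in -R..R, r x ^ 2) +
      (4 - 4 / s) * volume.real {x ∈ Ioo (-R) R | Real.exp (-2 * s) < p x} ≤
      rescaledEnergy ε s R p r := by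
  have hc := continuous_log_one_add_sq (h.continuous.div_const (ε ^ 2))
  set U := {x ∈ Ioo (-R) R | Real.exp (-2 * s) < p x} with hU
  have hUm : MeasurableSet U :=
    (isOpen_Ioo.inter (isOpen_lt continuous_const h.continuous)).measurableSet
  have hfin : volume U ≠ ⊤ := measure_ne_top_of_subset (fun x hx => hx.1) (by simp)
  have hl : IntegrableOn (fun x => Real.log (1 + (p x / ε ^ 2) ^ 2)) (Ioo (-R) R) :=
    (hc.continuousOn.integrableOn_Icc).mono_set Ioo_subset_Icc_self
  have h1 : (4 * s ^ 2 - 4 * s) * volume.real U ≤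
      ∫ x in -R..R, Real.log (1 + (p x / ε ^ 2) ^ 2) := by
    rw [intervalIntegral.integral_of_le (by linarith), integral_Ioc_eq_integral_Ioo]
    calc (4 * s ^ 2 - 4 * s) * volume.real U = ∫ x in U, (4 * s ^ 2 - 4 * s) := by
          rw [setIntegral_const, smul_eq_mul, mul_comm]
      _ ≤ ∫ x in U, Real.log (1 + (p x / ε ^ 2) ^ 2) := by
          refine setIntegral_mono_on (integrableOn_const hfin) (hl.mono_set fun x hx => hx.1) hUm
            fun x hx => ?_
          rw [hε]
          exact le_log_one_add_of_exp_lt hx.2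
      _ ≤ ∫ x in Ioo (-R) R, Real.log (1 + (p x / ε ^ 2) ^ 2) :=
          setIntegral_mono_set hl
            (ae_of_all _ fun x => Real.log_nonneg (by nlinarith [sq_nonneg (p x / ε ^ 2)]))
            (ae_of_all _ fun x hx => hx.1)
  rw [rescaledEnergy_eq h]
  have h2 : (4 - 4 / s) * volume.real U = 1 / s ^ 2 * ((4 * s ^ 2 - 4 * s) * volume.real U) := by
    field_simp
  rw [h2]
  have := mul_le_mul_of_nonneg_left h1 (by positivity : 0 ≤ 1 / s ^ 2)
  linarith

theorem integral_log_le_rescaledEnergy (h : IsH2Rep (-R) R w p r) (hs : 0 < s) (hR : 0 ≤ R) :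
    ∫ x in -R..R, Real.log (1 + (p x / ε ^ 2) ^ 2) ≤ s ^ 2 * rescaledEnergy ε s R p r := by
  rw [rescaledEnergy_eq h, mul_add]
  have h1 : 0 ≤ ∫ x in -R..R, r x ^ 2 :=
    intervalIntegral.integral_nonneg (by linarith) fun x _ => sq_nonneg _
  have h2 : s ^ 2 * (1 / s ^ 2 * ∫ x in -R..R, Real.log (1 + (p x / ε ^ 2) ^ 2)) =
      ∫ x in -R..R, Real.log (1 + (p x / ε ^ 2) ^ 2) := by field_simp
  rw [h2]
  have : 0 ≤ s ^ 2 * ∫ x in -R..R, r x ^ 2 := by positivity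
  linarith

/-- The pointwise bound is used with e = ε² and η = ε: the constant term then integrates to 2Lε when
R = L/ε², and the logarithm carries the factor ε/2 + 2δ, small enough to beat s². -/
theorem integral_min_max_le (h : IsH2Rep (-R) R w p r) (hs : 0 < s) (hε : 0 < ε) {δ y₁ y₂ : ℝ}
    (hδ : 0 < δ) (h1 : -R ≤ y₁) (h12 : y₁ ≤ y₂) (h2 : y₂ ≤ R) :
    ∫ x in y₁..y₂, min (max (p x) 0) δ ≤ 2 * (ε ^ 2 * R) * ε +
      (ε / 2 + 2 * δ) * (s ^ 2 * rescaledEnergy ε s R p r) := by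
  have hpc := h.continuous
  have hc := continuous_log_one_add_sq (hpc.div_const (ε ^ 2))
  have hm : Continuous fun x => min (max (p x) 0) δ := by fun_prop
  calc ∫ x in y₁..y₂, min (max (p x) 0) δ ≤ ∫ x in -R..R, min (max (p x) 0) δ :=
        intervalIntegral.integral_mono_interval h1 h12 h2
          (ae_of_all _ fun x => le_min (le_max_right _ _) hδ.le) (hm.intervalIntegrable _ _)
    _ ≤ ∫ x in -R..R, (ε * ε ^ 2 +
          (ε ^ 2 / (2 * ε) + 2 * δ) * Real.log (1 + (p x / ε ^ 2) ^ 2)) :=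
        intervalIntegral.integral_mono_on (by linarith) (hm.intervalIntegrable _ _)
          ((continuous_const.add (hc.const_mul _)).intervalIntegrable _ _)
          fun x _ => min_max_le_log (by positivity) hε hδ
    _ = 2 * (ε ^ 2 * R) * ε +
          (ε / 2 + 2 * δ) * ∫ x in -R..R, Real.log (1 + (p x / ε ^ 2) ^ 2) := by
        rw [intervalIntegral.integral_add (by simp) ((hc.const_mul _).intervalIntegrable _ _),
          intervalIntegral.integral_const, smul_eq_mul, intervalIntegral.integral_const_mul,
          show ε ^ 2 / (2 * ε) = ε / 2 by field_simp]
        ring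
    _ ≤ _ := by
        have := mul_le_mul_of_nonneg_left (integral_log_le_rescaledEnergy (ε := ε) h hs
          (by linarith)) (by positivity : 0 ≤ ε / 2 + 2 * δ)
        linarith

end

/-- Under x = ε²y the Jacobian ε² turns ε⁶ into ε⁸, the square of the scaling of the second
derivative, and cancels the ε² in ω(ε)² = ε²s². -/
theorem IsH2Rep.RPM_eq_rescaledEnergy {L ε s : ℝ} {v p r : ℝ → ℝ} (h : IsH2Rep (-L) L v p r)
    (hL : 0 < L) (hs : 0 < s) (hε : ε = Real.exp (-s ^ 2)) :
    RPM ε (Ioo (-L) L) v = rescaledEnergy ε s (L / ε ^ 2) (fun y => ε ^ 2 * p (ε ^ 2 * y))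
      (fun y => (ε ^ 2) ^ 2 * r (ε ^ 2 * y)) := by
  have hab : -L < L := by linarith
  have hε0 : 0 < ε := hε ▸ Real.exp_pos _
  have h1 := (h.hasWeakDeriv_left hab).weakDeriv_ae_eq isOpen_Ioo
  have h2 := (h.hasWeakDeriv_left hab).weakDeriv_weakDeriv_ae_eq isOpen_Ioo
    (h.hasWeakDeriv_right hab)
  have hω : omega ε ^ 2 = ε ^ 2 * s ^ 2 := by
    rw [omega, mul_pow, Real.sq_sqrt (abs_nonneg _), hε, Real.log_exp, abs_neg,
      abs_of_nonneg (sq_nonneg s)]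
  have e1 : RPM ε (Ioo (-L) L) v = ∫ x in -L..L, (ε ^ 6 * r x ^ 2 +
      1 / (ε ^ 2 * s ^ 2) * Real.log (1 + p x ^ 2)) := by
    rw [RPM, intervalIntegral.integral_of_le hab.le, integral_Ioc_eq_integral_Ioo, hω]
    refine integral_congr_ae ?_
    filter_upwards [h1, h2] with x hx1 hx2
    rw [hx1, hx2]
  set F : ℝ → ℝ := fun x => ε ^ 8 * r x ^ 2 + 1 / s ^ 2 * Real.log (1 + p x ^ 2) with hF
  have e2 : rescaledEnergy ε s (L / ε ^ 2) (fun y => ε ^ 2 * p (ε ^ 2 * y))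
      (fun y => (ε ^ 2) ^ 2 * r (ε ^ 2 * y)) = ∫ y in -(L / ε ^ 2)..L / ε ^ 2, F (ε ^ 2 * y) := by
    rw [rescaledEnergy]
    congr 1; ext y
    simp only [hF]
    rw [mul_div_cancel_left₀ _ (by positivity)]; ring
  rw [e1, e2, intervalIntegral.integral_comp_mul_left _ (by positivity), smul_eq_mul,
    ← intervalIntegral.integral_const_mul]
  have e3 : ε ^ 2 * -(L / ε ^ 2) = -L := by field_simp
  have e4 : ε ^ 2 * (L / ε ^ 2) = L := by field_simp
  rw [e3, e4]
  congr 1; ext x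
  simp only [hF]
  field_simp

theorem exists_mem_Ioo_le_average {a b : ℝ} (hab : a < b) {F : ℝ → ℝ}
    (hF : IntegrableOn F (Ioo a b)) :
    ∃ x ∈ Ioo a b, F x ≤ (b - a)⁻¹ * ∫ t in Ioo a b, F t := by
  obtain ⟨x, hx, hle⟩ := exists_le_setAverage (μ := volume) (s := Ioo a b)
    (by simp [Real.volume_Ioo, hab]) (by simp) hF
  refine ⟨x, hx, ?_⟩
  rwa [setAverage_eq, Real.volume_real_Ioo_of_le hab.le, smul_eq_mul] at hle

end

/-! ### From the hypotheses to an almost optimal sequence. -/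

section

theorem tendsto_sq_mul_exp_neg_mul {c : ℝ} (hc : 0 < c) :
    Tendsto (fun s : ℝ => s ^ 2 * Real.exp (-c * s)) atTop (𝓝 0) := by
  have h := (Real.tendsto_pow_mul_exp_neg_atTop_nhds_zero 2).comp
    (tendsto_id.const_mul_atTop hc)
  have h2 := h.const_mul (1 / c ^ 2)
  rw [mul_zero] at h2
  refine h2.congr fun s => ?_
  simp only [Function.comp, id]
  rw [neg_mul]
  field_simp

/-- Functions of almost minimal energy which converge strictly to a jump give rise, after
rescaling, to an almost optimal transition. -/
theorem exists_almostOptimal {L : ℝ} (hL : 0 < L) {ε : ℕ → ℝ} (hε : ∀ n, 0 < ε n)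
    (hε0 : Tendsto ε atTop (𝓝 0)) {v : ℕ → ℝ → ℝ} (hv : ∀ n, MemH2 (Ioo (-L) L) (v n))
    (hvc : ∀ n, ContinuousOn (v n) (Icc (-L) L)) (hv0 : ∀ n, v n 0 = 0) {V : ℝ} (hV : 0 < V)
    {τ₀ : ℝ} (hstrict : StrictTendstoBV (Ioo (-L) L) v fun y => V * (Real.sign y - τ₀)) {ℓ : ℝ}
    (hlim : Tendsto (fun n => RPM (ε n) (Ioo (-L) L) (v n)) atTop (𝓝 ℓ))
    (hℓ : ℓ ≤ alpha0 * √(2 * V)) :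
    ∃ (δ κ B T θ y₁ y₂ : ℕ → ℝ) (p r : ℕ → ℝ → ℝ),
      AlmostOptimal V τ₀ (fun n => L / ε n ^ 2) δ κ B T θ y₁ y₂
        (fun n y => v n (ε n ^ 2 * y)) p r := by
  obtain ⟨hBV, hBV₀, hL1, hTV⟩ := hstrict
  have hab : -L < L := by linarith
  choose pv rv hrep using fun n => (hv n).exists_isH2Rep hab (hvc n)
  set u : ℝ → ℝ := fun y => V * (Real.sign y - τ₀) with hu
  set R : ℕ → ℝ := fun n => L / ε n ^ 2 with hR
  have hR0 : ∀ n, 0 < R n := fun n => div_pos hL (pow_pos (hε n) 2)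
  have hεR : ∀ n, ε n ^ 2 * R n = L := fun n => mul_div_cancel₀ _ (pow_pos (hε n) 2).ne'
  set p : ℕ → ℝ → ℝ := fun n y => ε n ^ 2 * pv n (ε n ^ 2 * y) with hp
  set r : ℕ → ℝ → ℝ := fun n y => (ε n ^ 2) ^ 2 * rv n (ε n ^ 2 * y) with hr
  have hrepw : ∀ n, IsH2Rep (-R n) (R n) (fun y => v n (ε n ^ 2 * y)) (p n) (r n) := fun n => by
    have := (hrep n).comp_mul_left (pow_pos (hε n) 2)
    rwa [neg_div] at this
  have hε2 : Tendsto (fun n => ε n ^ 2) atTop (𝓝[>] 0) := by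
    refine tendsto_nhdsWithin_iff.2 ⟨by simpa using hε0.pow 2, ?_⟩
    exact Eventually.of_forall fun n => pow_pos (hε n) 2
  set s : ℕ → ℝ := fun n => √(-Real.log (ε n)) with hs
  have hst : Tendsto s atTop atTop := by
    have h1 : Tendsto ε atTop (𝓝[>] 0) :=
      tendsto_nhdsWithin_iff.2 ⟨hε0, Eventually.of_forall hε⟩
    exact Real.tendsto_sqrt_atTop.comp
      (tendsto_neg_atBot_atTop.comp (Real.tendsto_log_nhdsGT_zero.comp h1))
  have hεs : ∀ᶠ n in atTop, 1 < s n ∧ ε n = Real.exp (-s n ^ 2) := by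
    filter_upwards [hst.eventually_gt_atTop 1, hε0.eventually_lt_const one_pos] with n h1 h2
    refine ⟨h1, ?_⟩
    simp only [hs]
    rw [Real.sq_sqrt (by linarith [Real.log_neg (hε n) h2]), neg_neg, Real.exp_log (hε n)]
  set E : ℕ → ℝ := fun n => RPM (ε n) (Ioo (-L) L) (v n) with hE
  have hEw : ∀ᶠ n in atTop, E n = rescaledEnergy (ε n) (s n) (R n) (p n) (r n) := by
    filter_upwards [hεs] with n hn
    exact (hrep n).RPM_eq_rescaledEnergy hL (by linarith [hn.1]) hn.2
  -- Only ℓ ≤ α₀√(2V) is known; the maximum gives an upper bound whose limit is exactly the critical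
  -- value. The same device is used for T.
  set B : ℕ → ℝ := fun n => max (E n) (alpha0 * √(2 * V)) with hB
  have hBt : Tendsto B atTop (𝓝 (alpha0 * √(2 * V))) := by
    have := hlim.max (tendsto_const_nhds (x := alpha0 * √(2 * V)))
    rwa [max_eq_right hℓ] at this
  have hEB : ∀ n, E n ≤ B n := fun n => le_max_left _ _
  set T : ℕ → ℝ := fun n => max (totalVariation (Ioo (-L) L) (v n)).toReal (2 * V) with hT
  have hTt : Tendsto T atTop (𝓝 (2 * V)) := by
    have h1 := ((ENNReal.tendsto_toReal hBV₀.2.ne).comp hTV).max (tendsto_const_nhds (x := 2 * V))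
    rwa [max_eq_right (ENNReal.toReal_le_of_le_ofReal (by linarith)
      (totalVariation_sign_le hL hV))] at h1
  have hs2 : Tendsto (fun n => s n ^ 2 * ε n) atTop (𝓝 0) := by
    refine squeeze_zero' ?_ ?_ ((tendsto_sq_mul_exp_neg_mul one_pos).comp hst)
    · exact Eventually.of_forall fun n => mul_nonneg (sq_nonneg _) (hε n).le
    · filter_upwards [hεs] with n hn
      simp only [Function.comp]
      refine mul_le_mul_of_nonneg_left ?_ (sq_nonneg _)
      rw [hn.2]
      exact Real.exp_le_exp.2 (by nlinarith [hn.1])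
  set δ : ℕ → ℝ := fun n => Real.exp (-2 * s n) with hδ
  have hs2δ : Tendsto (fun n => s n ^ 2 * δ n) atTop (𝓝 0) :=
    (tendsto_sq_mul_exp_neg_mul two_pos).comp hst
  have hδt : Tendsto δ atTop (𝓝 0) :=
    Real.tendsto_exp_atBot.comp (hst.const_mul_atTop_of_neg (by norm_num : (-2 : ℝ) < 0))
  -- The sum of both integrals allows one averaging argument to find points at which v is close to
  -- its limit and v' is small simultaneously.
  set Φ : ℕ → ℝ := fun n => (∫ x in Ioo (-L) L, |v n x - u x|) +
    ∫ x in Ioo (-L) L, Real.log (1 + pv n x ^ 2) with hΦ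
  have hlogc : ∀ n, Continuous fun x => Real.log (1 + pv n x ^ 2) := fun n =>
    continuous_log_one_add_sq (hrep n).continuous
  have hlog0 : ∀ n x, 0 ≤ Real.log (1 + pv n x ^ 2) := fun n x =>
    Real.log_nonneg (by nlinarith [sq_nonneg (pv n x)])
  have hΦt : Tendsto Φ atTop (𝓝 0) := by
    have h1 : Tendsto (fun n => ∫ x in Ioo (-L) L, Real.log (1 + pv n x ^ 2)) atTop (𝓝 0) := by
      have hup : Tendsto (fun n => ε n * (s n ^ 2 * ε n) * B n) atTop (𝓝 0) := by
        simpa using (hε0.mul hs2).mul hBt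
      refine squeeze_zero' (Eventually.of_forall fun n => integral_nonneg fun x => hlog0 n x)
        ?_ hup
      filter_upwards [hεs, hEw] with n hn hEn
      have e1 := integral_log_le_rescaledEnergy (ε := ε n) (hrepw n)
        (by linarith [hn.1] : 0 < s n) (hR0 n).le
      have e2 : ∫ y in -R n..R n, Real.log (1 + (p n y / ε n ^ 2) ^ 2) =
          (ε n ^ 2)⁻¹ * ∫ x in Ioo (-L) L, Real.log (1 + pv n x ^ 2) := by
        rw [← integral_Ioc_eq_integral_Ioo, ← intervalIntegral.integral_of_le hab.le, ← hεR n,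
          ← mul_neg, ← smul_eq_mul, ← intervalIntegral.integral_comp_mul_left
            (fun x => Real.log (1 + pv n x ^ 2)) (pow_pos (hε n) 2).ne']
        congr 1; ext y
        simp only [hp]
        rw [mul_div_cancel_left₀ _ (pow_pos (hε n) 2).ne']
      rw [e2, ← hEn, inv_mul_le_iff₀ (pow_pos (hε n) 2)] at e1
      refine e1.trans ?_
      have : ε n * (s n ^ 2 * ε n) * B n = ε n ^ 2 * (s n ^ 2 * B n) := by ring
      rw [this]
      have := hEB n
      gcongr
    simpa using hL1.add h1
  have hFint : ∀ n, IntegrableOn (fun x => |v n x - u x| + Real.log (1 + pv n x ^ 2))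
      (Ioo (-L) L) := fun n =>
    ((hBV n).1.sub hBV₀.1).abs.add
      (((hlogc n).continuousOn.integrableOn_Icc).mono_set Ioo_subset_Icc_self)
  have hF0 : ∀ n x, 0 ≤ |v n x - u x| + Real.log (1 + pv n x ^ 2) := fun n x =>
    add_nonneg (abs_nonneg _) (hlog0 n x)
  have hFΦ : ∀ n, ∫ x in Ioo (-L) L, (|v n x - u x| + Real.log (1 + pv n x ^ 2)) = Φ n :=
    fun n => integral_add ((hBV n).1.sub hBV₀.1).abs
      (((hlogc n).continuousOn.integrableOn_Icc).mono_set Ioo_subset_Icc_self)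
  have hgood : ∀ c d, -L ≤ c → c < d → d ≤ L → d - c = L → ∀ n, ∃ x ∈ Ioo c d,
      |v n x - u x| + Real.log (1 + pv n x ^ 2) ≤ L⁻¹ * Φ n := by
    intro c d hc hcd hd hl n
    have hsub : Ioo c d ⊆ Ioo (-L) L := Ioo_subset_Ioo hc hd
    obtain ⟨x, hx, hle⟩ := exists_mem_Ioo_le_average hcd ((hFint n).mono_set hsub)
    refine ⟨x, hx, hle.trans ?_⟩
    rw [hl, ← hFΦ n]
    exact mul_le_mul_of_nonneg_left (setIntegral_mono_set (hFint n)
      (ae_of_all _ (hF0 n)) (ae_of_all _ hsub)) (by positivity)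
  choose x₁ hx₁ hx₁le using hgood (-L) 0 le_rfl (by linarith) hL.le (by ring)
  choose x₂ hx₂ hx₂le using hgood 0 L (by linarith) hL le_rfl (by ring)
  have hΦL : Tendsto (fun n => L⁻¹ * Φ n) atTop (𝓝 0) := by simpa using hΦt.const_mul L⁻¹
  have hcancel : ∀ n x, ε n ^ 2 * (x / ε n ^ 2) = x := fun n x =>
    mul_div_cancel₀ _ (pow_pos (hε n) 2).ne'
  have hpδ : ∀ x : ℕ → ℝ, (∀ n, |v n (x n) - u (x n)| + Real.log (1 + pv n (x n) ^ 2) ≤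
      L⁻¹ * Φ n) → ∀ᶠ n in atTop, p n (x n / ε n ^ 2) ≤ δ n := fun x hx => by
    -- Once the average is below log 2, the derivative of v is at most 1 at the chosen point, so p
    -- is at most ε² = exp(-2s²) ≤ exp(-2s), as s > 1.
    filter_upwards [hεs, hΦL.eventually_lt_const (Real.log_pos one_lt_two)] with n hn hΦn
    have h1 : Real.log (1 + pv n (x n) ^ 2) < Real.log 2 := by
      have := abs_nonneg (v n (x n) - u (x n))
      linarith [hx n]
    have h2 := (Real.log_lt_log_iff (by positivity) two_pos).1 h1
    have h3 : pv n (x n) ≤ 1 := by nlinarith [sq_nonneg (pv n (x n) - 1)]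
    have h4 : ε n ^ 2 ≤ δ n := by
      simp only [hδ]
      rw [hn.2, ← Real.exp_nat_mul]
      refine Real.exp_le_exp.2 ?_
      push_cast
      nlinarith [hn.1]
    simp only [hp]
    rw [hcancel]
    have := mul_le_mul_of_nonneg_left h3 (pow_pos (hε n) 2).le
    linarith
  have hwt : ∀ (x : ℕ → ℝ) (c : ℝ), (∀ n, |v n (x n) - u (x n)| +
      Real.log (1 + pv n (x n) ^ 2) ≤ L⁻¹ * Φ n) → (∀ n, u (x n) = c) →
      Tendsto (fun n => v n (ε n ^ 2 * (x n / ε n ^ 2))) atTop (𝓝 c) := fun x c hx hc => by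
    rw [tendsto_iff_dist_tendsto_zero]
    refine squeeze_zero (fun n => dist_nonneg) (fun n => ?_) hΦL
    rw [hcancel, Real.dist_eq, ← hc n]
    linarith [hx n, hlog0 n (x n)]
  refine ⟨δ, fun n => 4 - 4 / s n, B, T,
    fun n => 2 * L * ε n + (ε n / 2 + 2 * δ n) * (s n ^ 2 * B n), fun n => x₁ n / ε n ^ 2,
    fun n => x₂ n / ε n ^ 2, p, r, hV, hrepw, ?_, fun n => ?_, ?_, hδt, ?_, ?_, hBt, ?_, hTt, ?_,
    ?_, ?_, hpδ x₁ hx₁le, hpδ x₂ hx₂le, hwt x₁ _ hx₁le fun n => ?_, hwt x₂ _ hx₂le fun n => ?_,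
    ?_, ?_⟩
  · exact (hε2.inv_tendsto_nhdsGT_zero.const_mul_atTop hL).congr fun n => by
      simp [hR, div_eq_mul_inv]
  · simp [hv0 n]
  · exact Eventually.of_forall fun n => (Real.exp_pos _).le
  · filter_upwards [hεs] with n hn
    have : 0 ≤ 4 / s n := div_nonneg (by norm_num) (by linarith [hn.1])
    linarith
  · simpa using (hst.const_div_atTop 4).const_sub 4
  · filter_upwards [hεs, hEw] with n hn hEn
    have := integral_sq_add_measure_le_rescaledEnergy (hrepw n) (by linarith [hn.1] : 0 < s n)
      (hR0 n).le hn.2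
    rw [← hEn] at this
    exact this.trans (hEB n)
  · refine Eventually.of_forall fun n => ?_
    have e1 : ∫ y in -R n..R n, |p n y| = ∫ x in -L..L, |pv n x| := by
      have e2 : ∀ y, |p n y| = ε n ^ 2 * |pv n (ε n ^ 2 * y)| := fun y => by
        simp only [hp]; rw [abs_mul, abs_of_pos (pow_pos (hε n) 2)]
      simp only [e2]
      rw [intervalIntegral.integral_const_mul, intervalIntegral.integral_comp_mul_left
        (fun x => |pv n x|) (pow_pos (hε n) 2).ne', smul_eq_mul,
        mul_inv_cancel_left₀ (pow_pos (hε n) 2).ne', mul_neg, hεR n]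
    rw [e1]
    refine le_trans ?_ (le_max_left _ _)
    exact (ENNReal.ofReal_le_iff_le_toReal (hBV n).2.ne).1
      ((hrep n).ofReal_integral_abs_le_totalVariation hab)
  · refine Eventually.of_forall fun n => ⟨?_, ?_⟩
    · simp only [hR]
      rw [← neg_div]
      exact div_lt_div_of_pos_right (hx₁ n).1 (pow_pos (hε n) 2)
    · exact div_neg_of_neg_of_pos (hx₁ n).2 (pow_pos (hε n) 2)
  · refine Eventually.of_forall fun n => ⟨?_, ?_⟩
    · exact div_pos (hx₂ n).1 (pow_pos (hε n) 2)
    · exact div_lt_div_of_pos_right (hx₂ n).2 (pow_pos (hε n) 2)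
  · simp only [hu]
    rw [Real.sign_of_neg (hx₁ n).2]
  · simp only [hu]
    rw [Real.sign_of_pos (hx₂ n).1]
  · have h1 := ((hs2.const_mul (1 / 2)).add (hs2δ.const_mul 2)).mul hBt
    have h2 := (hε0.const_mul (2 * L)).add h1
    simp only [mul_zero, add_zero, zero_mul] at h2
    refine h2.congr fun n => ?_
    ring
  · filter_upwards [hεs, hEw] with n hn hEn
    have h1 : -R n ≤ x₁ n / ε n ^ 2 := by
      simp only [hR]
      rw [← neg_div]
      exact div_le_div_of_nonneg_right (hx₁ n).1.le (pow_pos (hε n) 2).le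
    have h2 : x₂ n / ε n ^ 2 ≤ R n :=
      div_le_div_of_nonneg_right (hx₂ n).2.le (pow_pos (hε n) 2).le
    have h3 : x₁ n / ε n ^ 2 ≤ x₂ n / ε n ^ 2 :=
      div_le_div_of_nonneg_right ((hx₁ n).2.trans (hx₂ n).1).le (pow_pos (hε n) 2).le
    refine (integral_min_max_le (s := s n) (hrepw n) (by linarith [hn.1]) (hε n) (Real.exp_pos _) h1 h3
      h2).trans ?_
    rw [hεR n, ← hEn]
    have h4 : s n ^ 2 * E n ≤ s n ^ 2 * B n := mul_le_mul_of_nonneg_left (hEB n) (sq_nonneg _)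
    have h5 : 0 ≤ ε n / 2 + 2 * δ n := by
      have := Real.exp_pos (-2 * s n)
      have := hε n
      positivity
    have := mul_le_mul_of_nonneg_left h4 h5
    linarith

end

end PeronaMalik

/-! ### The main theorem. -/

open PeronaMalik in
theorem theorem3p1
    (L : ℝ) (hL : 0 < L)
    (ε : ℕ → ℝ) (hε : ∀ n, 0 < ε n) (hε0 : Filter.Tendsto ε Filter.atTop (𝓝 0))
    -- `v n` is the continuous representative of a function in `H²((-L, L))`
    (v : ℕ → ℝ → ℝ) (hv : ∀ n, PeronaMalik.MemH2 (Set.Ioo (-L) L) (v n))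
    (hvc : ∀ n, ContinuousOn (v n) (Set.Icc (-L) L))
    (hv0 : ∀ n, v n 0 = 0)
    (V : ℝ) (hV : 0 < V) (τ₀ : ℝ) (hτ₀ : τ₀ ∈ Set.Ioo (-1 : ℝ) 1)
    (hstrict : PeronaMalik.StrictTendstoBV (Set.Ioo (-L) L) v
      (fun y => V * (Real.sign y - τ₀)))
    (ℓ : ℝ)
    (hlim : Filter.Tendsto (fun n => PeronaMalik.RPM (ε n) (Set.Ioo (-L) L) (v n))
      Filter.atTop (𝓝 ℓ))
    (hℓ : ℓ ≤ PeronaMalik.alpha0 * Real.sqrt (2 * V))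
    (w : ℕ → ℝ → ℝ) (hw : ∀ n y, w n y = v n (ε n ^ 2 * y))
    (Λ : ℝ) (hΛ : Λ = Real.sqrt 3 / 2 * Real.sqrt (2 * V)) :
    -- uniform convergence on `|y| ≤ L / ε_n²`: the maximum exists and tends to zero
    (∃ m : ℕ → ℝ,
      (∀ n, IsGreatest ((fun y => |w n y - PeronaMalik.cubicTranslate Λ V τ₀ y|) ''
        {y : ℝ | |y| ≤ L / ε n ^ 2}) (m n)) ∧
      Filter.Tendsto m Filter.atTop (𝓝 0)) ∧
    ∀ a b : ℝ, a < b →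
      -- for `n` large `w n` is a differentiable function in `H²((a, b))`
      (∀ᶠ n in Filter.atTop, DifferentiableOn ℝ (w n) (Set.Ioo a b) ∧
        PeronaMalik.MemH2 (Set.Ioo a b) (w n)) ∧
      -- uniform convergence of the first derivatives
      TendstoUniformlyOn (fun n => deriv (w n)) (deriv (PeronaMalik.cubicTranslate Λ V τ₀))
        Filter.atTop (Set.Ioo a b) ∧
      -- strong convergence in `L²((a, b))` of the second derivatives
      Filter.Tendsto
        (fun n => MeasureTheory.eLpNorm
          (fun y => PeronaMalik.weakDeriv (Set.Ioo a b)
              (PeronaMalik.weakDeriv (Set.Ioo a b) (w n)) y -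
            deriv (deriv (PeronaMalik.cubicTranslate Λ V τ₀)) y)
          2 (MeasureTheory.volume.restrict (Set.Ioo a b)))
        Filter.atTop (𝓝 0) := by
  obtain rfl : w = fun n y => v n (ε n ^ 2 * y) := funext fun n => funext (hw n)
  have hΛ0 : 0 < Λ := by rw [hΛ]; positivity
  obtain ⟨δ, κ, B, T, θ, y₁, y₂, p, r, hopt⟩ :=
    exists_almostOptimal hL hε hε0 hv hvc hv0 hV hstrict hlim hℓ
  obtain ⟨α, β, hbump, hJ⟩ := hopt.exists_isBump
  have h : AlmostOptimalBump V τ₀ (fun n => L / ε n ^ 2) δ κ B T θ y₁ y₂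
      (fun n y => v n (ε n ^ 2 * y)) p r α β := ⟨hopt, hbump, hJ⟩
  set R : ℕ → ℝ := fun n => L / ε n ^ 2 with hR
  have hset : ∀ n, {y : ℝ | |y| ≤ R n} = Icc (-R n) (R n) := fun n => by
    ext y; exact (abs_le : |y| ≤ R n ↔ _)
  have hR0 : ∀ n, 0 < R n := fun n => div_pos hL (pow_pos (hε n) 2)
  have huc : Continuous (cubicTranslate Λ V τ₀) :=
    continuous_iff_continuousAt.2 fun x => (hasDerivAt_cubicTranslate x).continuousAt
  refine ⟨?_, fun a b hab => ?_⟩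
  · have hex : ∀ n, ∃ m, IsGreatest ((fun y => |v n (ε n ^ 2 * y) - cubicTranslate Λ V τ₀ y|) ''
        {y : ℝ | |y| ≤ R n}) m := fun n => by
      rw [hset n]
      refine (isCompact_Icc.image_of_continuousOn ?_).exists_isGreatest
        ((nonempty_Icc.2 (by linarith [hR0 n])).image _)
      exact ((h.rep n).continuousOn.sub huc.continuousOn).abs
    choose m hm using hex
    obtain ⟨e, he, hle⟩ := h.exists_tendsto_uniform hτ₀ hΛ
    refine ⟨m, hm, squeeze_zero' (Eventually.of_forall fun n => ?_) ?_ he⟩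
    · obtain ⟨y, -, hy⟩ := (hm n).1
      rw [← hy]; exact abs_nonneg _
    · filter_upwards [hle] with n hn
      obtain ⟨y, hyR, hy⟩ := (hm n).1
      rw [← hy]
      exact hn y (by rwa [hset n] at hyR)
  set A : ℝ := max |a| |b| with hA
  have hsubA : Icc a b ⊆ Icc (-A) A := fun x hx =>
    ⟨by linarith [neg_abs_le a, le_max_left |a| |b|, hx.1],
      by linarith [le_abs_self b, le_max_right |a| |b|, hx.2]⟩
  have hin : ∀ᶠ n in atTop, Icc a b ⊆ Icc (-R n) (R n) ∧ Ioo a b ⊆ Ioo (-R n) (R n) := by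
    filter_upwards [h.R_tendsto.eventually_ge_atTop A] with n hn
    have hs : Icc a b ⊆ Icc (-R n) (R n) := hsubA.trans (Icc_subset_Icc (by linarith) hn)
    exact ⟨hs, by simpa using interior_mono hs⟩
  refine ⟨?_, ?_, ?_⟩
  · filter_upwards [hin] with n hn
    exact ⟨fun x hx => ((h.rep n).hasDerivAt (hn.2 hx)).differentiableAt.differentiableWithinAt,
      ((h.rep n).mono hn.1).memH2 hab⟩
  · obtain ⟨e, he, hle⟩ := h.exists_tendsto_deriv hτ₀ hΛ A
    rw [Metric.tendstoUniformlyOn_iff]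
    intro η hη
    filter_upwards [hin, hle, he.eventually_lt_const hη] with n hn hn' hηn x hx
    rw [((h.rep n).hasDerivAt (hn.2 hx)).deriv, dist_comm, Real.dist_eq]
    exact (hn'.2 x (hsubA (Ioo_subset_Icc_self hx))).trans_lt hηn
  · obtain ⟨H, hH, hHle⟩ := h.exists_tendsto_second_deriv hτ₀ hΛ
    set g := cubicSecondDeriv (2 * V) (-cubicShift Λ V τ₀ - Λ) (-cubicShift Λ V τ₀ + Λ) with hg
    have hup : Tendsto (fun n => ENNReal.ofReal √(H n)) atTop (𝓝 0) := by
      simpa using ENNReal.tendsto_ofReal hH.sqrt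
    refine tendsto_of_tendsto_of_tendsto_of_le_of_le' tendsto_const_nhds hup
      (Eventually.of_forall fun n => zero_le) ?_
    filter_upwards [hin, hHle] with n hn hHn
    have hrep := (h.rep n).mono hn.1
    -- The weak derivatives on (a, b) are chosen independently of those on the larger interval;
    -- uniqueness identifies them with `r n` almost everywhere.
    have hae := (hrep.hasWeakDeriv_left hab).weakDeriv_weakDeriv_ae_eq isOpen_Ioo
      (hrep.hasWeakDeriv_right hab)
    have hae' := ae_restrict_of_ae (s := Ioo a b)
      (deriv_deriv_cubicTranslate_ae_eq (V := V) (τ₀ := τ₀) hΛ0)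
    have hint : Integrable fun x => (r n x - g x) ^ 2 :=
      integrable_sub_cubicSecondDeriv_sq hrep _ _ _
    refine (eLpNorm_congr_ae (hae.sub hae')).trans_le ?_
    have hmem : MemLp (fun x => r n x - g x) 2 volume :=
      (memLp_two_iff_integrable_sq (hrep.integrable.sub
        (integrable_cubicSecondDeriv _ _ _)).aestronglyMeasurable).2 hint
    refine eLpNorm_two_le_ofReal_sqrt (hmem.restrict _) (le_trans ?_ hHn)
    rw [intervalIntegral.integral_of_le (by linarith [hR0 n]), integral_Ioc_eq_integral_Ioo]
    exact setIntegral_mono_set hint.integrableOn (ae_of_all _ fun x => sq_nonneg _)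
      (ae_of_all _ hn.2)

end
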